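/- Let $k$ be an algebraically closed field of characteristic zero, $H$ a finite dimensional semisimple Hopf algebra over $k$ (so its antipode $S$ is bijective) with counit $\varepsilon$ and comultiplication $h\mapsto h_{(1)}\otimes h_{(2)}$, and $A=\bigoplus_{n\in\mathbb Z}A^n$ a dg $H$-module algebra, i.e. a cochain dg $k$-algebra that is an $H$-module algebra, $h(ab)=(h_{(1)}a)(h_{(2)}b)$ and $h1=\varepsilon(h)1$, with $hA^n\subseteq A^n$ and $d(ha)=h\,d(a)$. The smash product $A\#H=A\otimes H$, with product $(a\#h)(b\#g)=a(h_{(1)}b)\#h_{(2)}g$, grading $A^n\otimes H$ and differential $d\otimes\mathrm{id}$, is a dg algebra. For a dg $A\#H$-module $M$ let $M\otimes H$ be the dg $A\#H$-module with $(a\#h)(m\otimes w)=(a\#h_{(1)})m\otimes h_{(2)}w$ and differential $d\otimes\mathrm{id}$. For dg modules $P,Q$ over a dg algebra $B$, $\mathrm{Hom}_B(P,Q)=\bigoplus_i\mathrm{Hom}^i_B(P,Q)$ is the complex of graded $B$-module maps $f$ of degree $i$, $f(bp)=(-1)^{i|b|}bf(p)$, with $d(f)=d_Q f-(-1)^{i}f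 d_P$; $P$ is K-projective if $\mathrm{Hom}_B(P,X)$ is acyclic for every acyclic dg $B$-module $X$; and $\mathrm{Ext}^*_B(M,N)=H^*(\mathrm{Hom}_B(P,Q))$ for K-projective resolutions $P\to M$, $Q\to N$. For $M=N$, $P=Q$ this is a graded algebra with the product induced by $f*g=(-1)^{|f||g|}g\circ f$. Every K-projective dg $A\#H$-module is K-projective as a dg $A$-module. Hence for dg $A\#H$-modules $M,N$ with K-projective resolutions $P,Q$ over $A\#H$ one has $\mathrm{Ext}^*_A(M,N)=H^*(\mathrm{Hom}_A(P,Q))$; it is a graded $H$-module under the action induced by $(h\rightharpoonup f)(p)=h_{(2)}f(S^{-1}(h_{(1)})p)$, and $\mathrm{Ext}^*_A(M,M)$ is a graded $H$-module algebra. Writing $X^H=\{x\in X: hx=\varepsilon(h)x \text{ for all } h\in H\}$, for all dg $A\#H$-modules $M,N$ and all choices of the resolutions: (i) $\mathrm{Ext}^*_{A\#H}(M,N)\cong\mathrm{Ext}^*_A(M,N)^H$ as graded vector spaces; (ii) $\mathrm{Ext}^*_{A\#H}(M,M)\cong\mathrm{Ext}^*_A(M,M)^H$ as graded algebras; (iii)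 $\mathrm{Ext}^*_{A\#H}(M\otimes H,M\otimes H)\cong\mathrm{Ext}^*_A(M,M)\#H$ as graded algebras, where $\mathrm{Ext}^i_A(M,M)\otimes H$ is the degree $i$ part of the right-hand side. -/

import Mathlib

universe u

namespace DGHopf
open scoped TensorProduct DirectSum
open Coalgebra HopfAlgebra WithConv
section Hopf
variable (k : Type u) [Field k] (H : Type u) [Ring H] [HopfAlgebra k H]

/-- Contraction of the left tensor factor with a functional. -/
noncomputable def cut (g : H →ₗ[k] k) : H ⊗[k] H →ₗ[k] H :=
  (TensorProduct.lid k H).toLinearMap ∘ₗ g.rTensor H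

variable {k H}

theorem exists_integral [IsSemisimpleRing H] :
    ∃ t : H, counit (R := k) t = 1 ∧ ∀ h : H, h * t = counit (R := k) h • t := by
  let I : Submodule H H := RingHom.ker (Bialgebra.counitAlgHom k H)
  obtain ⟨J, hJ⟩ := exists_isCompl I
  have h1 : (1 : H) ∈ I ⊔ J := by rw [hJ.sup_eq_top]; trivial
  obtain ⟨e, he, t, ht, het⟩ := Submodule.mem_sup.1 h1
  have memI : ∀ x : H, x ∈ I ↔ counit (R := k) x = 0 := fun x => Iff.rfl
  have hεt : counit (R := k) t = 1 := by
    have := congrArg (counit (R := k)) het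
    rw [map_add, (memI e).1 he, zero_add, Bialgebra.counit_one] at this
    exact this
  refine ⟨t, hεt, fun h => ?_⟩
  rw [← sub_eq_zero]
  have hJ' : h * t - counit (R := k) h • t ∈ J := by
    refine J.sub_mem (J.smul_mem h ht) ?_
    rw [Algebra.smul_def]
    exact J.smul_mem _ ht
  have hI' : h * t - counit (R := k) h • t ∈ I := by
    rw [memI]; simp [hεt]
  have := hJ.inf_eq_bot ▸ (Submodule.mem_inf.2 ⟨hI', hJ'⟩)
  simpa using this

theorem antipode_tmul_one_mul_comul (h : H) :
    ∑ i ∈ (ℛ k h).index, (antipode k ((ℛ k h).left i) ⊗ₜ[k] (1 : H)) * comul ((ℛ k h).right i)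
      = (1 : H) ⊗ₜ[k] h := by
  let i1 : H →ₐ[k] H ⊗[k] H := Algebra.TensorProduct.includeLeft
  let i2 : H →ₐ[k] H ⊗[k] H := Algebra.TensorProduct.includeRight
  have e1 : toConv (i1.toLinearMap ∘ₗ antipode k) * toConv i1.toLinearMap = 1 := by
    ext c
    rw [(ℛ k c).convMul_apply]
    have := congrArg i1 (sum_antipode_mul_eq_algebraMap_counit (ℛ k c))
    simpa [map_sum] using this
  have e2 : toConv i1.toLinearMap * toConv i2.toLinearMap =
      toConv (comul : H →ₗ[k] H ⊗[k] H) := by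
    ext c
    rw [(ℛ k c).convMul_apply]
    simp [i1, i2, (ℛ k c).eq]
  have e3 : toConv (i1.toLinearMap ∘ₗ antipode k) * toConv (comul : H →ₗ[k] H ⊗[k] H) =
      toConv i2.toLinearMap := by
    rw [← e2, ← mul_assoc, e1, one_mul]
  have e4 := congrArg (fun f => f.ofConv h) e3
  simp only [(ℛ k h).convMul_apply] at e4
  simpa [i1, i2] using e4

theorem one_tmul_mul_comul_integral {t : H} (ht : ∀ h : H, h * t = counit (R := k) h • t) (h : H) :
    ((1 : H) ⊗ₜ[k] h) * comul t = (antipode k h ⊗ₜ[k] (1 : H)) * comul t := by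
  rw [← antipode_tmul_one_mul_comul, Finset.sum_mul]
  simp_rw [mul_assoc, ← Bialgebra.comul_mul, ht, map_smul, mul_smul_comm, ← smul_mul_assoc,
    ← Finset.sum_mul]
  congr 1
  simp_rw [TensorProduct.smul_tmul', ← map_smul, ← TensorProduct.sum_tmul, ← map_sum]
  congr 2
  have := congrArg (TensorProduct.rid k H) (Coalgebra.sum_tmul_counit_eq (ℛ k h))
  simpa only [map_sum, TensorProduct.rid_tmul, one_smul] using this

theorem antipode_injective [FiniteDimensional k H] [IsSemisimpleRing H] :
    Function.Injective (antipode k : H →ₗ[k] H) := by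
  obtain ⟨t, h1, ht⟩ := exists_integral (k := k) (H := H)
  rw [← LinearMap.ker_eq_bot, LinearMap.ker_eq_bot']
  intro h hh
  let b := Module.finBasis k H
  have hz : ∀ z : H ⊗[k] H, z = ∑ i, b i ⊗ₜ[k] cut k H (b.coord i) z := by
    intro z
    induction z with
    | zero => simp
    | add x y hx hy =>
      simp only [map_add, TensorProduct.tmul_add, Finset.sum_add_distrib]
      rw [← hx, ← hy]
    | tmul x y =>
      simp only [cut, LinearMap.comp_apply, LinearMap.rTensor_tmul, LinearEquiv.coe_coe,
        TensorProduct.lid_tmul, ← TensorProduct.smul_tmul, ← TensorProduct.sum_tmul]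
      simp [b.sum_repr]
  have hcut : ∀ (g : H →ₗ[k] k) (x : H) (z : H ⊗[k] H),
      x * cut k H g z = cut k H g (((1 : H) ⊗ₜ[k] x) * z) := by
    intro g x z
    induction z with
    | zero => simp
    | add y z hy hz => simp only [map_add, mul_add, hy, hz]
    | tmul y z => simp [cut]
  have key := mul_antipode_rTensor_comul_apply (R := k) t
  rw [hz (comul t)] at key
  simp only [map_sum, LinearMap.rTensor_tmul, LinearMap.mul'_apply, h1, map_one] at key
  calc h = h * 1 := (mul_one h).symm
    _ = 0 := by
      rw [← key, Finset.mul_sum]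
      refine Finset.sum_eq_zero fun i _ => ?_
      rw [← mul_assoc, hcut, one_tmul_mul_comul_integral ht, antipode_mul_antidistrib, hh,
        mul_zero, TensorProduct.zero_tmul, zero_mul, map_zero]


variable (k H) in
/-- The inverse of the antipode. -/
noncomputable def antipodeInv [FiniteDimensional k H] [IsSemisimpleRing H] : H →ₗ[k] H :=
  (LinearEquiv.ofBijective (antipode k : H →ₗ[k] H)
    ⟨antipode_injective, LinearMap.surjective_of_injective antipode_injective⟩).symm.toLinearMap

section inv
variable [FiniteDimensional k H] [IsSemisimpleRing H]

theorem antipode_antipodeInv (h : H) : antipode k (antipodeInv k H h) = h :=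
  (LinearEquiv.ofBijective (antipode k : H →ₗ[k] H)
    ⟨antipode_injective, LinearMap.surjective_of_injective antipode_injective⟩).apply_symm_apply h

theorem antipodeInv_one : antipodeInv k H 1 = 1 :=
  antipode_injective (k := k) (by rw [antipode_antipodeInv, antipode_one])

theorem antipodeInv_mul (g h : H) :
    antipodeInv k H (g * h) = antipodeInv k H h * antipodeInv k H g :=
  antipode_injective (k := k) (by
    rw [antipode_antipodeInv, antipode_mul_antidistrib, antipode_antipodeInv,
      antipode_antipodeInv])

theorem sum_antipodeInv_right_mul_left (h : H) :
    ∑ i ∈ (ℛ k h).index, antipodeInv k H ((ℛ k h).right i) * (ℛ k h).left i =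
      algebraMap k H (counit h) :=
  antipode_injective (k := k) (by
    rw [map_sum]
    simp only [antipode_mul_antidistrib, antipode_antipodeInv]
    rw [sum_antipode_mul_eq_algebraMap_counit, Algebra.algebraMap_eq_smul_one, map_smul,
      antipode_one])

theorem sum_right_mul_antipodeInv_left (h : H) :
    ∑ i ∈ (ℛ k h).index, (ℛ k h).right i * antipodeInv k H ((ℛ k h).left i) =
      algebraMap k H (counit h) :=
  antipode_injective (k := k) (by
    rw [map_sum]
    simp only [antipode_mul_antidistrib, antipode_antipodeInv]
    rw [sum_mul_antipode_eq_algebraMap_counit, Algebra.algebraMap_eq_smul_one, map_smul,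
      antipode_one])

end inv

theorem coassoc3 {X : Type*} [AddCommGroup X] [Module k X] (φ : H → H → H → X)
    (h1 : ∀ y z, IsLinearMap k fun x => φ x y z) (h2 : ∀ x z, IsLinearMap k fun y => φ x y z)
    (h3 : ∀ x y, IsLinearMap k fun z => φ x y z) (h : H) :
    ∑ i ∈ (ℛ k h).index, ∑ j ∈ (ℛ k ((ℛ k h).left i)).index,
      φ ((ℛ k ((ℛ k h).left i)).left j) ((ℛ k ((ℛ k h).left i)).right j) ((ℛ k h).right i) =
    ∑ i ∈ (ℛ k h).index, ∑ j ∈ (ℛ k ((ℛ k h).right i)).index,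
      φ ((ℛ k h).left i) ((ℛ k ((ℛ k h).right i)).left j)
        ((ℛ k ((ℛ k h).right i)).right j) := by
  let Φ : H →ₗ[k] H ⊗[k] H →ₗ[k] X :=
    { toFun := fun x => TensorProduct.lift (LinearMap.mk₂ k (φ x)
        (fun y y' z => (h2 x z).map_add y y') (fun c y z => (h2 x z).map_smul c y)
        (fun y z z' => (h3 x y).map_add z z') (fun c y z => (h3 x y).map_smul c z))
      map_add' := fun x x' => TensorProduct.ext' fun y z => by
        simpa using (h1 y z).map_add x x'
      map_smul' := fun c x => TensorProduct.ext' fun y z => by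
        simpa using (h1 y z).map_smul c x }
  have := congrArg (TensorProduct.lift Φ) (Coalgebra.sum_tmul_tmul_eq (ℛ k h)
    (fun i => ℛ k ((ℛ k h).left i)) (fun i => ℛ k ((ℛ k h).right i)))
  simpa only [map_sum, TensorProduct.lift.tmul, Φ, LinearMap.coe_mk, AddHom.coe_mk,
    LinearMap.mk₂_apply] using this

theorem sum_counit_left {X : Type*} [AddCommGroup X] [Module k X] (f : H →ₗ[k] X) (h : H) :
    ∑ i ∈ (ℛ k h).index, counit (R := k) ((ℛ k h).left i) • f ((ℛ k h).right i) = f h := by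
  simp_rw [← map_smul, ← map_sum, sum_counit_smul]

theorem sum_counit_right {X : Type*} [AddCommGroup X] [Module k X] (f : H →ₗ[k] X) (h : H) :
    ∑ i ∈ (ℛ k h).index, counit (R := k) ((ℛ k h).right i) • f ((ℛ k h).left i) = f h := by
  simp_rw [← map_smul, ← map_sum]
  have := congrArg (TensorProduct.rid k H) (Coalgebra.sum_tmul_counit_eq (ℛ k h))
  congr 1
  simpa only [map_sum, TensorProduct.rid_tmul, one_smul] using this

end Hopf

section Smash
variable (k : Type u) [Field k] (H : Type u) [Ring H] [HopfAlgebra k H]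

/-- `B` is an `H`-module algebra: `h (a b) = h₍₁₎(a) h₍₂₎(b)` and `h 1 = ε(h) 1`. Here and below
`ℛ k h` is a chosen presentation `Δ(h) = ∑ left i ⊗ right i`, i.e. `h₍₁₎ ⊗ h₍₂₎`. -/
class IsModuleAlgebra (B : Type u) [Ring B] [Algebra k B] [Module H B] [IsScalarTower k H B] :
    Prop where
  smul_mul : ∀ (h : H) (a b : B), h • (a * b) =
    ∑ i ∈ (ℛ k h).index, ((ℛ k h).left i • a) * ((ℛ k h).right i • b)
  smul_one : ∀ h : H, h • (1 : B) = algebraMap k B (counit h)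

variable {k H}
variable {B : Type u} [Ring B] [Algebra k B] {M : Type u} [AddCommGroup M] [Module k M]

variable (H) in
/-- The representation `b ↦ α(b) ⊗ id` on `M ⊗ H`. -/
noncomputable def tensorLeft (α : B →ₐ[k] Module.End k M) : B →ₐ[k] Module.End k (M ⊗[k] H) :=
  ((Module.endTensorEndAlgHom (R := k) (S := k) (A := k) (M := M) (N := H)).comp
    Algebra.TensorProduct.includeLeft).comp α

/-- The diagonal representation `h ↦ β(h₍₁₎) ⊗ (h₍₂₎ ·)` on `M ⊗ H`. -/
noncomputable def tensorDiag (β : H →ₐ[k] Module.End k M) : H →ₐ[k] Module.End k (M ⊗[k] H) :=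
  ((Module.endTensorEndAlgHom (R := k) (S := k) (A := k) (M := M) (N := H)).comp
    (Algebra.TensorProduct.map β (Algebra.lmul k H))).comp (Bialgebra.comulAlgHom k H)

theorem tensorLeft_apply (α : B →ₐ[k] Module.End k M) (b : B) (m : M) (w : H) :
    tensorLeft H α b (m ⊗ₜ w) = α b m ⊗ₜ w := rfl

theorem tensorDiag_eq (β : H →ₐ[k] Module.End k M) (h : H) :
    tensorDiag β h = ∑ i ∈ (ℛ k h).index,
      TensorProduct.map (β ((ℛ k h).left i)) (LinearMap.mulLeft k ((ℛ k h).right i)) := by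
  change Module.endTensorEndAlgHom (R := k) (S := k) (A := k)
    (Algebra.TensorProduct.map β (Algebra.lmul k H) (comul h)) = _
  conv_lhs => rw [← (ℛ k h).eq]
  rw [map_sum, map_sum]
  rfl

theorem tensorDiag_apply (β : H →ₐ[k] Module.End k M) (h : H) (m : M) (w : H) :
    tensorDiag β h (m ⊗ₜ w) = ∑ i ∈ (ℛ k h).index,
      β ((ℛ k h).left i) m ⊗ₜ[k] ((ℛ k h).right i * w) := by
  rw [tensorDiag_eq, LinearMap.sum_apply]
  rfl

/-- The linear map `a ⊗ h ↦ α(a) β(h)`. -/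
noncomputable def smashAct (α : B →ₐ[k] Module.End k M) (β : H →ₐ[k] Module.End k M) :
    B ⊗[k] H →ₗ[k] Module.End k M :=
  TensorProduct.lift ((LinearMap.mul k (Module.End k M)).compl₁₂ α.toLinearMap β.toLinearMap)

theorem smashAct_tmul (α : B →ₐ[k] Module.End k M) (β : H →ₐ[k] Module.End k M) (b : B) (h : H) :
    smashAct α β (b ⊗ₜ h) = α b * β h := rfl

variable [Module H B] [IsScalarTower k H B]

/-- Covariance of a pair of representations: `β(h) α(b) = α(h₍₁₎ b) β(h₍₂₎)`. -/
def Covariant (α : B →ₐ[k] Module.End k M) (β : H →ₐ[k] Module.End k M) : Prop :=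
  ∀ (h : H) (b : B), β h * α b =
    ∑ i ∈ (ℛ k h).index, α ((ℛ k h).left i • b) * β ((ℛ k h).right i)

theorem covariant_tensor {α : B →ₐ[k] Module.End k M} {β : H →ₐ[k] Module.End k M}
    (hc : Covariant α β) : Covariant (tensorLeft H α) (tensorDiag β) := by
  intro h b
  refine TensorProduct.ext' fun m w => ?_
  simp only [Module.End.mul_apply, tensorLeft_apply, tensorDiag_apply, LinearMap.sum_apply,
    map_sum]
  have hc' : ∀ x : H, β x (α b m) = ∑ i ∈ (ℛ k x).index,
      α ((ℛ k x).left i • b) (β ((ℛ k x).right i) m) := fun x => by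
    have := LinearMap.congr_fun (hc x b) m
    simpa using this
  simp only [hc', TensorProduct.sum_tmul]
  exact coassoc3 (fun x y z => α (x • b) (β y m) ⊗ₜ[k] (z * w))
    (fun y z => ⟨fun x x' => by simp [add_smul, TensorProduct.add_tmul],
      fun c x => by simp [TensorProduct.smul_tmul']⟩)
    (fun y z => ⟨fun x x' => by simp [TensorProduct.add_tmul],
      fun c x => by simp [TensorProduct.smul_tmul']⟩)
    (fun y z => ⟨fun x x' => by simp [add_mul, TensorProduct.tmul_add],
      fun c x => by simp⟩) h


variable (k H B) in
/-- The underlying vector space `B ⊗ H` of the smash product `B # H`. -/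
def Smash : Type u := B ⊗[k] H

noncomputable instance : AddCommGroup (Smash k H B) := inferInstanceAs (AddCommGroup (B ⊗[k] H))
noncomputable instance : Module k (Smash k H B) := inferInstanceAs (Module k (B ⊗[k] H))

variable (k H B) in
/-- Left multiplications of the smash product, `(a # h) (b # g) = a h₍₁₎(b) # h₍₂₎ g`. -/
noncomputable def smashMul : B ⊗[k] H →ₗ[k] Module.End k (B ⊗[k] H) :=
  smashAct (tensorLeft H (Algebra.lmul k B)) (tensorDiag (Algebra.lsmul k k B))

theorem smashMul_tmul (a b : B) (h g : H) :
    smashMul k H B (a ⊗ₜ h) (b ⊗ₜ g) =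
      ∑ i ∈ (ℛ k h).index, (a * ((ℛ k h).left i • b)) ⊗ₜ[k] ((ℛ k h).right i * g) := by
  rw [smashMul, smashAct_tmul, Module.End.mul_apply, tensorDiag_apply, map_sum]
  rfl

theorem smashAct_smashMul {α : B →ₐ[k] Module.End k M} {β : H →ₐ[k] Module.End k M}
    (hc : Covariant α β) (x y : B ⊗[k] H) :
    smashAct α β (smashMul k H B x y) = smashAct α β x * smashAct α β y := by
  induction x with
  | zero => simp
  | add x x' hx hx' => simp only [map_add, LinearMap.add_apply, hx, hx', add_mul]
  | tmul a h =>
    induction y with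
    | zero => simp
    | add y y' hy hy' => simp only [map_add, hy, hy', mul_add]
    | tmul b g =>
      rw [smashMul_tmul, map_sum]
      simp only [smashAct_tmul, map_mul]
      rw [mul_assoc, ← mul_assoc (β h), hc h b, Finset.sum_mul, Finset.mul_sum]
      simp only [mul_assoc]

theorem covariant_self [IsModuleAlgebra k H B] :
    Covariant (Algebra.lmul k B) (Algebra.lsmul k k B : H →ₐ[k] Module.End k B) := by
  intro h b
  refine LinearMap.ext fun c => ?_
  simp only [Module.End.mul_apply, LinearMap.sum_apply]
  exact IsModuleAlgebra.smul_mul h b c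

theorem smashMul_one (x : B ⊗[k] H) [IsModuleAlgebra k H B] : smashMul k H B x (1 ⊗ₜ 1) = x := by
  induction x with
  | zero => simp
  | add x x' hx hx' => simp only [map_add, LinearMap.add_apply, hx, hx']
  | tmul a h =>
    rw [smashMul_tmul]
    simp only [IsModuleAlgebra.smul_one (k := k), mul_one, Algebra.algebraMap_eq_smul_one,
      mul_smul_comm, TensorProduct.smul_tmul, ← TensorProduct.tmul_sum, sum_counit_smul]

theorem smashMul_one_left : smashMul k H B (1 ⊗ₜ 1) = 1 := by
  rw [smashMul, smashAct_tmul, map_one, map_one, one_mul]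

/-- The smash product `B # H` of an `H`-module algebra `B` with `H`. -/
noncomputable instance [IsModuleAlgebra k H B] : Ring (Smash k H B) :=
  { (inferInstance : AddCommGroup (Smash k H B)) with
    mul := fun x y => smashMul k H B x y
    one := (1 : B) ⊗ₜ[k] (1 : H)
    left_distrib := fun x y z => map_add (smashMul k H B x) y z
    right_distrib := fun x y z => LinearMap.congr_fun (map_add (smashMul k H B) x y) z
    zero_mul := fun x => LinearMap.congr_fun (map_zero (smashMul k H B)) x
    mul_zero := fun x => map_zero (smashMul k H B x)
    mul_assoc := fun x y z =>
      LinearMap.congr_fun (smashAct_smashMul (covariant_tensor covariant_self) x y) z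
    one_mul := fun x => LinearMap.congr_fun smashMul_one_left x
    mul_one := fun x => smashMul_one x }

noncomputable instance [IsModuleAlgebra k H B] : Algebra k (Smash k H B) :=
  Algebra.ofModule
    (fun c x y => LinearMap.congr_fun (map_smul (smashMul k H B) c x) y)
    (fun c x y => map_smul (smashMul k H B x) c y)

variable (k) in
/-- The element `b # h`. -/
noncomputable def smashMk (b : B) (h : H) : Smash k H B := b ⊗ₜ[k] h

section
variable [IsModuleAlgebra k H B]

theorem smash_mul_def (x y : Smash k H B) : x * y = smashMul k H B x y := rfl
theorem smash_one_def : (1 : Smash k H B) = smashMk k 1 1 := rfl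

variable (k H B) in
/-- The inclusion `b ↦ b # 1`. -/
noncomputable def smashInl : B →ₐ[k] Smash k H B :=
  AlgHom.ofLinearMap ((TensorProduct.mk k B H).flip 1) rfl (fun a b => by
    change (a * b) ⊗ₜ[k] (1 : H) = smashMul k H B (a ⊗ₜ 1) (b ⊗ₜ 1)
    rw [smashMul, smashAct_tmul, map_one, mul_one]
    rfl)

variable (k H B) in
/-- The inclusion `h ↦ 1 # h`. -/
noncomputable def smashInr : H →ₐ[k] Smash k H B :=
  AlgHom.ofLinearMap (TensorProduct.mk k B H 1) rfl (fun h g => by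
    change (1 : B) ⊗ₜ[k] (h * g) = smashMul k H B (1 ⊗ₜ h) (1 ⊗ₜ g)
    rw [smashMul_tmul]
    simp only [IsModuleAlgebra.smul_one (k := k), one_mul, Algebra.algebraMap_eq_smul_one,
      TensorProduct.smul_tmul, ← TensorProduct.tmul_sum, ← smul_mul_assoc, ← Finset.sum_mul,
      sum_counit_smul])

theorem smashInl_mul_smashInr (b : B) (h : H) :
    smashInl k H B b * smashInr k H B h = smashMk k b h := by
  change smashMul k H B (b ⊗ₜ 1) (1 ⊗ₜ h) = b ⊗ₜ h
  rw [smashMul, smashAct_tmul, map_one, mul_one, tensorLeft_apply]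
  simp

theorem smashInr_mul_smashInl (h : H) (b : B) :
    smashInr k H B h * smashInl k H B b =
      ∑ i ∈ (ℛ k h).index, smashInl k H B ((ℛ k h).left i • b) * smashInr k H B ((ℛ k h).right i) := by
  simp only [smashInl_mul_smashInr]
  change smashMul k H B (1 ⊗ₜ h) (b ⊗ₜ 1) = _
  rw [smashMul_tmul]
  simp only [one_mul, mul_one]
  rfl

/-- The action of `B # H` coming from a covariant pair. -/
noncomputable def smashLift {α : B →ₐ[k] Module.End k M} {β : H →ₐ[k] Module.End k M}
    (hc : Covariant α β) : Smash k H B →ₐ[k] Module.End k M :=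
  AlgHom.ofLinearMap (smashAct α β)
    (by change smashAct α β (1 ⊗ₜ 1) = 1; rw [smashAct_tmul, map_one, map_one, one_mul])
    (fun x y => smashAct_smashMul hc x y)

end
end Smash

section Tensor
variable {k : Type u} [Field k] {V : Type u} [AddCommGroup V] [Module k V]
  (W : Type u) [AddCommGroup W] [Module k W]

/-- The grading of `V ⊗ W` induced by a grading of `V`, with `W` in degree zero. -/
def tensorGr (gr : ℤ → Submodule k V) (n : ℤ) : Submodule k (V ⊗[k] W) :=
  Submodule.span k {x | ∃ v ∈ gr n, ∃ w : W, x = v ⊗ₜ[k] w}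

theorem tensorGr_eq_range (gr : ℤ → Submodule k V) (n : ℤ) :
    tensorGr W gr n = LinearMap.range ((gr n).subtype.rTensor W) := by
  apply le_antisymm
  · rw [tensorGr, Submodule.span_le]
    rintro _ ⟨v, hv, w, rfl⟩
    exact ⟨(⟨v, hv⟩ : gr n) ⊗ₜ w, rfl⟩
  · rintro _ ⟨y, rfl⟩
    induction y with
    | zero => simp
    | add x y hx hy => rw [map_add]; exact Submodule.add_mem _ hx hy
    | tmul v w => exact Submodule.subset_span ⟨v, v.2, w, rfl⟩

theorem tensorGr_isInternal {gr : ℤ → Submodule k V} (h : DirectSum.IsInternal gr) :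
    DirectSum.IsInternal (tensorGr W gr) := by
  have hinj : ∀ n, Function.Injective ((gr n).subtype.rTensor W) := fun n =>
    Module.Flat.rTensor_preserves_injective_linearMap _ (gr n).injective_subtype
  let e1 : (⨁ n, gr n) ⊗[k] W ≃ₗ[k] V ⊗[k] W :=
    (LinearEquiv.ofBijective (DirectSum.coeLinearMap gr) h).rTensor W
  let e2 : (⨁ n, gr n) ⊗[k] W ≃ₗ[k] ⨁ n, (gr n ⊗[k] W) :=
    TensorProduct.directSumLeft k k (fun n => gr n) W
  let e3 : ∀ n, (gr n ⊗[k] W) ≃ₗ[k] tensorGr W gr n := fun n =>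
    (LinearEquiv.ofInjective _ (hinj n)).trans
      (LinearEquiv.ofEq _ _ (tensorGr_eq_range W gr n).symm)
  let e4 : (⨁ n, (gr n ⊗[k] W)) ≃ₗ[k] ⨁ n, tensorGr W gr n :=
    DFinsupp.mapRange.linearEquiv e3
  have key : DirectSum.coeLinearMap (tensorGr W gr) ∘ₗ (e2.trans e4).toLinearMap =
      e1.toLinearMap := by
    refine TensorProduct.ext ?_
    refine DirectSum.linearMap_ext k fun n => ?_
    refine LinearMap.ext fun v => LinearMap.ext fun w => ?_
    change DirectSum.coeLinearMap (tensorGr W gr) (e4 (e2 (DirectSum.lof k ℤ _ n v ⊗ₜ[k] w))) =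
      DirectSum.coeLinearMap gr (DirectSum.lof k ℤ _ n v) ⊗ₜ[k] w
    have h2 : e2 (DirectSum.lof k ℤ _ n v ⊗ₜ[k] w) = DirectSum.lof k ℤ _ n (v ⊗ₜ[k] w) :=
      TensorProduct.directSumLeft_tmul_lof ..
    have h4 : e4 (DirectSum.lof k ℤ _ n (v ⊗ₜ[k] w)) =
        DirectSum.lof k ℤ (fun n => tensorGr W gr n) n (e3 n (v ⊗ₜ[k] w)) :=
      DFinsupp.mapRange_single (hf := fun n => map_zero (e3 n))
    rw [h2, h4, DirectSum.coeLinearMap_lof, DirectSum.coeLinearMap_lof]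
    rfl
  have : Function.Bijective (DirectSum.coeLinearMap (tensorGr W gr)) := by
    have h2 : (DirectSum.coeLinearMap (tensorGr W gr)) =
        ((e2.trans e4).symm.trans e1).toLinearMap := by
      rw [LinearEquiv.coe_trans, ← key, LinearMap.comp_assoc]
      refine LinearMap.ext fun x => ?_
      simp
    rw [h2]
    exact LinearEquiv.bijective _
  exact this

end Tensor

/-- A (cochain) dg algebra over `k`. -/
structure DGAlgebra (k : Type u) [Field k] where
  carrier : Type u
  [ring : Ring carrier]
  [algebra : Algebra k carrier]
  gr : ℤ → Submodule k carrier
  isInternal : DirectSum.IsInternal gr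
  one_mem : (1 : carrier) ∈ gr 0
  mul_mem : ∀ {i j : ℤ} {a b : carrier}, a ∈ gr i → b ∈ gr j → a * b ∈ gr (i + j)
  d : carrier →ₗ[k] carrier
  d_mem : ∀ {i : ℤ} {a : carrier}, a ∈ gr i → d a ∈ gr (i + 1)
  d_d : ∀ a : carrier, d (d a) = 0
  d_mul : ∀ {i : ℤ} {a : carrier} (b : carrier), a ∈ gr i →
    d (a * b) = d a * b + i.negOnePow • (a * d b)

instance (k : Type u) [Field k] : CoeSort (DGAlgebra k) (Type u) := ⟨DGAlgebra.carrier⟩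
instance {k : Type u} [Field k] (A : DGAlgebra k) : Ring A := A.ring
instance {k : Type u} [Field k] (A : DGAlgebra k) : Algebra k A := A.algebra

/-- A left dg module over the dg algebra `A`. -/
structure DGModule {k : Type u} [Field k] (A : DGAlgebra k) where
  carrier : Type u
  [addCommGroup : AddCommGroup carrier]
  [moduleBase : Module k carrier]
  [module : Module A carrier]
  [isScalarTower : IsScalarTower k A carrier]
  gr : ℤ → Submodule k carrier
  isInternal : DirectSum.IsInternal gr
  smul_mem : ∀ {i j : ℤ} {a : A} {m : carrier}, a ∈ A.gr i → m ∈ gr j → a • m ∈ gr (i + j)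
  d : carrier →ₗ[k] carrier
  d_mem : ∀ {i : ℤ} {m : carrier}, m ∈ gr i → d m ∈ gr (i + 1)
  d_d : ∀ m : carrier, d (d m) = 0
  d_smul : ∀ {i : ℤ} {a : A} (m : carrier), a ∈ A.gr i →
    d (a • m) = A.d a • m + i.negOnePow • (a • d m)

section
variable {k : Type u} [Field k] {A : DGAlgebra k}

instance : CoeSort (DGModule A) (Type u) := ⟨DGModule.carrier⟩
instance (M : DGModule A) : AddCommGroup M := M.addCommGroup
instance (M : DGModule A) : Module k M := M.moduleBase
instance (M : DGModule A) : Module A M := M.module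
instance (M : DGModule A) : IsScalarTower k A M := M.isScalarTower

/-- `Hom_A^i(M,N)`: the graded `A`-module maps of degree `i`; as for every map of degree `i` of dg
modules, `A`-linearity carries the Koszul sign `f (a m) = (-1)^{i |a|} a f(m)`. -/
def homDeg (M N : DGModule A) (i : ℤ) : Submodule k (M →ₗ[k] N) where
  carrier := {f | (∀ (n : ℤ), ∀ m ∈ M.gr n, f m ∈ N.gr (n + i)) ∧
    ∀ (j : ℤ), ∀ a ∈ A.gr j, ∀ m : M, f (a • m) = (i * j).negOnePow • (a • f m)}
  add_mem' := fun {f g} hf hg => ⟨fun n m hm => (N.gr _).add_mem (hf.1 n m hm) (hg.1 n m hm),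
    fun j a ha m => by
      rw [LinearMap.add_apply, LinearMap.add_apply, hf.2 j a ha, hg.2 j a ha, smul_add, smul_add]⟩
  zero_mem' := ⟨fun n m _ => (N.gr _).zero_mem, fun j a _ m => by simp⟩
  smul_mem' := fun c f hf => ⟨fun n m hm => (N.gr _).smul_mem c (hf.1 n m hm),
    fun j a ha m => by
      rw [LinearMap.smul_apply, LinearMap.smul_apply, hf.2 j a ha, smul_comm c, smul_comm c a]⟩

/-- The differential `d f = d_N ∘ f - (-1)^i f ∘ d_M` on maps of degree `i`. -/
def homD (M N : DGModule A) (i : ℤ) : (M →ₗ[k] N) →ₗ[k] (M →ₗ[k] N) :=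
  LinearMap.compRight k N.d - i.negOnePow • LinearMap.lcomp k N M.d

theorem homD_apply (M N : DGModule A) (i : ℤ) (f : M →ₗ[k] N) (m : M) :
    homD M N i f m = N.d (f m) - i.negOnePow • f (M.d m) := rfl

/-- Cocycles of degree `i` of the complex `Hom_A(M,N)`. -/
def homZ (M N : DGModule A) (i : ℤ) : Submodule k (M →ₗ[k] N) :=
  homDeg M N i ⊓ LinearMap.ker (homD M N i)

/-- Coboundaries of degree `i` of the complex `Hom_A(M,N)`. -/
def homB (M N : DGModule A) (i : ℤ) : Submodule k (M →ₗ[k] N) :=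
  (homDeg M N (i - 1)).map (homD M N (i - 1))

/-- The dg module `M` is quasi-trivial (acyclic): its cohomology vanishes. -/
def DGModule.IsAcyclic (M : DGModule A) : Prop := ∀ m : M, M.d m = 0 → ∃ n : M, M.d n = m

/-- `P` is K-projective: `Hom_A(P,-)` preserves quasi-trivial dg modules. -/
def DGModule.IsKProjective (P : DGModule A) : Prop :=
  ∀ X : DGModule A, X.IsAcyclic → ∀ i : ℤ, homZ P X i ≤ homB P X i

/-- A morphism of dg modules inducing an isomorphism on cohomology. -/
structure IsQuasiIso {M N : DGModule A} (f : M →ₗ[k] N) : Prop where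
  map_mem : ∀ (n : ℤ), ∀ m ∈ M.gr n, f m ∈ N.gr n
  map_smul : ∀ (a : A) (m : M), f (a • m) = a • f m
  map_d : ∀ m : M, f (M.d m) = N.d (f m)
  inj : ∀ m : M, M.d m = 0 → (∃ n : N, N.d n = f m) → ∃ m' : M, M.d m' = m
  surj : ∀ n : N, N.d n = 0 → ∃ m : M, M.d m = 0 ∧ ∃ n' : N, n = f m + N.d n'

/-- A K-projective resolution of the dg module `M`. -/
structure KProjRes (M : DGModule A) where
  P : DGModule A
  isKProjective : P.IsKProjective
  π : P →ₗ[k] M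
  isQuasiIso : IsQuasiIso π

end

section
variable {k : Type u} [Field k] (H : Type u) [Ring H] [HopfAlgebra k H]

/-- `A` is a dg `H`-module algebra: an `H`-module algebra whose `H`-action preserves degrees and
commutes with the differential. -/
class IsDGModuleAlgebra (A : DGAlgebra k) [Module H A] [IsScalarTower k H A] : Prop
    extends IsModuleAlgebra k H A where
  smul_mem : ∀ {i : ℤ} (h : H) {a : A}, a ∈ A.gr i → h • a ∈ A.gr i
  d_smul : ∀ (h : H) (a : A), A.d (h • a) = h • A.d a

variable (A : DGAlgebra k) [Module H A] [IsScalarTower k H A] [IsDGModuleAlgebra H A]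

section
variable {H} {B : Type u} [Ring B] [Algebra k B] [Module H B] [IsScalarTower k H B]
    [IsModuleAlgebra k H B]

theorem smash_mul_mk (a b : B) (h g : H) : smashMk k a h * smashMk k b g =
    ∑ i ∈ (ℛ k h).index, smashMk k (a * ((ℛ k h).left i • b)) ((ℛ k h).right i * g) :=
  smashMul_tmul a b h g

theorem smash_induction {p : Smash k H B → Prop} (x : Smash k H B) (h0 : p 0)
    (h1 : ∀ b h, p (smashMk k b h)) (h2 : ∀ x y, p x → p y → p (x + y)) : p x :=
  TensorProduct.induction_on (motive := p) x h0 h1 h2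

variable (H) in
/-- The grading of `B # H` induced by a grading of `B`, with `H` in degree zero. -/
noncomputable def smashGr (gr : ℤ → Submodule k B) (n : ℤ) : Submodule k (Smash k H B) :=
  Submodule.span k {x | ∃ b ∈ gr n, ∃ h : H, x = smashMk k b h}

theorem smashGr_isInternal {gr : ℤ → Submodule k B} (h : DirectSum.IsInternal gr) :
    DirectSum.IsInternal (smashGr H gr) := tensorGr_isInternal H h

variable (H) in
/-- `f ⊗ id` on `B # H`. -/
noncomputable def smashMap (f : B →ₗ[k] B) : Smash k H B →ₗ[k] Smash k H B :=
  f.rTensor H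

theorem smashMap_mk (f : B →ₗ[k] B) (b : B) (h : H) :
    smashMap H f (smashMk k b h) = smashMk k (f b) h := rfl

theorem smashMk_add (b c : B) (h : H) :
    smashMk k (b + c) h = smashMk k b h + smashMk k c h := TensorProduct.add_tmul b c h

theorem smashMk_zsmul (n : ℤˣ) (b : B) (h : H) :
    smashMk k (n • b) h = n • smashMk k b h := by
  rcases Int.units_eq_one_or n with rfl | rfl
  · simp
  · simpa using! TensorProduct.neg_tmul b h

end

theorem smashGr_mul_mem {i j : ℤ} {a b : Smash k H A} (ha : a ∈ smashGr H A.gr i)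
    (hb : b ∈ smashGr H A.gr j) : a * b ∈ smashGr H A.gr (i + j) := by
  induction ha using Submodule.span_induction with
  | zero => rw [zero_mul]; exact Submodule.zero_mem _
  | add x y _ _ hx hy => rw [add_mul]; exact Submodule.add_mem _ hx hy
  | smul c x _ hx => rw [smul_mul_assoc]; exact Submodule.smul_mem _ _ hx
  | mem x hx =>
    obtain ⟨v, hv, h, rfl⟩ := hx
    induction hb using Submodule.span_induction with
    | zero => rw [mul_zero]; exact Submodule.zero_mem _
    | add x y _ _ hx hy => rw [mul_add]; exact Submodule.add_mem _ hx hy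
    | smul c x _ hx => rw [mul_smul_comm]; exact Submodule.smul_mem _ _ hx
    | mem x hx =>
      obtain ⟨w, hw, g, rfl⟩ := hx
      rw [smash_mul_mk]
      exact Submodule.sum_mem _ fun l _ => Submodule.subset_span
        ⟨_, A.mul_mem hv (IsDGModuleAlgebra.smul_mem _ hw), _, rfl⟩

theorem smashMap_d_mem {i : ℤ} {a : Smash k H A} (ha : a ∈ smashGr H A.gr i) :
    smashMap H A.d a ∈ smashGr H A.gr (i + 1) := by
  induction ha using Submodule.span_induction with
  | zero => rw [map_zero]; exact Submodule.zero_mem _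
  | add x y _ _ hx hy => rw [map_add]; exact Submodule.add_mem _ hx hy
  | smul c x _ hx => rw [map_smul]; exact Submodule.smul_mem _ _ hx
  | mem x hx =>
    obtain ⟨v, hv, h, rfl⟩ := hx
    exact Submodule.subset_span ⟨_, A.d_mem hv, _, rfl⟩

theorem smashMap_d_d (a : Smash k H A) : smashMap H A.d (smashMap H A.d a) = 0 := by
  induction a using smash_induction with
  | h0 => simp
  | h1 b h => rw [smashMap_mk, smashMap_mk, A.d_d]; exact TensorProduct.zero_tmul _ _
  | h2 x y hx hy => rw [map_add, map_add, hx, hy, add_zero]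

theorem smashMap_d_mul {i : ℤ} {a : Smash k H A} (b : Smash k H A)
    (ha : a ∈ smashGr H A.gr i) : smashMap H A.d (a * b) =
      smashMap H A.d a * b + i.negOnePow • (a * smashMap H A.d b) := by
  induction ha using Submodule.span_induction with
  | zero => simp
  | add x y _ _ hx hy =>
    rw [add_mul, map_add, hx, hy, map_add, add_mul, add_mul, smul_add]; abel
  | smul c x _ hx =>
    rw [smul_mul_assoc, map_smul, hx, map_smul, smul_mul_assoc, smul_mul_assoc, smul_add,
      smul_comm c]
  | mem x hx =>
    obtain ⟨v, hv, h, rfl⟩ := hx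
    induction b using smash_induction with
    | h0 => simp
    | h2 x y hx hy =>
      rw [mul_add, map_add, hx, hy, map_add, mul_add, mul_add, smul_add]; abel
    | h1 w g =>
      simp only [smash_mul_mk, map_sum, smashMap_mk, Finset.smul_sum, ← Finset.sum_add_distrib,
        A.d_mul _ hv, smashMk_add, smashMk_zsmul, IsDGModuleAlgebra.d_smul]

/-- The smash product `A # H` of a dg `H`-module algebra `A`, a dg algebra with `A^n ⊗ H` in
degree `n` and differential `d ⊗ id`. -/
noncomputable def smashDG : DGAlgebra k where
  carrier := Smash k H A
  ring := inferInstance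
  algebra := inferInstance
  gr := smashGr H A.gr
  isInternal := smashGr_isInternal A.isInternal
  one_mem := Submodule.subset_span ⟨1, A.one_mem, 1, rfl⟩
  mul_mem := smashGr_mul_mem H A
  d := smashMap H A.d
  d_mem := smashMap_d_mem H A
  d_d := smashMap_d_d H A
  d_mul := smashMap_d_mul H A

/-- The inclusion `A → A # H`. -/
noncomputable def inlDG : A →ₐ[k] smashDG H A := smashInl k H A

/-- The inclusion `H → A # H`. -/
noncomputable def inrDG : H →ₐ[k] smashDG H A := smashInr k H A

variable {H A}

/-- The element `a # h`. -/
noncomputable def mkDG (a : A) (h : H) : smashDG H A := smashMk k a h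

theorem mkDG_mem {i : ℤ} {a : A} (ha : a ∈ A.gr i) (h : H) : mkDG a h ∈ (smashDG H A).gr i := by
  change smashMk k a h ∈ smashGr H A.gr i
  exact Submodule.subset_span ⟨a, ha, h, rfl⟩

theorem inlDG_mem {i : ℤ} {a : A} (ha : a ∈ A.gr i) : inlDG H A a ∈ (smashDG H A).gr i :=
  mkDG_mem ha 1

theorem inrDG_mem (h : H) : inrDG H A h ∈ (smashDG H A).gr 0 :=
  mkDG_mem A.one_mem h

theorem d_inlDG (a : A) : (smashDG H A).d (inlDG H A a) = inlDG H A (A.d a) := rfl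

theorem DGAlgebra.d_one (A : DGAlgebra k) : A.d 1 = 0 := by
  have := A.d_mul (1 : A) A.one_mem
  simpa using this

theorem d_inrDG (h : H) : (smashDG H A).d (inrDG H A h) = 0 := by
  change smashMk k (A.d 1) h = 0
  rw [A.d_one]
  exact TensorProduct.zero_tmul _ _

theorem inrDG_mul_inlDG (h : H) (a : A) : inrDG H A h * inlDG H A a =
    ∑ i ∈ (ℛ k h).index, inlDG H A ((ℛ k h).left i • a) * inrDG H A ((ℛ k h).right i) :=
  smashInr_mul_smashInl h a

/-- The module structure given by a representation. -/
noncomputable abbrev moduleOfHom {R V : Type u} [Ring R] [Algebra k R] [AddCommGroup V]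
    [Module k V] (f : R →ₐ[k] Module.End k V) : Module R V :=
  Module.compHom V (f : R →+* Module.End k V)

theorem isScalarTower_moduleOfHom {R V : Type u} [Ring R] [Algebra k R] [AddCommGroup V]
    [Module k V] (f : R →ₐ[k] Module.End k V) :
    letI := moduleOfHom f
    IsScalarTower k R V :=
  letI := moduleOfHom f
  ⟨fun c a m => by
    change f (c • a) m = c • f a m
    rw [map_smul]
    rfl⟩

/-- The action of `A` on a dg `A # H`-module. -/
noncomputable def actA (M : DGModule (smashDG H A)) : A →ₐ[k] Module.End k M :=
  (Algebra.lsmul k k M).comp (inlDG H A)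

/-- The action of `H` on a dg `A # H`-module. -/
noncomputable def actH (M : DGModule (smashDG H A)) : H →ₐ[k] Module.End k M :=
  (Algebra.lsmul k k M).comp (inrDG H A)

theorem covariant_act (M : DGModule (smashDG H A)) : Covariant (actA M) (actH M) := by
  intro h a
  have := congrArg (Algebra.lsmul k k M) (inrDG_mul_inlDG h a)
  simp only [map_mul, map_sum] at this
  exact this

theorem actA_apply (M : DGModule (smashDG H A)) (a : A) (m : M) :
    actA M a m = inlDG H A a • m := rfl

theorem actH_apply (M : DGModule (smashDG H A)) (h : H) (m : M) :
    actH M h m = inrDG H A h • m := rfl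

theorem actH_mem (M : DGModule (smashDG H A)) (h : H) {n : ℤ} {m : M} (hm : m ∈ M.gr n) :
    actH M h m ∈ M.gr n := by
  have := M.smul_mem (inrDG_mem h) hm
  rwa [zero_add] at this

theorem d_actH (M : DGModule (smashDG H A)) (h : H) (m : M) :
    M.d (actH M h m) = actH M h (M.d m) := by
  rw [actH_apply, M.d_smul m (inrDG_mem h), d_inrDG]
  simp [actH_apply]

/-- A dg `A # H`-module viewed as a dg `A`-module. -/
noncomputable def DGModule.res (M : DGModule (smashDG H A)) : DGModule A where
  carrier := M
  addCommGroup := inferInstance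
  moduleBase := inferInstance
  module := moduleOfHom (actA M)
  isScalarTower := isScalarTower_moduleOfHom (actA M)
  gr := M.gr
  isInternal := M.isInternal
  smul_mem := fun ha hm => M.smul_mem (inlDG_mem ha) hm
  d := M.d
  d_mem := M.d_mem
  d_d := M.d_d
  d_smul := fun {_ a} m ha => M.d_smul (a := inlDG H A a) m (inlDG_mem ha)

/-- The action of `A # H` on `M ⊗ H`: `(a # h)(m ⊗ w) = (a # h₍₁₎) m ⊗ h₍₂₎ w`. -/
noncomputable def tensorAct (M : DGModule (smashDG H A)) :
    smashDG H A →ₐ[k] Module.End k (M ⊗[k] H) :=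
  smashLift (covariant_tensor (covariant_act M))

theorem tensorAct_mk (M : DGModule (smashDG H A)) (a : A) (h : H) (m : M) (w : H) :
    tensorAct M (mkDG a h) (m ⊗ₜ w) = ∑ i ∈ (ℛ k h).index,
      (mkDG a ((ℛ k h).left i) • m) ⊗ₜ[k] ((ℛ k h).right i * w) := by
  change (tensorLeft H (actA M) a * tensorDiag (actH M) h) (m ⊗ₜ w) = _
  rw [Module.End.mul_apply, tensorDiag_apply, map_sum]
  refine Finset.sum_congr rfl fun i _ => ?_
  rw [tensorLeft_apply, actA_apply, actH_apply, smul_smul]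
  congr 2
  exact smashInl_mul_smashInr a _

theorem tensorAct_mem (M : DGModule (smashDG H A)) {i j : ℤ} {a : smashDG H A} {m : M ⊗[k] H}
    (ha : a ∈ (smashDG H A).gr i) (hm : m ∈ tensorGr H M.gr j) :
    tensorAct M a m ∈ tensorGr H M.gr (i + j) := by
  change a ∈ smashGr H A.gr i at ha
  induction ha using Submodule.span_induction with
  | zero =>
    have : tensorAct M (0 : smashDG H A) m = 0 := by rw [map_zero]; rfl
    exact this ▸ Submodule.zero_mem _
  | add x y _ _ hx hy =>
    have : tensorAct M (x + y : smashDG H A) m = tensorAct M x m + tensorAct M y m := by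
      rw [map_add]; rfl
    exact this ▸ Submodule.add_mem _ hx hy
  | smul c x _ hx =>
    have : tensorAct M (c • x : smashDG H A) m = c • tensorAct M x m := by
      rw [map_smul]; rfl
    exact this ▸ Submodule.smul_mem _ _ hx
  | mem x hx =>
    obtain ⟨v, hv, h, rfl⟩ := hx
    induction hm using Submodule.span_induction with
    | zero => rw [map_zero]; exact Submodule.zero_mem _
    | add x y _ _ hx hy => rw [map_add]; exact Submodule.add_mem _ hx hy
    | smul c x _ hx => rw [map_smul]; exact Submodule.smul_mem _ _ hx
    | mem x hx =>
      obtain ⟨m, hm, g, rfl⟩ := hx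
      change tensorAct M (mkDG v h) _ ∈ _
      rw [tensorAct_mk]
      exact Submodule.sum_mem _ fun l _ => Submodule.subset_span
        ⟨_, M.smul_mem (mkDG_mem hv _) hm, _, rfl⟩

theorem tensorAct_d (M : DGModule (smashDG H A)) {i : ℤ} {a : smashDG H A} (m : M ⊗[k] H)
    (ha : a ∈ (smashDG H A).gr i) : M.d.rTensor H (tensorAct M a m) =
      tensorAct M ((smashDG H A).d a) m + i.negOnePow • tensorAct M a (M.d.rTensor H m) := by
  change a ∈ smashGr H A.gr i at ha
  induction ha using Submodule.span_induction with
  | zero =>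
    have : tensorAct M (0 : smashDG H A) = 0 := map_zero _
    have h0 : (smashDG H A).d (0 : smashDG H A) = 0 := map_zero _
    erw [h0, this]
    simp
  | add x y _ _ hx hy =>
    have h1 : tensorAct M (x + y : smashDG H A) = tensorAct M x + tensorAct M y := map_add _ _ _
    have h2 : (smashDG H A).d (x + y : smashDG H A) = (smashDG H A).d x + (smashDG H A).d y :=
      map_add _ _ _
    erw [h2, h1]
    rw [map_add, LinearMap.add_apply, map_add, hx, hy, LinearMap.add_apply, LinearMap.add_apply,
      smul_add]
    abel
  | smul c x _ hx =>
    have h1 : tensorAct M (c • x : smashDG H A) = c • tensorAct M x := map_smul _ _ _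
    have h2 : (smashDG H A).d (c • x : smashDG H A) = c • (smashDG H A).d x := map_smul _ _ _
    erw [h2, h1]
    rw [map_smul, LinearMap.smul_apply, map_smul, hx, LinearMap.smul_apply, LinearMap.smul_apply,
      smul_add, smul_comm c]
  | mem x hx =>
    obtain ⟨v, hv, h, rfl⟩ := hx
    induction m using TensorProduct.induction_on with
    | zero => simp
    | add x y hx hy => simp only [map_add, hx, hy, smul_add]; abel
    | tmul m w =>
      change M.d.rTensor H (tensorAct M (mkDG v h) (m ⊗ₜ w)) = tensorAct M (mkDG (A.d v) h) (m ⊗ₜ w) +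
        i.negOnePow • tensorAct M (mkDG v h) (M.d.rTensor H (m ⊗ₜ w))
      have hd' : ∀ (g : H) (m : M), M.d ((mkDG v g) • m) =
          (mkDG (A.d v) g) • m +
            i.negOnePow • ((mkDG v g) • M.d m) := fun g m =>
        M.d_smul m (mkDG_mem hv _)
      simp only [tensorAct_mk, map_sum, LinearMap.rTensor_tmul, hd', TensorProduct.add_tmul,
        Finset.sum_add_distrib, Finset.smul_sum]
      congr 1

/-- The dg `A # H`-module `M ⊗ H`, where `H` is the left regular `H`-module in degree zero. -/
noncomputable def DGModule.tensorH (M : DGModule (smashDG H A)) : DGModule (smashDG H A) where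
  carrier := M ⊗[k] H
  addCommGroup := inferInstance
  moduleBase := inferInstance
  module := moduleOfHom (tensorAct M)
  isScalarTower := isScalarTower_moduleOfHom (tensorAct M)
  gr := tensorGr H M.gr
  isInternal := tensorGr_isInternal H M.isInternal
  smul_mem := fun ha hm => tensorAct_mem M ha hm
  d := M.d.rTensor H
  d_mem := by
    intro i m hm
    induction hm using Submodule.span_induction with
    | zero => rw [map_zero]; exact Submodule.zero_mem _
    | add x y _ _ hx hy => rw [map_add]; exact Submodule.add_mem _ hx hy
    | smul c x _ hx => rw [map_smul]; exact Submodule.smul_mem _ _ hx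
    | mem x hx =>
      obtain ⟨v, hv, h, rfl⟩ := hx
      exact Submodule.subset_span ⟨_, M.d_mem hv, _, rfl⟩
  d_d := fun m => by
    have : M.d.rTensor H ∘ₗ M.d.rTensor H = 0 := by
      rw [← LinearMap.rTensor_comp, show M.d ∘ₗ M.d = 0 from LinearMap.ext M.d_d,
        LinearMap.rTensor_zero]
    exact LinearMap.congr_fun this m
  d_smul := fun m ha => tensorAct_d M m ha

end

section
variable {k : Type u} [Field k] {A : DGAlgebra k}

/-- The cohomology `H^i(Hom_A(M,N))`. -/
def HomH (M N : DGModule A) (i : ℤ) : Type u :=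
  homZ M N i ⧸ (homB M N i).submoduleOf (homZ M N i)

noncomputable instance (M N : DGModule A) (i : ℤ) : AddCommGroup (HomH M N i) :=
  inferInstanceAs (AddCommGroup (homZ M N i ⧸ (homB M N i).submoduleOf (homZ M N i)))

noncomputable instance (M N : DGModule A) (i : ℤ) : Module k (HomH M N i) :=
  inferInstanceAs (Module k (homZ M N i ⧸ (homB M N i).submoduleOf (homZ M N i)))

/-- The class of a cocycle. -/
noncomputable def HomH.mk (M N : DGModule A) (i : ℤ) : homZ M N i →ₗ[k] HomH M N i :=
  ((homB M N i).submoduleOf (homZ M N i)).mkQ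

theorem HomH.mk_surjective (M N : DGModule A) (i : ℤ) : Function.Surjective (HomH.mk M N i) :=
  Submodule.mkQ_surjective _

theorem HomH.mk_eq_iff {M N : DGModule A} {i : ℤ} {f g : homZ M N i} :
    HomH.mk M N i f = HomH.mk M N i g ↔ f.1 - g.1 ∈ homB M N i :=
  Submodule.Quotient.eq _

/-- The cohomology `H^*(Hom_A(M,N)) = ⨁ H^i(Hom_A(M,N))`. -/
abbrev HomHTot (M N : DGModule A) : Type u := ⨁ i : ℤ, HomH M N i

theorem comp_mem_homDeg {L M N : DGModule A} {i j : ℤ} {f : L →ₗ[k] M} {g : M →ₗ[k] N}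
    (hf : f ∈ homDeg L M i) (hg : g ∈ homDeg M N j) : g ∘ₗ f ∈ homDeg L N (i + j) := by
  refine ⟨fun n m hm => ?_, fun l a ha m => ?_⟩
  · rw [← add_assoc]
    exact hg.1 _ _ (hf.1 _ _ hm)
  · rw [LinearMap.comp_apply, LinearMap.comp_apply, hf.2 l a ha, LinearMap.map_smul_of_tower,
      hg.2 l a ha, smul_smul, ← Int.negOnePow_add, add_mul]

theorem homD_comp {L M N : DGModule A} (i j : ℤ) (f : L →ₗ[k] M) (g : M →ₗ[k] N) :
    homD L N (i + j) (g ∘ₗ f) = homD M N j g ∘ₗ f + j.negOnePow • (g ∘ₗ homD L M i f) := by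
  refine LinearMap.ext fun m => ?_
  rw [LinearMap.add_apply, LinearMap.smul_apply, LinearMap.comp_apply, LinearMap.comp_apply,
    homD_apply, homD_apply, homD_apply, map_sub, LinearMap.comp_apply, LinearMap.comp_apply,
    LinearMap.map_smul_of_tower, smul_sub, smul_smul, ← Int.negOnePow_add, add_comm j i]
  abel

theorem units_smul_mem {V : Type u} [AddCommGroup V] [Module k V] (W : Submodule k V) (n : ℤˣ)
    {v : V} (hv : v ∈ W) : n • v ∈ W := by
  rcases Int.units_eq_one_or n with rfl | rfl
  · simpa using hv
  · simpa using hv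

theorem comp_mem_homZ {L M N : DGModule A} {i j : ℤ} {f : L →ₗ[k] M} {g : M →ₗ[k] N}
    (hf : f ∈ homZ L M i) (hg : g ∈ homZ M N j) : g ∘ₗ f ∈ homZ L N (i + j) := by
  refine ⟨comp_mem_homDeg hf.1 hg.1, ?_⟩
  have h1 : homD L M i f = 0 := hf.2
  have h2 : homD M N j g = 0 := hg.2
  change homD L N (i + j) (g ∘ₗ f) = 0
  rw [homD_comp, h1, h2]
  simp

theorem comp_mem_homB_left {L M N : DGModule A} {i j : ℤ} {f : L →ₗ[k] M} {g : M →ₗ[k] N}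
    (hf : f ∈ homZ L M i) (hg : g ∈ homB M N j) : g ∘ₗ f ∈ homB L N (i + j) := by
  obtain ⟨g', hg', rfl⟩ := hg
  have h1 : homD L M i f = 0 := hf.2
  refine ⟨g' ∘ₗ f, ?_, ?_⟩
  · rw [add_sub_assoc]; exact comp_mem_homDeg hf.1 hg'
  · rw [add_sub_assoc, homD_comp, h1]; simp

theorem comp_mem_homB_right {L M N : DGModule A} {i j : ℤ} {f : L →ₗ[k] M} {g : M →ₗ[k] N}
    (hf : f ∈ homB L M i) (hg : g ∈ homZ M N j) : g ∘ₗ f ∈ homB L N (i + j) := by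
  obtain ⟨f', hf', rfl⟩ := hf
  have h1 : homD M N j g = 0 := hg.2
  have e : i + j - 1 = (i - 1) + j := by ring
  refine ⟨j.negOnePow • (g ∘ₗ f'), ?_, ?_⟩
  · rw [e]; exact units_smul_mem _ _ (comp_mem_homDeg hf' hg.1)
  · rw [e, LinearMap.map_smul_of_tower, homD_comp, h1, LinearMap.zero_comp, zero_add, smul_smul,
      ← Int.negOnePow_add, Int.negOnePow_even _ (Even.add_self j), one_smul]

/-- The product `f * g = (-1)^{|f||g|} g ∘ f` on cocycles. -/
def starZ {M : DGModule A} {i j : ℤ} (f : homZ M M i) (g : homZ M M j) : homZ M M (i + j) :=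
  ⟨(i * j).negOnePow • (g.1 ∘ₗ f.1), units_smul_mem _ _ (comp_mem_homZ f.2 g.2)⟩

/-- The product induced by `f * g = (-1)^{|f||g|} g ∘ f` on cohomology. -/
noncomputable def starH {M : DGModule A} {i j : ℤ} (x : HomH M M i) (y : HomH M M j) : HomH M M (i + j) :=
  Quotient.liftOn₂' x y (fun f g => HomH.mk M M (i + j) (starZ f g)) (by
    intro f g f' g' hf hg
    have hf' : f.1 - f'.1 ∈ homB M M i := 
      HomH.mk_eq_iff.1 (Quotient.sound' hf)
    have hg' : g.1 - g'.1 ∈ homB M M j := 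
      HomH.mk_eq_iff.1 (Quotient.sound' hg)
    rw [HomH.mk_eq_iff]
    have : (starZ f g).1 - (starZ f' g').1 = (i * j).negOnePow •
        (g.1 ∘ₗ (f.1 - f'.1) + (g.1 - g'.1) ∘ₗ f'.1) := by
      simp only [starZ, ← smul_sub, LinearMap.comp_sub, LinearMap.sub_comp]
      congr 1
      abel
    rw [this]
    exact units_smul_mem _ _ (Submodule.add_mem _ (comp_mem_homB_right hf' g.2)
      (comp_mem_homB_left f'.2 hg')))

theorem starH_mk {M : DGModule A} {i j : ℤ} (f : homZ M M i) (g : homZ M M j) :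
    starH (HomH.mk M M i f) (HomH.mk M M j g) = HomH.mk M M (i + j) (starZ f g) := rfl

/-- The identity as a cocycle of degree zero. -/
def oneZ (M : DGModule A) : homZ M M 0 :=
  ⟨LinearMap.id, ⟨fun n m hm => by simpa using hm, fun j a _ m => by simp⟩,
    LinearMap.ext fun m => by simp [homD_apply]⟩

theorem HomH.mk_heq {M : DGModule A} {i j : ℤ} (h : i = j) {f : homZ M M i} {g : homZ M M j}
    (hfg : f.1 = g.1) : GradedMonoid.mk (A := HomH M M) i (HomH.mk M M i f) =
      GradedMonoid.mk (A := HomH M M) j (HomH.mk M M j g) := by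
  subst h
  rw [Subtype.ext hfg]

noncomputable instance (M : DGModule A) : GradedMonoid.GMul (HomH M M) := ⟨fun x y => starH x y⟩
noncomputable instance (M : DGModule A) : GradedMonoid.GOne (HomH M M) := ⟨HomH.mk M M 0 (oneZ M)⟩

noncomputable instance (M : DGModule A) : GradedMonoid.GMonoid (HomH M M) where
  one_mul := by
    rintro ⟨i, a⟩
    obtain ⟨f, rfl⟩ := HomH.mk_surjective M M _ a
    exact HomH.mk_heq (zero_add i) (f := starZ (oneZ M) f) (g := f) (by simp [starZ, oneZ])
  mul_one := by
    rintro ⟨i, a⟩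
    obtain ⟨f, rfl⟩ := HomH.mk_surjective M M _ a
    exact HomH.mk_heq (add_zero i) (f := starZ f (oneZ M)) (g := f) (by simp [starZ, oneZ])
  mul_assoc := by
    rintro ⟨i, a⟩ ⟨j, b⟩ ⟨l, c⟩
    obtain ⟨f, rfl⟩ := HomH.mk_surjective M M _ a
    obtain ⟨g, rfl⟩ := HomH.mk_surjective M M _ b
    obtain ⟨h, rfl⟩ := HomH.mk_surjective M M _ c
    refine HomH.mk_heq (add_assoc i j l) (f := starZ (starZ f g) h) (g := starZ f (starZ g h)) ?_
    refine LinearMap.ext fun m => ?_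
    simp only [starZ, LinearMap.smul_apply, LinearMap.comp_apply, LinearMap.map_smul_of_tower,
      smul_smul, ← Int.negOnePow_add]
    congr 2
    ring

theorem gMul_mk {M : DGModule A} {i j : ℤ} (f : homZ M M i) (g : homZ M M j) :
    GradedMonoid.GMul.mul (HomH.mk M M i f) (HomH.mk M M j g) = HomH.mk M M (i + j) (starZ f g) :=
  rfl

noncomputable instance (M : DGModule A) : DirectSum.GRing (HomH M M) where
  mul_zero := by
    intro i j a
    obtain ⟨f, rfl⟩ := HomH.mk_surjective M M i a
    rw [← map_zero (HomH.mk M M j), gMul_mk, ← map_zero (HomH.mk M M (i + j))]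
    congr 1
    exact Subtype.ext (by simp [starZ])
  zero_mul := by
    intro i j a
    obtain ⟨f, rfl⟩ := HomH.mk_surjective M M j a
    rw [← map_zero (HomH.mk M M i), gMul_mk, ← map_zero (HomH.mk M M (i + j))]
    congr 1
    exact Subtype.ext (by simp [starZ])
  mul_add := by
    intro i j a b c
    obtain ⟨f, rfl⟩ := HomH.mk_surjective M M _ a
    obtain ⟨g, rfl⟩ := HomH.mk_surjective M M _ b
    obtain ⟨h, rfl⟩ := HomH.mk_surjective M M _ c
    rw [← map_add, gMul_mk, gMul_mk, gMul_mk, ← map_add]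
    congr 1
    exact Subtype.ext (by simp [starZ, LinearMap.add_comp])
  add_mul := by
    intro i j a b c
    obtain ⟨f, rfl⟩ := HomH.mk_surjective M M _ a
    obtain ⟨g, rfl⟩ := HomH.mk_surjective M M _ b
    obtain ⟨h, rfl⟩ := HomH.mk_surjective M M _ c
    rw [← map_add, gMul_mk, gMul_mk, gMul_mk, ← map_add]
    congr 1
    exact Subtype.ext (by simp [starZ, LinearMap.comp_add])
  natCast n := n • HomH.mk M M 0 (oneZ M)
  natCast_zero := zero_smul _ _
  natCast_succ n := succ_nsmul _ _
  intCast n := n • HomH.mk M M 0 (oneZ M)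
  intCast_ofNat n := natCast_zsmul _ _
  intCast_negSucc_ofNat n := negSucc_zsmul _ _

noncomputable instance (M : DGModule A) : DirectSum.GAlgebra k (HomH M M) where
  toFun := (LinearMap.toSpanSingleton k _ (HomH.mk M M 0 (oneZ M))).toAddMonoidHom
  map_one := one_smul k (HomH.mk M M 0 (oneZ M))
  map_mul := by
    intro r s
    refine HomH.mk_heq (add_zero 0).symm (f := (r * s) • oneZ M)
      (g := starZ (r • oneZ M) (s • oneZ M)) ?_
    refine LinearMap.ext fun m => ?_
    simp [starZ, oneZ, mul_smul, smul_comm s r m]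
  commutes := by
    rintro r ⟨i, a⟩
    obtain ⟨f, rfl⟩ := HomH.mk_surjective M M _ a
    refine HomH.mk_heq (by simp) (f := starZ (r • oneZ M) f) (g := starZ f (r • oneZ M)) ?_
    refine LinearMap.ext fun m => ?_
    simp [starZ, oneZ]
  smul_def := by
    rintro r ⟨i, a⟩
    obtain ⟨f, rfl⟩ := HomH.mk_surjective M M _ a
    refine HomH.mk_heq (by simp) (f := r • f) (g := starZ (r • oneZ M) f) ?_
    refine LinearMap.ext fun m => ?_
    simp [starZ, oneZ]

end

section
variable {k : Type u} [Field k] {H : Type u} [Ring H] [HopfAlgebra k H]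
  [FiniteDimensional k H] [IsSemisimpleRing H]

section cov
variable {B : Type u} [Ring B] [Algebra k B] [Module H B] [IsScalarTower k H B]
  {V : Type u} [AddCommGroup V] [Module k V]
  {α : B →ₐ[k] Module.End k V} {β : H →ₐ[k] Module.End k V}

theorem cov_left (hc : Covariant α β) (h : H) (a : B) :
    ∑ i ∈ (ℛ k h).index, β ((ℛ k h).right i) * α (antipodeInv k H ((ℛ k h).left i) • a) =
      α a * β h := by
  simp only [hc _ _]
  rw [← coassoc3 (fun x y z => α (y • antipodeInv k H x • a) * β z)
    (fun y z => ⟨fun x x' => by simp [add_smul, add_mul], fun c x => by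
      rw [map_smul (antipodeInv k H), smul_assoc, smul_comm y c, map_smul α, smul_mul_assoc]⟩)
    (fun y z => ⟨fun x x' => by simp [add_smul, add_mul], fun c x => by simp⟩)
    (fun y z => ⟨fun x x' => by simp [mul_add], fun c x => by simp⟩) h]
  simp only [smul_smul, ← Finset.sum_mul, ← map_sum, ← Finset.sum_smul]
  simp only [sum_right_mul_antipodeInv_left, algebraMap_smul, map_smul, smul_mul_assoc,
    ← mul_smul_comm, ← Finset.mul_sum]
  exact congrArg _ (sum_counit_left β.toLinearMap h)

/-- `h ↦ α(S⁻¹(h₍₂₎) a) β(S⁻¹(h₍₁₎))` -/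
noncomputable def covU (α : B →ₐ[k] Module.End k V) (β : H →ₐ[k] Module.End k V) (a : B) :
    H →ₗ[k] Module.End k V :=
  TensorProduct.lift (LinearMap.mk₂ k
    (fun x y => α (antipodeInv k H y • a) * β (antipodeInv k H x))
    (fun x x' y => by simp [mul_add]) (fun c x y => by simp)
    (fun x y y' => by simp [add_smul, add_mul]) (fun c x y => by simp)) ∘ₗ comul

theorem covU_apply (α : B →ₐ[k] Module.End k V) (β : H →ₐ[k] Module.End k V) (a : B) (h : H) :
    covU α β a h = ∑ i ∈ (ℛ k h).index, α (antipodeInv k H ((ℛ k h).right i) • a) *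
      β (antipodeInv k H ((ℛ k h).left i)) := by
  rw [covU, LinearMap.comp_apply]
  conv_lhs => rw [← (ℛ k h).eq]
  rw [map_sum]
  rfl

theorem covU_star (hc : Covariant α β) (h : H) (a : B) :
    ∑ i ∈ (ℛ k h).index, β ((ℛ k h).right i) * covU α β a ((ℛ k h).left i) =
      counit (R := k) h • α a := by
  simp only [covU_apply, Finset.mul_sum, ← mul_assoc]
  rw [coassoc3 (fun x y z => β z * α (antipodeInv k H y • a) * β (antipodeInv k H x))
    (fun y z => ⟨fun x x' => by simp [mul_add], fun c x => by simp⟩)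
    (fun y z => ⟨fun x x' => by simp [add_smul, mul_add, add_mul], fun c x => by simp⟩)
    (fun y z => ⟨fun x x' => by simp [add_mul], fun c x => by simp⟩) h]
  simp only [← Finset.sum_mul, cov_left hc]
  simp only [mul_assoc, ← map_mul, ← Finset.mul_sum, ← map_sum, sum_right_mul_antipodeInv_left]
  rw [AlgHom.commutes, ← Algebra.commutes, Algebra.smul_def]

theorem cov_right (hc : Covariant α β) (h : H) (a : B) :
    covU α β a h = β (antipodeInv k H h) * α a := by
  have h1 := coassoc3 (X := Module.End k V) (k := k) (fun x y z => β (antipodeInv k H z) * β y * covU α β a x)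
    (fun y z => ⟨fun x x' => by simp [mul_add], fun c x => by simp⟩)
    (fun y z => ⟨fun x x' => by simp [mul_add, add_mul], fun c x => by simp⟩)
    (fun y z => ⟨fun x x' => by simp [add_mul], fun c x => by simp⟩) h
  simp only [mul_assoc, ← Finset.mul_sum, covU_star hc] at h1
  simp only [← mul_assoc, ← Finset.sum_mul, ← map_mul, ← map_sum,
    sum_antipodeInv_right_mul_left, AlgHom.commutes, ← Algebra.smul_def, sum_counit_right] at h1
  rw [← h1]
  simp only [mul_smul_comm, ← smul_mul_assoc, ← Finset.sum_mul]
  congr 1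
  exact sum_counit_left (β.toLinearMap ∘ₗ antipodeInv k H) h
theorem act_linear {W : Type u} [AddCommGroup W] [Module k W]
    {α' : B →ₐ[k] Module.End k W} {β' : H →ₐ[k] Module.End k W}
    (hc : Covariant α β) (hc' : Covariant α' β') (f : V →ₗ[k] W) (s : ℤˣ) (a : B)
    (hf : ∀ (g : H) (x : V), f (α (g • a) x) = s • α' (g • a) (f x)) (h : H) (m : V) :
    ∑ i ∈ (ℛ k h).index, β' ((ℛ k h).right i)
        (f (β (antipodeInv k H ((ℛ k h).left i)) (α a m))) =
      s • α' a (∑ i ∈ (ℛ k h).index, β' ((ℛ k h).right i)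
        (f (β (antipodeInv k H ((ℛ k h).left i)) m))) := by
  have h1 : ∀ (g : H) (x : V), β (antipodeInv k H g) (α a x) =
      ∑ l ∈ (ℛ k g).index, α (antipodeInv k H ((ℛ k g).right l) • a)
        (β (antipodeInv k H ((ℛ k g).left l)) x) := fun g x => by
    have := LinearMap.congr_fun (cov_right hc g a) x
    rw [covU_apply, LinearMap.sum_apply] at this
    exact this.symm
  have h2 : ∀ (g : H) (y : W), ∑ l ∈ (ℛ k g).index, β' ((ℛ k g).right l)
      (α' (antipodeInv k H ((ℛ k g).left l) • a) y) = α' a (β' g y) := fun g y => by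
    have := LinearMap.congr_fun (cov_left hc' g a) y
    rw [LinearMap.sum_apply] at this
    exact this
  have h3 := coassoc3 (k := k) (X := W)
    (fun x y z => β' z (α' (antipodeInv k H y • a) (f (β (antipodeInv k H x) m))))
    (fun y z => ⟨fun x x' => by simp, fun c x => by simp⟩)
    (fun y z => ⟨fun x x' => by simp [add_smul], fun c x => by simp⟩)
    (fun y z => ⟨fun x x' => by simp, fun c x => by simp⟩) h
  simp only [h2] at h3
  rw [map_sum, ← h3, Finset.smul_sum]
  refine Finset.sum_congr rfl fun l _ => ?_
  rw [h1, Finset.smul_sum, map_sum, map_sum]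
  refine Finset.sum_congr rfl fun r _ => ?_
  rw [hf, LinearMap.map_smul_of_tower]

end cov

section
variable {A : DGAlgebra k} [Module H A] [IsScalarTower k H A] [IsDGModuleAlgebra H A]

/-- The `H`-action `(h ⇀ f)(m) = h₍₂₎ f(S⁻¹(h₍₁₎) m)` on the linear maps between two dg
`A # H`-modules, see `homAct_apply`. -/
noncomputable def homAct (M N : DGModule (smashDG H A)) : H →ₐ[k] Module.End k (M →ₗ[k] N) :=
  (Algebra.TensorProduct.lift
    (AlgHom.ofLinearMap
      (LinearMap.flip (LinearMap.llcomp k M M N) ∘ₗ (actH M).toLinearMap ∘ₗ antipodeInv k H)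
      (LinearMap.ext fun f => LinearMap.ext fun m => by
        simp [antipodeInv_one])
      (fun h g => LinearMap.ext fun f => LinearMap.ext fun m => by
        simp [antipodeInv_mul]))
    (AlgHom.ofLinearMap ((LinearMap.llcomp k M N N) ∘ₗ (actH N).toLinearMap)
      (LinearMap.ext fun f => LinearMap.ext fun m => by simp)
      (fun h g => LinearMap.ext fun f => LinearMap.ext fun m => by simp))
    (fun h g => LinearMap.ext fun f => LinearMap.ext fun m => by simp)).comp
  (Bialgebra.comulAlgHom k H)

theorem homAct_eq (M N : DGModule (smashDG H A)) (h : H) (f : M →ₗ[k] N) :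
    homAct M N h f = ∑ i ∈ (ℛ k h).index,
      actH N ((ℛ k h).right i) ∘ₗ f ∘ₗ actH M (antipodeInv k H ((ℛ k h).left i)) := by
  rw [homAct, AlgHom.comp_apply, Bialgebra.comulAlgHom_apply]
  conv_lhs => rw [← (ℛ k h).eq]
  rw [map_sum, LinearMap.sum_apply]
  rfl

theorem homAct_apply (M N : DGModule (smashDG H A)) (h : H) (f : M →ₗ[k] N) (m : M) :
    homAct M N h f m = ∑ i ∈ (ℛ k h).index,
      inrDG H A ((ℛ k h).right i) • f (inrDG H A (antipodeInv k H ((ℛ k h).left i)) • m) := by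
  rw [homAct_eq, LinearMap.sum_apply]
  rfl

/-- `homAct` for the underlying dg `A`-modules. -/
noncomputable def homActRes (M N : DGModule (smashDG H A)) :
    H →ₐ[k] Module.End k (M.res →ₗ[k] N.res) := homAct M N

theorem homActRes_apply (M N : DGModule (smashDG H A)) (h : H) (f : M.res →ₗ[k] N.res)
    (m : M.res) : homActRes M N h f m = ∑ i ∈ (ℛ k h).index,
      actH N ((ℛ k h).right i) (f (actH M (antipodeInv k H ((ℛ k h).left i)) m)) :=
  homAct_apply M N h f m

theorem homActRes_mem_homDeg (M N : DGModule (smashDG H A)) (h : H) {i : ℤ}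
    {f : M.res →ₗ[k] N.res} (hf : f ∈ homDeg M.res N.res i) :
    homActRes M N h f ∈ homDeg M.res N.res i := by
  refine ⟨fun n m hm => ?_, fun j a ha m => ?_⟩
  · rw [homActRes_apply]
    exact Submodule.sum_mem _ fun l _ => actH_mem N _ (hf.1 n _ (actH_mem M _ hm))
  · rw [homActRes_apply, homActRes_apply]
    exact act_linear (covariant_act M) (covariant_act N) f (i * j).negOnePow a
      (fun g x => hf.2 j _ (IsDGModuleAlgebra.smul_mem g ha) x) h m

theorem homD_homAct (M N : DGModule (smashDG H A)) (h : H) (i : ℤ) (f : M →ₗ[k] N) :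
    homD M N i (homAct M N h f) = homAct M N h (homD M N i f) := by
  refine LinearMap.ext fun m => ?_
  simp only [homD_apply, homAct_eq, LinearMap.sum_apply, LinearMap.comp_apply, map_sum,
    map_sub, d_actH, LinearMap.map_smul_of_tower]

theorem homD_homActRes (M N : DGModule (smashDG H A)) (h : H) (i : ℤ) (f : M.res →ₗ[k] N.res) :
    homD M.res N.res i (homActRes M N h f) = homActRes M N h (homD M.res N.res i f) :=
  homD_homAct M N h i f

theorem homActRes_mem_homZ (M N : DGModule (smashDG H A)) (h : H) {i : ℤ}
    {f : M.res →ₗ[k] N.res} (hf : f ∈ homZ M.res N.res i) :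
    homActRes M N h f ∈ homZ M.res N.res i := by
  refine ⟨homActRes_mem_homDeg M N h hf.1, ?_⟩
  have h1 : homD M.res N.res i f = 0 := hf.2
  change homD M.res N.res i (homActRes M N h f) = 0
  rw [homD_homActRes, h1, map_zero]

theorem homActRes_mem_homB (M N : DGModule (smashDG H A)) (h : H) {i : ℤ}
    {f : M.res →ₗ[k] N.res} (hf : f ∈ homB M.res N.res i) :
    homActRes M N h f ∈ homB M.res N.res i := by
  obtain ⟨g, hg, rfl⟩ := hf
  exact ⟨homActRes M N h g, homActRes_mem_homDeg M N h hg, homD_homActRes M N h _ g⟩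

/-- The `H`-action on cocycles. -/
noncomputable def actZ (M N : DGModule (smashDG H A)) (i : ℤ) (h : H) (f : homZ M.res N.res i) :
    homZ M.res N.res i := ⟨homActRes M N h f.1, homActRes_mem_homZ M N h f.2⟩

/-- The `H`-action on `H^i(Hom_A(M,N))` induced by `(h ⇀ f)(m) = h₍₂₎ f(S⁻¹(h₍₁₎) m)`. -/
noncomputable instance (M N : DGModule (smashDG H A)) (i : ℤ) : SMul H (HomH M.res N.res i) :=
  ⟨fun h x => Quotient.liftOn' x (fun f => HomH.mk M.res N.res i (actZ M N i h f)) (by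
    intro f g hfg
    have hfg' : f.1 - g.1 ∈ homB M.res N.res i := HomH.mk_eq_iff.1 (Quotient.sound' hfg)
    rw [HomH.mk_eq_iff]
    change homActRes M N h f.1 - homActRes M N h g.1 ∈ _
    rw [← map_sub]
    exact homActRes_mem_homB M N h hfg')⟩

theorem smul_mk (M N : DGModule (smashDG H A)) (i : ℤ) (h : H) (f : homZ M.res N.res i) :
    h • HomH.mk M.res N.res i f = HomH.mk M.res N.res i (actZ M N i h f) := rfl

noncomputable instance (M N : DGModule (smashDG H A)) (i : ℤ) :
    Module H (HomH M.res N.res i) where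
  one_smul := by
    intro x
    obtain ⟨f, rfl⟩ := HomH.mk_surjective M.res N.res i x
    rw [smul_mk]
    congr 1
    exact Subtype.ext (by simp [actZ])
  mul_smul := by
    intro h g x
    obtain ⟨f, rfl⟩ := HomH.mk_surjective M.res N.res i x
    rw [smul_mk, smul_mk, smul_mk]
    congr 1
    exact Subtype.ext (by simp [actZ])
  smul_zero := by
    intro h
    rw [← map_zero (HomH.mk M.res N.res i), smul_mk]
    congr 1
    exact Subtype.ext (by simp [actZ])
  smul_add := by
    intro h x y
    obtain ⟨f, rfl⟩ := HomH.mk_surjective M.res N.res i x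
    obtain ⟨g, rfl⟩ := HomH.mk_surjective M.res N.res i y
    rw [← map_add, smul_mk, smul_mk, smul_mk, ← map_add]
    congr 1
    exact Subtype.ext (by simp [actZ])
  add_smul := by
    intro h g x
    obtain ⟨f, rfl⟩ := HomH.mk_surjective M.res N.res i x
    rw [smul_mk, smul_mk, smul_mk, ← map_add]
    congr 1
    exact Subtype.ext (by simp [actZ])
  zero_smul := by
    intro x
    obtain ⟨f, rfl⟩ := HomH.mk_surjective M.res N.res i x
    rw [smul_mk, ← map_zero (HomH.mk M.res N.res i)]
    congr 1
    exact Subtype.ext (by simp [actZ])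

instance (M N : DGModule (smashDG H A)) (i : ℤ) : IsScalarTower k H (HomH M.res N.res i) where
  smul_assoc := by
    intro c h x
    obtain ⟨f, rfl⟩ := HomH.mk_surjective M.res N.res i x
    rw [smul_mk, smul_mk, ← map_smul]
    congr 1
    exact Subtype.ext (by simp [actZ])

end
end

section
variable {k : Type u} [Field k] {H : Type u} [Ring H] [HopfAlgebra k H]

theorem mulLeft_comp_convMul {C : Type u} [Ring C] [Algebra k C] (c : C) (X Y : H →ₗ[k] C) :
    toConv (LinearMap.mulLeft k c ∘ₗ X) * toConv Y =
      toConv (LinearMap.mulLeft k c ∘ₗ (toConv X * toConv Y).ofConv) := by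
  ext h
  rw [(ℛ k h).convMul_apply]
  simp [(ℛ k h).convMul_apply, mul_assoc]

variable [FiniteDimensional k H] [IsSemisimpleRing H]

theorem sum_conj_mul_conj {V : Type u} [AddCommGroup V] [Module k V] (β : H →ₐ[k] Module.End k V)
    (f g : Module.End k V) (ρ : Module.End k V → H →ₗ[k] Module.End k V)
    (hρ : ∀ f h, ρ f h = ∑ i ∈ (ℛ k h).index,
      β ((ℛ k h).right i) * f * β (antipodeInv k H ((ℛ k h).left i))) (h : H) :
    ∑ i ∈ (ℛ k h).index, ρ g ((ℛ k h).right i) * ρ f ((ℛ k h).left i) = ρ (g * f) h := by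
  let op : Module.End k V →ₗ[k] (Module.End k V)ᵐᵒᵖ := (MulOpposite.opLinearEquiv k).toLinearMap
  let b : H →ₗ[k] (Module.End k V)ᵐᵒᵖ := op ∘ₗ β.toLinearMap
  let t : H →ₗ[k] (Module.End k V)ᵐᵒᵖ := op ∘ₗ β.toLinearMap ∘ₗ antipodeInv k H
  let p : Module.End k V → H →ₗ[k] (Module.End k V)ᵐᵒᵖ := fun f =>
    LinearMap.mulLeft k (MulOpposite.op f) ∘ₗ b
  have hbt : toConv b * toConv t = 1 := by
    ext x
    rw [(ℛ k x).convMul_apply]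
    have := congrArg β (sum_antipodeInv_right_mul_left (k := k) x)
    rw [map_sum, AlgHom.commutes] at this
    simp only [map_mul] at this
    apply MulOpposite.unop_injective
    simpa [b, t, op] using this
  have hr : ∀ f, toConv t * toConv (p f) = toConv (op ∘ₗ ρ f) := by
    intro f
    ext x
    rw [(ℛ k x).convMul_apply]
    apply MulOpposite.unop_injective
    simp [t, p, b, op, hρ]
  have key : toConv (op ∘ₗ ρ f) * toConv (op ∘ₗ ρ g) = toConv (op ∘ₗ ρ (g * f)) := by
    rw [← hr, ← hr, ← hr, mul_assoc, ← mul_assoc (toConv (p f))]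
    congr 1
    rw [mulLeft_comp_convMul, hbt, mulLeft_comp_convMul, toConv_ofConv, one_mul]
    ext x
    simp [p]
  have := congrArg (fun F => MulOpposite.unop (F.ofConv h)) key
  rw [(ℛ k h).convMul_apply] at this
  simpa [op] using this

variable {A : DGAlgebra k} [Module H A] [IsScalarTower k H A] [IsDGModuleAlgebra H A]

theorem homAct_comp (M : DGModule (smashDG H A)) (f g : M →ₗ[k] M) (h : H) :
    homAct M M h (g ∘ₗ f) = ∑ i ∈ (ℛ k h).index,
      homAct M M ((ℛ k h).right i) g ∘ₗ homAct M M ((ℛ k h).left i) f :=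
  (sum_conj_mul_conj (actH M) f g (fun f => (homAct M M).toLinearMap.flip f)
    (fun f h => homAct_eq M M h f) h).symm

theorem homAct_id (M : DGModule (smashDG H A)) (h : H) :
    homAct M M h LinearMap.id = counit (R := k) h • LinearMap.id := by
  have := congrArg (actH M) (sum_right_mul_antipodeInv_left (k := k) h)
  rw [map_sum, AlgHom.commutes, Algebra.algebraMap_eq_smul_one] at this
  simp only [map_mul] at this
  rw [homAct_eq]
  exact this

theorem smul_gMul (M : DGModule (smashDG H A)) {i j : ℤ} (h : H) (x : HomH M.res M.res i)
    (y : HomH M.res M.res j) : h • (GradedMonoid.GMul.mul x y : HomH M.res M.res (i + j)) =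
      ∑ l ∈ (ℛ k h).index, GradedMonoid.GMul.mul ((ℛ k h).left l • x) ((ℛ k h).right l • y) := by
  obtain ⟨f, rfl⟩ := HomH.mk_surjective M.res M.res i x
  obtain ⟨g, rfl⟩ := HomH.mk_surjective M.res M.res j y
  simp only [smul_mk, gMul_mk]
  rw [← map_sum]
  congr 1
  apply Subtype.ext
  rw [AddSubmonoidClass.coe_finsetSum]
  change homActRes M M h ((i * j).negOnePow • (g.1 ∘ₗ f.1)) = ∑ l ∈ _, (i * j).negOnePow •
    (homActRes M M ((ℛ k h).right l) g.1 ∘ₗ homActRes M M ((ℛ k h).left l) f.1)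
  rw [LinearMap.map_smul_of_tower, ← Finset.smul_sum]
  congr 1
  exact homAct_comp M f.1 g.1 h

theorem smul_of (M N : DGModule (smashDG H A)) (i : ℤ) (h : H) (x : HomH M.res N.res i) :
    h • DirectSum.of (HomH M.res N.res) i x = DirectSum.of (HomH M.res N.res) i (h • x) :=
  ((DirectSum.lof H ℤ (HomH M.res N.res) i).map_smul h x).symm

/-- `H^*(Hom_A(M,M))` is a (graded) `H`-module algebra. -/
instance (M : DGModule (smashDG H A)) : IsModuleAlgebra k H (HomHTot M.res M.res) where
  smul_mul h x y := by
    induction x using DirectSum.induction_on with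
    | zero => simp
    | add x x' hx hx' => simp only [add_mul, smul_add, hx, hx', Finset.sum_add_distrib]
    | of i x =>
      induction y using DirectSum.induction_on with
      | zero => simp
      | add y y' hy hy' => simp only [mul_add, smul_add, hy, hy', Finset.sum_add_distrib]
      | of j y =>
        simp only [DirectSum.of_mul_of, smul_of, smul_gMul, map_sum]
  smul_one h := by
    rw [DirectSum.algebraMap_apply, DirectSum.one_def, smul_of]
    congr 1
    change HomH.mk M.res M.res 0 (actZ M M 0 h (oneZ M.res)) =
      counit (R := k) h • HomH.mk M.res M.res 0 (oneZ M.res)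
    rw [← map_smul]
    congr 1
    exact Subtype.ext (homAct_id M h)

variable (k H) in
/-- The invariants `X^H = {x | h x = ε(h) x}` of an `H`-module. -/
def invariants (X : Type u) [AddCommGroup X] [Module k X] [Module H X] [IsScalarTower k H X] :
    Submodule k X where
  carrier := {x | ∀ h : H, h • x = counit (R := k) h • x}
  add_mem' := fun hx hy h => by rw [smul_add, smul_add, hx h, hy h]
  zero_mem' := fun h => by rw [smul_zero, smul_zero]
  smul_mem' := fun c x hx h => by rw [smul_comm h c x, hx h, smul_comm]

variable (k H) in
/-- The invariants of an `H`-module algebra form a subalgebra. -/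
def invariantSubalgebra (B : Type u) [Ring B] [Algebra k B] [Module H B] [IsScalarTower k H B]
    [IsModuleAlgebra k H B] : Subalgebra k B where
  carrier := {x | ∀ h : H, h • x = counit (R := k) h • x}
  mul_mem' := fun {x y} hx hy h => by
    rw [IsModuleAlgebra.smul_mul (k := k)]
    have hx' : ∀ h : H, h • x = counit (R := k) h • x := hx
    have hy' : ∀ h : H, h • y = counit (R := k) h • y := hy
    simp only [hx', hy', smul_mul_assoc, mul_smul_comm]
    exact sum_counit_right (LinearMap.toSpanSingleton k B (x * y) ∘ₗ counit) h
  add_mem' := fun hx hy h => by rw [smul_add, smul_add, hx h, hy h]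
  algebraMap_mem' := fun c h => by
    rw [Algebra.algebraMap_eq_smul_one, smul_comm h c, IsModuleAlgebra.smul_one (k := k),
      Algebra.algebraMap_eq_smul_one, smul_comm]

end

section
variable {k : Type u} [Field k] {A : DGAlgebra k}

/-- The degree `i` part of `H^*(Hom_A(M,N))`. -/
noncomputable def homHGr (M N : DGModule A) (i : ℤ) : Submodule k (HomHTot M N) :=
  LinearMap.range (DirectSum.lof k ℤ (HomH M N) i)

/-- `Ext_A^*(M,N) = H^*(Hom_A(P,Q))`, computed with K-projective resolutions `P` of `M` and `Q` of
`N`. For `M = N` and `P = Q` it is an algebra with product induced by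
`f * g = (-1)^{|f||g|} g ∘ f`. -/
abbrev Ext {M N : DGModule A} (P : KProjRes M) (Q : KProjRes N) : Type u := HomHTot P.P Q.P

/-- The degree `i` part `Ext_A^i(M,N)`. -/
noncomputable abbrev extGr {M N : DGModule A} (P : KProjRes M) (Q : KProjRes N) (i : ℤ) :
    Submodule k (Ext P Q) := homHGr P.P Q.P i

variable {H : Type u} [Ring H] [HopfAlgebra k H] [Module H A] [IsScalarTower k H A]
  [IsDGModuleAlgebra H A]

/-- For dg `A # H`-modules `M` and `N`, the graded `H`-module `Ext_A^*(M,N) = H^*(Hom_A(P,Q))`,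
computed with K-projective resolutions `P`, `Q` of the dg `A # H`-modules `M`, `N` (which are also
K-projective resolutions over `A`). -/
abbrev ExtRes {M N : DGModule (smashDG H A)} (P : KProjRes M) (Q : KProjRes N) : Type u :=
  HomHTot P.P.res Q.P.res

/-- The degree `i` part of `ExtRes P Q`. -/
noncomputable abbrev extResGr {M N : DGModule (smashDG H A)} (P : KProjRes M) (Q : KProjRes N)
    (i : ℤ) : Submodule k (ExtRes P Q) := homHGr P.P.res Q.P.res i

end

end DGHopf

namespace DGHopf
open scoped TensorProduct DirectSum
open Coalgebra HopfAlgebra WithConv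

/-! ### Operators between Hom complexes and their effect on cohomology -/

section HomOp
variable {k : Type u} [Field k] {A B : DGAlgebra k}

/-! All the isomorphisms come from operators on Hom complexes; cohomology is taken only afterwards.

Restriction from `A # H` to `A` has the right adjoint `X ↦ Hom(H, X)` (`coind`), which preserves
acyclicity. Hence restriction preserves K-projectivity (`DGModule.IsKProjective.res`), and a
resolution over `A # H` also computes Ext over `A`.

For (i) and (ii): an `A`-linear map `f` between `A # H`-modules is `H`-linear exactly when `h ⇀ f =
ε(h) f` (`homAct_of_mem_homDeg`, `mem_homDeg_of_homAct`). Semisimplicity provides an integral `t`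
with `ε(t) = 1`, and `f ↦ t ⇀ f` is a chain projection of `Hom_A(P,Q)` onto `Hom_{A # H}(P,Q)`
(`reynoldsOp`). So the inclusion of complexes is injective on cohomology, and its image there is the
image of `t`, which consists of the invariant classes. For `P = Q` the inclusion respects
composition, so the isomorphism is one of algebras.

For (iii): `P ⊗ H` is induced from `A`. The map `F ↦ F(- ⊗ 1)` is an isomorphism from `Hom_{A # H}(P
⊗ H, N)` to `Hom_A(P, N)`, with inverse `g ↦ (p ⊗ w ↦ (w ⇀ g)(p))` (`tensorExt`). Therefore `P ⊗ H`
is K-projective, hence a resolution of `M ⊗ H`. Since `A` acts on `P ⊗ H` through the first factor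
only and `H` is finite dimensional, `End_{A # H}(P ⊗ H) ≅ Hom_A(P, P ⊗ H) = Hom_A(P, P) ⊗ H`. Under
this identification `f ⊗ u` is `R_u ∘ Φ(f)`, where `R_u` is right multiplication by `u` and `Φ(f)(p
⊗ w) = (w₍₁₎ ⇀ f)(p) ⊗ w₍₂₎` (`freeMap`). The product of Ext reverses composition, so `Φ(f) ∘ R_u =
R_{u₍₂₎} ∘ Φ(u₍₁₎ ⇀ f)` (`freeMap_rightMul`) is the defining relation `u f = (u₍₁₎ f) u₍₂₎` of the
smash product.

Finally, the choice of resolutions does not matter: the cone of a quasi-isomorphism is acyclic, so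
mapping out of a K-projective module turns quasi-isomorphisms into quasi-isomorphisms
(`IsQuasiIso.exists_lift`, `IsQuasiIso.mem_homB_of_comp`). Two resolutions are thus related by
comparison maps inverse to each other up to homotopy, and conjugation with these identifies the Ext
groups. -/

theorem mem_homZ_iff {M N : DGModule A} {i : ℤ} {f : M →ₗ[k] N} :
    f ∈ homZ M N i ↔ f ∈ homDeg M N i ∧ homD M N i f = 0 := Iff.rfl

/-- A linear operator between Hom complexes of dg modules (over possibly different dg algebras)
that preserves degrees and commutes with the differentials. -/
structure HomOp (M N : DGModule A) (M' N' : DGModule B) where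
  toLin : (M →ₗ[k] N) →ₗ[k] (M' →ₗ[k] N')
  map_mem : ∀ {i : ℤ} {f : M →ₗ[k] N}, f ∈ homDeg M N i → toLin f ∈ homDeg M' N' i
  map_homD : ∀ (i : ℤ) (f : M →ₗ[k] N), homD M' N' i (toLin f) = toLin (homD M N i f)

namespace HomOp
variable {M N : DGModule A} {M' N' : DGModule B} (T : HomOp M N M' N')

theorem map_mem_homZ {i : ℤ} {f : M →ₗ[k] N} (hf : f ∈ homZ M N i) :
    T.toLin f ∈ homZ M' N' i := by
  rw [mem_homZ_iff] at hf ⊢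
  exact ⟨T.map_mem hf.1, by rw [T.map_homD, hf.2, map_zero]⟩

theorem map_mem_homB {i : ℤ} {f : M →ₗ[k] N} (hf : f ∈ homB M N i) :
    T.toLin f ∈ homB M' N' i := by
  obtain ⟨g, hg, rfl⟩ := hf
  exact ⟨T.toLin g, T.map_mem hg, T.map_homD _ g⟩

/-- The induced map on cocycles. -/
noncomputable def mapZ (i : ℤ) : homZ M N i →ₗ[k] homZ M' N' i :=
  T.toLin.restrict fun _ hf => T.map_mem_homZ hf

/-- The induced map on cohomology. -/
noncomputable def mapH (i : ℤ) : HomH M N i →ₗ[k] HomH M' N' i :=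
  Submodule.mapQ _ _ (T.mapZ i) fun f hf => T.map_mem_homB (f := f.1) hf

theorem mapH_mk (i : ℤ) (f : homZ M N i) :
    T.mapH i (HomH.mk M N i f) = HomH.mk M' N' i (T.mapZ i f) := rfl

/-- The induced map on total cohomology. -/
noncomputable def mapTot : HomHTot M N →ₗ[k] HomHTot M' N' := DirectSum.lmap T.mapH

theorem mapTot_apply (x : HomHTot M N) (i : ℤ) : T.mapTot x i = T.mapH i (x i) := rfl

theorem mapTot_of (i : ℤ) (x : HomH M N i) :
    T.mapTot (DirectSum.of _ i x) = DirectSum.of _ i (T.mapH i x) := DirectSum.lmap_lof _ _ _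

theorem mapTot_of_mk (i : ℤ) (f : homZ M N i) :
    T.mapTot (DirectSum.of _ i (HomH.mk M N i f)) =
      DirectSum.of _ i (HomH.mk M' N' i (T.mapZ i f)) := T.mapTot_of i _

theorem mapTot_mapTot_of_sub_mem (T' : HomOp M' N' M N)
    (h : ∀ i, ∀ f ∈ homZ M N i, T'.toLin (T.toLin f) - f ∈ homB M N i) (x : HomHTot M N) :
    T'.mapTot (T.mapTot x) = x := by
  refine DFinsupp.ext fun i => ?_
  change T'.mapH i (T.mapH i (x i)) = x i
  obtain ⟨f, hf⟩ := HomH.mk_surjective M N i (x i)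
  rw [← hf, mapH_mk, mapH_mk, HomH.mk_eq_iff]
  exact h i f.1 f.2

end HomOp

/-- Degrees such as `i + 0` and `i` index different summands as types. This lets classes be compared
through their underlying linear maps whenever the degrees are equal. -/
theorem of_mk_eq {M : DGModule A} {i j : ℤ} (h : i = j) {f : homZ M M i} {g : homZ M M j}
    (hfg : f.1 = g.1) : DirectSum.of (HomH M M) i (HomH.mk M M i f) =
      DirectSum.of (HomH M M) j (HomH.mk M M j g) :=
  DirectSum.of_eq_of_gradedMonoid_eq (HomH.mk_heq h hfg)

theorem of_mk_mul_of_mk {M : DGModule A} {i j : ℤ} (f : homZ M M i) (g : homZ M M j) :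
    DirectSum.of (HomH M M) i (HomH.mk M M i f) * DirectSum.of (HomH M M) j (HomH.mk M M j g) =
      DirectSum.of (HomH M M) (i + j) (HomH.mk M M (i + j) (starZ f g)) :=
  DirectSum.of_mul_of _ _

theorem homHTot_one (M : DGModule A) :
    (1 : HomHTot M M) = DirectSum.of (HomH M M) 0 (HomH.mk M M 0 (oneZ M)) := rfl

theorem homHTot_induction {M N : DGModule A} {p : HomHTot M N → Prop} (x : HomHTot M N)
    (h0 : p 0) (h1 : ∀ i (f : homZ M N i), p (DirectSum.of _ i (HomH.mk M N i f)))
    (h2 : ∀ x y, p x → p y → p (x + y)) : p x := by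
  induction x using DirectSum.induction_on with
  | zero => exact h0
  | add x y hx hy => exact h2 x y hx hy
  | of i x =>
    obtain ⟨f, rfl⟩ := HomH.mk_surjective M N i x
    exact h1 i f

theorem mem_homHGr_iff {M N : DGModule A} {i : ℤ} {x : HomHTot M N} :
    x ∈ homHGr M N i ↔ ∀ j, j ≠ i → x j = 0 := by
  constructor
  · rintro ⟨y, rfl⟩ j hj
    exact DirectSum.of_eq_of_ne i j y hj
  · intro h
    refine ⟨x i, DFinsupp.ext fun j => ?_⟩
    by_cases hj : j = i
    · subst hj
      exact DirectSum.of_eq_same j _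
    · exact (DirectSum.of_eq_of_ne i j _ hj).trans (h j hj).symm

theorem of_mem_homHGr {M N : DGModule A} (i : ℤ) (x : HomH M N i) :
    DirectSum.of (HomH M N) i x ∈ homHGr M N i := ⟨x, rfl⟩

/-- Membership means that all components outside degree `i` vanish. The operator acts degree by
degree, and injectivity makes it reflect vanishing. -/
theorem HomOp.mapTot_mem_homHGr_iff {M N : DGModule A} {M' N' : DGModule B}
    (T : HomOp M N M' N') (hT : Function.Injective T.mapTot) {i : ℤ} {x : HomHTot M N} :
    T.mapTot x ∈ homHGr M' N' i ↔ x ∈ homHGr M N i := by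
  rw [mem_homHGr_iff, mem_homHGr_iff]
  refine forall₂_congr fun j _ => ?_
  rw [T.mapTot_apply]
  exact map_eq_zero_iff _ ((DirectSum.lmap_injective T.mapH).1 hT j)

/-- The algebra map on total cohomology induced by a chain operator that is multiplicative up to
coboundaries. -/
noncomputable def HomOp.algHom {M : DGModule A} {M' : DGModule B} (T : HomOp M M M' M')
    (h1 : T.toLin LinearMap.id - LinearMap.id ∈ homB M' M' 0)
    (hmul : ∀ i j, ∀ f ∈ homZ M M i, ∀ g ∈ homZ M M j,
      T.toLin (g ∘ₗ f) - T.toLin g ∘ₗ T.toLin f ∈ homB M' M' (i + j)) :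
    HomHTot M M →ₐ[k] HomHTot M' M' :=
  AlgHom.ofLinearMap T.mapTot
    (by
      rw [homHTot_one, T.mapTot_of_mk, homHTot_one]
      congr 1
      rw [HomH.mk_eq_iff]
      exact h1)
    (fun x y => by
      induction x using homHTot_induction with
      | h0 => simp
      | h2 x x' hx hx' => simp only [add_mul, map_add, hx, hx']
      | h1 i f =>
        induction y using homHTot_induction with
        | h0 => simp
        | h2 y y' hy hy' => simp only [mul_add, map_add, hy, hy']
        | h1 j g =>
          rw [of_mk_mul_of_mk, T.mapTot_of_mk, T.mapTot_of_mk, T.mapTot_of_mk, of_mk_mul_of_mk]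
          congr 1
          rw [HomH.mk_eq_iff]
          -- Degrees are preserved, so both products carry the same Koszul sign and it factors out.
          change T.toLin ((i * j).negOnePow • (g.1 ∘ₗ f.1)) -
            (i * j).negOnePow • (T.toLin g.1 ∘ₗ T.toLin f.1) ∈ _
          rw [LinearMap.map_smul_of_tower, ← smul_sub]
          exact units_smul_mem _ _ (hmul i j f.1 f.2 g.1 g.2))

end HomOp

/-! ### Gradings on shifts, products and Hom spaces -/

section Graded
variable {k : Type u} [Field k] {V W : Type u} [AddCommGroup V] [Module k V] [AddCommGroup W]
  [Module k W]

theorem isInternal_shift {g : ℤ → Submodule k V} (h : DirectSum.IsInternal g) (c : ℤ) :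
    DirectSum.IsInternal fun n => g (n + c) := by
  rw [DirectSum.isInternal_submodule_iff_iSupIndep_and_iSup_eq_top] at h ⊢
  refine ⟨h.1.comp (add_left_injective c), ?_⟩
  rw [← h.2]
  exact (Equiv.addRight c).iSup_comp (g := g)

theorem isInternal_prod {g : ℤ → Submodule k V} {g' : ℤ → Submodule k W}
    (h : DirectSum.IsInternal g) (h' : DirectSum.IsInternal g') :
    DirectSum.IsInternal fun n => (g n).prod (g' n) := by
  rw [DirectSum.isInternal_submodule_iff_iSupIndep_and_iSup_eq_top] at h h' ⊢
  constructor
  · intro i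
    rw [Submodule.disjoint_def]
    rintro ⟨v, w⟩ hx hx'
    have hle : (⨆ j, ⨆ (_ : j ≠ i), (g j).prod (g' j)) ≤
        (⨆ j, ⨆ (_ : j ≠ i), g j).prod (⨆ j, ⨆ (_ : j ≠ i), g' j) :=
      iSup₂_le fun j hj => Submodule.prod_mono (le_iSup₂_of_le j hj le_rfl)
        (le_iSup₂_of_le j hj le_rfl)
    have h2 := hle hx'
    exact Prod.ext (Submodule.disjoint_def.1 (h.1 i) v hx.1 h2.1)
      (Submodule.disjoint_def.1 (h'.1 i) w hx.2 h2.2)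
  · rw [eq_top_iff]
    rintro ⟨v, w⟩ -
    have h1 : (⨆ n, g n) ≤ (⨆ n, (g n).prod (g' n)).comap (LinearMap.inl k V W) :=
      iSup_le fun n x hx => (le_iSup (fun n => (g n).prod (g' n)) n) ⟨hx, Submodule.zero_mem _⟩
    have h2 : (⨆ n, g' n) ≤ (⨆ n, (g n).prod (g' n)).comap (LinearMap.inr k V W) :=
      iSup_le fun n x hx => (le_iSup (fun n => (g n).prod (g' n)) n) ⟨Submodule.zero_mem _, hx⟩
    rw [h.2] at h1
    rw [h'.2] at h2
    have h3 : (v, (0 : W)) ∈ ⨆ n, (g n).prod (g' n) := h1 Submodule.mem_top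
    have h4 : ((0 : V), w) ∈ ⨆ n, (g n).prod (g' n) := h2 Submodule.mem_top
    simpa using Submodule.add_mem _ h3 h4

/-- Finite dimension makes every map the finite sum of rank one maps `b_j^* ⊗ φ(b_j)`, and each
vector `φ(b_j)` splits into finitely many homogeneous parts. -/
theorem isInternal_hom [FiniteDimensional k V] {g : ℤ → Submodule k W}
    (h : DirectSum.IsInternal g) :
    DirectSum.IsInternal fun n => (⨅ v : V, (g n).comap (LinearMap.applyₗ v) :
      Submodule k (V →ₗ[k] W)) := by
  rw [DirectSum.isInternal_submodule_iff_iSupIndep_and_iSup_eq_top] at h ⊢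
  constructor
  · intro i
    rw [Submodule.disjoint_def]
    intro φ hφ hφ'
    refine LinearMap.ext fun v => ?_
    have hle : (⨆ j, ⨆ (_ : j ≠ i), (⨅ v : V, (g j).comap (LinearMap.applyₗ v) :
        Submodule k (V →ₗ[k] W))) ≤ (⨆ j, ⨆ (_ : j ≠ i), g j).comap (LinearMap.applyₗ v) :=
      iSup₂_le fun j hj => (iInf_le _ v).trans
        (Submodule.comap_mono (le_iSup₂_of_le j hj le_rfl))
    exact Submodule.disjoint_def.1 (h.1 i) _ ((Submodule.mem_iInf _).1 hφ v) (hle hφ')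
  · rw [eq_top_iff]
    intro φ _
    let b := Module.finBasis k V
    have hφ : φ = ∑ j, (b.coord j).smulRight (φ (b j)) :=
      b.ext fun j => by simp [LinearMap.sum_apply, Finsupp.single_apply]
    rw [hφ]
    refine Submodule.sum_mem _ fun j _ => ?_
    have h1 : (⨆ n, g n) ≤ (⨆ n, (⨅ v : V, (g n).comap (LinearMap.applyₗ v) :
        Submodule k (V →ₗ[k] W))).comap (LinearMap.smulRightₗ (b.coord j)) :=
      iSup_le fun n x hx => (le_iSup (fun n => (⨅ v : V, (g n).comap (LinearMap.applyₗ v) :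
        Submodule k (V →ₗ[k] W))) n) ((Submodule.mem_iInf _).2 fun v => (g n).smul_mem _ hx)
    exact h1 (h.2 ▸ Submodule.mem_top : φ (b j) ∈ _)

end Graded

/-! ### Mapping cones, and lifting maps from K-projective modules along quasi-isomorphisms -/

section Cone
variable {k : Type u} [Field k] {A : DGAlgebra k}

theorem DGModule.gr_induction (M : DGModule A) {p : M → Prop} (m : M) (h0 : p 0)
    (h1 : ∀ n, ∀ m ∈ M.gr n, p m) (h2 : ∀ x y, p x → p y → p (x + y)) : p m :=
  Submodule.iSup_induction M.gr (motive := p)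
    (M.isInternal.submodule_iSup_eq_top ▸ Submodule.mem_top) h1 h0 h2

/-- The sign operator, `m ↦ (-1)^n m` on the degree `n` part. -/
noncomputable def DGModule.sgn (M : DGModule A) : M →ₗ[k] M :=
  DirectSum.toModule k ℤ M (fun n => n.negOnePow • (M.gr n).subtype) ∘ₗ
    (LinearEquiv.ofBijective (DirectSum.coeLinearMap M.gr) M.isInternal).symm.toLinearMap

theorem DGModule.sgn_of_mem (M : DGModule A) {n : ℤ} {m : M} (hm : m ∈ M.gr n) :
    M.sgn m = n.negOnePow • m := by
  have h : (LinearEquiv.ofBijective (DirectSum.coeLinearMap M.gr) M.isInternal).symm m =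
      DirectSum.lof k ℤ (fun n => M.gr n) n ⟨m, hm⟩ := by
    rw [LinearEquiv.symm_apply_eq]
    exact (DirectSum.coeLinearMap_lof M.gr n ⟨m, hm⟩).symm
  rw [sgn, LinearMap.comp_apply, LinearEquiv.coe_coe, h, DirectSum.toModule_lof]
  rfl

theorem DGModule.sgn_mem (M : DGModule A) {n : ℤ} {m : M} (hm : m ∈ M.gr n) :
    M.sgn m ∈ M.gr n := by
  rw [M.sgn_of_mem hm]
  exact units_smul_mem _ _ hm

theorem negOnePow_smul_self {V : Type*} [AddCommGroup V] (n : ℤ) (v : V) :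
    n.negOnePow • n.negOnePow • v = v := by
  rw [smul_smul, ← Int.negOnePow_add, Int.negOnePow_even _ (Even.add_self n), one_smul]

theorem DGModule.sgn_sgn (M : DGModule A) (m : M) : M.sgn (M.sgn m) = m := by
  induction m using M.gr_induction with
  | h0 => simp
  | h1 n m hm => rw [M.sgn_of_mem (M.sgn_mem hm), M.sgn_of_mem hm, negOnePow_smul_self]
  | h2 x y hx hy => rw [map_add, map_add, hx, hy]

theorem DGModule.sgn_d (M : DGModule A) (m : M) : M.sgn (M.d m) = -M.d (M.sgn m) := by
  induction m using M.gr_induction with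
  | h0 => simp
  | h1 n m hm =>
    rw [M.sgn_of_mem (M.d_mem hm), M.sgn_of_mem hm, LinearMap.map_smul_of_tower,
      Int.negOnePow_succ, Units.neg_smul]
  | h2 x y hx hy => rw [map_add, map_add, hx, hy, map_add, map_add, neg_add]

theorem DGModule.sgn_smul (M : DGModule A) {i : ℤ} {a : A} (ha : a ∈ A.gr i) (m : M) :
    M.sgn (a • m) = i.negOnePow • a • M.sgn m := by
  induction m using M.gr_induction with
  | h0 => simp
  | h1 n m hm =>
    rw [M.sgn_of_mem (M.smul_mem ha hm), M.sgn_of_mem hm, smul_comm a, smul_smul,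
      Int.negOnePow_add]
  | h2 x y hx hy => rw [smul_add, map_add, hx, hy, map_add, smul_add, smul_add]

variable {L N : DGModule A} {π : L →ₗ[k] N}

/-- The mapping cone of a quasi-isomorphism. -/
noncomputable def cone (hπ : IsQuasiIso π) : DGModule A where
  carrier := L × N
  addCommGroup := inferInstance
  moduleBase := inferInstance
  module := inferInstance
  isScalarTower := inferInstance
  gr := fun n => (L.gr (n + 1)).prod (N.gr n)
  isInternal := isInternal_prod (isInternal_shift L.isInternal 1) N.isInternal
  smul_mem := fun ha hm => ⟨by rw [add_assoc]; exact L.smul_mem ha hm.1, N.smul_mem ha hm.2⟩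
  -- The shifted copy of `L` keeps its own action and differential. The usual shift, with both
  -- twisted by signs, is isomorphic to it through `sgn`, so the signs are concentrated in the
  -- connecting map `π ∘ sgn`. The differential squares to zero because `sgn` anticommutes with `d`.
  d := LinearMap.prod (L.d ∘ₗ LinearMap.fst k L N)
    ((π ∘ₗ L.sgn) ∘ₗ LinearMap.fst k L N + N.d ∘ₗ LinearMap.snd k L N)
  d_mem := fun hm => ⟨L.d_mem hm.1,
    Submodule.add_mem _ (hπ.map_mem _ _ (L.sgn_mem hm.1)) (N.d_mem hm.2)⟩
  d_d := fun m => Prod.ext (L.d_d m.1) (by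
    change π (L.sgn (L.d m.1)) + N.d (π (L.sgn m.1) + N.d m.2) = 0
    rw [L.sgn_d, map_neg, hπ.map_d, map_add, N.d_d, add_zero, neg_add_cancel])
  d_smul := fun {i a} m ha => Prod.ext (L.d_smul m.1 ha) (by
    change π (L.sgn (a • m.1)) + N.d (a • m.2) =
      A.d a • m.2 + i.negOnePow • a • (π (L.sgn m.1) + N.d m.2)
    rw [L.sgn_smul ha, LinearMap.map_smul_of_tower, hπ.map_smul, N.d_smul _ ha, smul_add,
      smul_add]
    abel)

theorem cone_d_apply (hπ : IsQuasiIso π) (p : L) (m : N) :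
    (cone hπ).d (p, m) = (L.d p, π (L.sgn p) + N.d m) := rfl

theorem cone_isAcyclic (hπ : IsQuasiIso π) : (cone hπ).IsAcyclic := by
  rintro ⟨p, m⟩ h
  rw [cone_d_apply] at h
  have hp : L.d p = 0 := congrArg Prod.fst h
  have hm : π (L.sgn p) + N.d m = 0 := congrArg Prod.snd h
  have hp' : L.d (L.sgn p) = 0 := by rw [← neg_eq_zero, ← L.sgn_d, hp, map_zero]
  obtain ⟨p1, hp1⟩ := hπ.inj (L.sgn p) hp' ⟨-m, by rw [map_neg, ← eq_neg_of_add_eq_zero_left hm]⟩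
  have hp2 : L.d (-L.sgn p1) = p := by rw [map_neg, ← L.sgn_d, hp1, L.sgn_sgn]
  -- Once the contribution of `-sgn p1` is removed, the second component is a cocycle of `N`, hence
  -- `π q + d n`. Adding the cocycle `sgn q` to the first component accounts for `π q`, since `sgn`
  -- is an involution.
  have hc : N.d (m - π (L.sgn (-L.sgn p1))) = 0 := by
    rw [map_neg, L.sgn_sgn, map_neg, sub_neg_eq_add, map_add, ← hπ.map_d, hp1, add_comm, hm]
  obtain ⟨q, hq, n, hn⟩ := hπ.surj _ hc
  refine ⟨(-L.sgn p1 + L.sgn q, n), ?_⟩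
  rw [cone_d_apply]
  refine Prod.ext ?_ ?_
  · change L.d (-L.sgn p1 + L.sgn q) = p
    rw [map_add, hp2, ← neg_neg (L.d (L.sgn q)), ← L.sgn_d, hq, map_zero, neg_zero, add_zero]
  · change π (L.sgn (-L.sgn p1 + L.sgn q)) + N.d n = m
    rw [map_add, map_add, L.sgn_sgn q, add_assoc, ← hn, add_sub_cancel]

variable {P : DGModule A}

theorem sgn_comp_mem_homDeg {i : ℤ} {f : P →ₗ[k] L}
    (h1 : ∀ n, ∀ m ∈ P.gr n, f m ∈ L.gr (n + i))
    (h2 : ∀ j, ∀ a ∈ A.gr j, ∀ m : P, f (a • m) = ((i - 1) * j).negOnePow • (a • f m)) :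
    L.sgn ∘ₗ f ∈ homDeg P L i := by
  refine ⟨fun n m hm => L.sgn_mem (h1 n m hm), fun j a ha m => ?_⟩
  rw [LinearMap.comp_apply, LinearMap.comp_apply, h2 j a ha, LinearMap.map_smul_of_tower,
    L.sgn_smul ha, smul_smul, ← Int.negOnePow_add]
  congr 2
  ring

/-- Composition with `sgn` raises the formal degree, and so the sign in the Hom differential, by
one; `sgn` also anticommutes with `d`. This is how a first component of a map to the cone becomes an
honest map to `L`. -/
theorem homD_sgn_comp (i : ℤ) (f : P →ₗ[k] L) :
    homD P L (i + 1) (L.sgn ∘ₗ f) = -(L.sgn ∘ₗ homD P L i f) := by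
  refine LinearMap.ext fun m => ?_
  rw [LinearMap.neg_apply, LinearMap.comp_apply, homD_apply, homD_apply, map_sub, L.sgn_d,
    LinearMap.comp_apply, LinearMap.comp_apply, LinearMap.map_smul_of_tower, Int.negOnePow_succ,
    Units.neg_smul]
  abel

theorem sgn_sgn_comp (f : P →ₗ[k] L) : L.sgn ∘ₗ L.sgn ∘ₗ f = f :=
  LinearMap.ext fun m => L.sgn_sgn (f m)

/-- The map to the cone with given components. -/
def coneMk (hπ : IsQuasiIso π) (g : P →ₗ[k] L) (s : P →ₗ[k] N) : P →ₗ[k] cone hπ :=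
  LinearMap.prod g s

theorem homD_coneMk (hπ : IsQuasiIso π) (i : ℤ) (g : P →ₗ[k] L) (s : P →ₗ[k] N) :
    homD P (cone hπ) i (coneMk hπ g s) =
      coneMk hπ (homD P L i g) (π ∘ₗ L.sgn ∘ₗ g + homD P N i s) := by
  refine LinearMap.ext fun m => Prod.ext rfl ?_
  change π (L.sgn (g m)) + N.d (s m) - i.negOnePow • s (P.d m) =
    π (L.sgn (g m)) + (N.d (s m) - i.negOnePow • s (P.d m))
  abel

theorem coneMk_surjective (hπ : IsQuasiIso π) (F : P →ₗ[k] cone hπ) :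
    ∃ g s, F = coneMk hπ g s :=
  ⟨LinearMap.fst k L N ∘ₗ (F : P →ₗ[k] L × N), LinearMap.snd k L N ∘ₗ (F : P →ₗ[k] L × N), rfl⟩

theorem coneMk_injective (hπ : IsQuasiIso π) {g g' : P →ₗ[k] L} {s s' : P →ₗ[k] N}
    (h : coneMk hπ g s = coneMk hπ g' s') : g = g' ∧ s = s' :=
  ⟨LinearMap.ext fun m => congrArg Prod.fst (LinearMap.congr_fun h m),
    LinearMap.ext fun m => congrArg Prod.snd (LinearMap.congr_fun h m)⟩

/-- The component `g` raises degrees in `L` by `i + 1`, but obeys the sign rule of degree `i`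
because the action on the cone is untwisted. Composing with `sgn` supplies the missing sign
`(-1)^|a|`. -/
theorem coneMk_mem_homDeg (hπ : IsQuasiIso π) {i : ℤ} {g : P →ₗ[k] L} {s : P →ₗ[k] N} :
    coneMk hπ g s ∈ homDeg P (cone hπ) i ↔
      L.sgn ∘ₗ g ∈ homDeg P L (i + 1) ∧ s ∈ homDeg P N i := by
  constructor
  · intro h
    refine ⟨sgn_comp_mem_homDeg (fun n m hm => ?_) fun j a ha m => ?_,
      fun n m hm => (h.1 n m hm).2, fun j a ha m => congrArg Prod.snd (h.2 j a ha m)⟩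
    · rw [← add_assoc]; exact (h.1 n m hm).1
    · rw [add_sub_cancel_right]; exact congrArg Prod.fst (h.2 j a ha m)
  · rintro ⟨hg, hs⟩
    refine ⟨fun n m hm => ⟨?_, hs.1 n m hm⟩, fun j a ha m => Prod.ext ?_ (hs.2 j a ha m)⟩
    · have := L.sgn_mem (hg.1 n m hm)
      rwa [LinearMap.comp_apply, L.sgn_sgn, ← add_assoc] at this
    · have := congrArg L.sgn (hg.2 j a ha m)
      rw [LinearMap.comp_apply, LinearMap.comp_apply, L.sgn_sgn, LinearMap.map_smul_of_tower L.sgn,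
        L.sgn_smul ha, L.sgn_sgn, smul_smul, ← Int.negOnePow_add] at this
      refine this.trans ?_
      change _ = (i * j).negOnePow • a • g m
      rw [show (i + 1) * j + j = i * j + (j + j) by ring, Int.negOnePow_add,
        Int.negOnePow_even _ (Even.add_self j), mul_one]

/-- The pair `(0, f)` is a cocycle with values in the acyclic cone, so it is the coboundary of some
`(g, s)`. Comparing components, `g` is a cocycle and `f = π ∘ sgn ∘ g + d s`, so `sgn ∘ g` is the
lift. This is surjectivity of `Hom(P, π)` on cohomology. -/
theorem IsQuasiIso.exists_lift (hπ : IsQuasiIso π) (hP : P.IsKProjective) {i : ℤ}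
    {f : P →ₗ[k] N} (hf : f ∈ homZ P N i) : ∃ g ∈ homZ P L i, f - π ∘ₗ g ∈ homB P N i := by
  have hd : homD P N i f = 0 := hf.2
  have hz : coneMk hπ 0 f ∈ homZ P (cone hπ) i := by
    refine ⟨(coneMk_mem_homDeg hπ).2 ⟨by rw [LinearMap.comp_zero]; exact Submodule.zero_mem _,
      hf.1⟩, ?_⟩
    change homD P (cone hπ) i (coneMk hπ 0 f) = 0
    rw [homD_coneMk, hd]
    simp only [map_zero, LinearMap.comp_zero, add_zero]
    rfl
  obtain ⟨F, hF, hFd⟩ := hP _ (cone_isAcyclic hπ) i hz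
  obtain ⟨g, s, rfl⟩ := coneMk_surjective hπ F
  obtain ⟨hg, hs⟩ := (coneMk_mem_homDeg hπ).1 hF
  rw [homD_coneMk] at hFd
  obtain ⟨h1, h2⟩ := coneMk_injective hπ hFd
  have h3 := homD_sgn_comp (i - 1) g
  rw [sub_add_cancel] at hg h3
  refine ⟨L.sgn ∘ₗ g, ⟨hg, ?_⟩, s, hs, ?_⟩
  · change homD P L i (L.sgn ∘ₗ g) = 0
    rw [h3, h1, LinearMap.comp_zero, neg_zero]
  · rw [← h2, add_sub_cancel_left]

/-- If `π ∘ g = d s`, then `(sgn ∘ g, -s)` is a cocycle of degree `i - 1` with values in the cone,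
hence the coboundary of some `(u, v)`. The first component gives `g = d(-sgn ∘ u)`. This is
injectivity of `Hom(P, π)` on cohomology. -/
theorem IsQuasiIso.mem_homB_of_comp (hπ : IsQuasiIso π) (hP : P.IsKProjective) {i : ℤ}
    {g : P →ₗ[k] L} (hg : g ∈ homZ P L i) (h : π ∘ₗ g ∈ homB P N i) : g ∈ homB P L i := by
  obtain ⟨s, hs, hsd⟩ := h
  have hd : homD P L i g = 0 := hg.2
  have h3 := homD_sgn_comp (i - 1) (L.sgn ∘ₗ g)
  rw [sub_add_cancel, sgn_sgn_comp, hd] at h3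
  have h4 : homD P L (i - 1) (L.sgn ∘ₗ g) = 0 := by
    have := congrArg (L.sgn ∘ₗ ·) (neg_eq_zero.1 h3.symm)
    simpa only [sgn_sgn_comp, LinearMap.comp_zero] using this
  have hz : coneMk hπ (L.sgn ∘ₗ g) (-s) ∈ homZ P (cone hπ) (i - 1) := by
    refine ⟨(coneMk_mem_homDeg hπ).2 ⟨?_, Submodule.neg_mem _ hs⟩, ?_⟩
    · rw [sgn_sgn_comp, sub_add_cancel]; exact hg.1
    · change homD P (cone hπ) (i - 1) (coneMk hπ (L.sgn ∘ₗ g) (-s)) = 0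
      rw [homD_coneMk, h4, sgn_sgn_comp, map_neg, hsd, add_neg_cancel]
      rfl
  obtain ⟨F, hF, hFd⟩ := hP _ (cone_isAcyclic hπ) (i - 1) hz
  obtain ⟨u, v, rfl⟩ := coneMk_surjective hπ F
  obtain ⟨hu, -⟩ := (coneMk_mem_homDeg hπ).1 hF
  rw [homD_coneMk] at hFd
  obtain ⟨h1, -⟩ := coneMk_injective hπ hFd
  have h5 := homD_sgn_comp (i - 1 - 1) u
  rw [sub_add_cancel] at hu h5
  refine ⟨-(L.sgn ∘ₗ u), Submodule.neg_mem _ hu, ?_⟩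
  rw [map_neg, h5, neg_neg, h1, sgn_sgn_comp]

end Cone

/-! ### Comparison of K-projective resolutions -/

section Resolutions
variable {k : Type u} [Field k] {A : DGAlgebra k}

theorem homD_zero_eq_zero {M N : DGModule A} {f : M →ₗ[k] N}
    (h : ∀ m, N.d (f m) = f (M.d m)) : homD M N 0 f = 0 :=
  LinearMap.ext fun m => by
    rw [homD_apply, h, Int.negOnePow_zero, one_smul, sub_self, LinearMap.zero_apply]

theorem mem_homZ_zero {M N : DGModule A} {f : M →ₗ[k] N} (h1 : ∀ n, ∀ m ∈ M.gr n, f m ∈ N.gr n)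
    (h2 : ∀ (a : A) (m : M), f (a • m) = a • f m) (h3 : ∀ m, N.d (f m) = f (M.d m)) :
    f ∈ homZ M N 0 := by
  refine ⟨⟨fun n m hm => by rw [add_zero]; exact h1 n m hm, fun j a _ m => ?_⟩,
    homD_zero_eq_zero h3⟩
  rw [h2, zero_mul, Int.negOnePow_zero, one_smul]

theorem IsQuasiIso.mem_homZ {L N : DGModule A} {π : L →ₗ[k] N} (hπ : IsQuasiIso π) :
    π ∈ homZ L N 0 :=
  mem_homZ_zero hπ.map_mem hπ.map_smul fun m => (hπ.map_d m).symm

theorem comp_mem_homZ_zero {L M N : DGModule A} {f : L →ₗ[k] M} {g : M →ₗ[k] N}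
    (hf : f ∈ homZ L M 0) (hg : g ∈ homZ M N 0) : g ∘ₗ f ∈ homZ L N 0 := by
  have := comp_mem_homZ hf hg
  rwa [add_zero] at this

theorem KProjRes.exists_hom {M : DGModule A} (P P' : KProjRes M) :
    ∃ φ ∈ homZ P.P P'.P 0, P.π - P'.π ∘ₗ φ ∈ homB P.P M 0 :=
  P'.isQuasiIso.exists_lift P.isKProjective P.isQuasiIso.mem_homZ

/-- Both comparison maps are compatible with the augmentations up to coboundaries, so `π ∘ (ψ ∘ φ -
id)` is a coboundary. K-projectivity of the source then allows `π` to be cancelled. -/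
theorem KProjRes.comp_sub_id_mem {M : DGModule A} (P P' : KProjRes M) {φ : P.P →ₗ[k] P'.P}
    {ψ : P'.P →ₗ[k] P.P} (hφ : φ ∈ homZ P.P P'.P 0) (hψ : ψ ∈ homZ P'.P P.P 0)
    (h : P.π - P'.π ∘ₗ φ ∈ homB P.P M 0) (h' : P'.π - P.π ∘ₗ ψ ∈ homB P'.P M 0) :
    ψ ∘ₗ φ - LinearMap.id ∈ homB P.P P.P 0 := by
  refine P.isQuasiIso.mem_homB_of_comp P.isKProjective
    (Submodule.sub_mem _ (comp_mem_homZ_zero hφ hψ) (oneZ P.P).2) ?_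
  have e : P.π ∘ₗ (ψ ∘ₗ φ - LinearMap.id) =
      -((P'.π - P.π ∘ₗ ψ) ∘ₗ φ) - (P.π - P'.π ∘ₗ φ) := by
    rw [LinearMap.comp_sub, LinearMap.sub_comp, LinearMap.comp_id, LinearMap.comp_assoc]
    abel
  have h1 := comp_mem_homB_left hφ h'
  rw [add_zero] at h1
  rw [e]
  exact Submodule.sub_mem _ (Submodule.neg_mem _ h1) h

variable {P Q P' Q' : DGModule A}

/-- The operator `f ↦ φ ∘ f ∘ ψ` for cocycles `φ` and `ψ` of degree zero. -/
noncomputable def conjOp {ψ : P' →ₗ[k] P} {φ : Q →ₗ[k] Q'} (hψ : ψ ∈ homZ P' P 0)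
    (hφ : φ ∈ homZ Q Q' 0) : HomOp P Q P' Q' where
  toLin := LinearMap.lcomp k Q' ψ ∘ₗ LinearMap.compRight k φ
  map_mem := fun {i f} hf => by
    have := comp_mem_homDeg hψ.1 (comp_mem_homDeg hf hφ.1)
    rwa [zero_add, add_zero] at this
  map_homD := fun i f => by
    have h1 : homD P' P 0 ψ = 0 := hψ.2
    have h2 : homD Q Q' 0 φ = 0 := hφ.2
    have h3 := homD_comp i 0 f φ
    have h4 := homD_comp 0 i ψ (φ ∘ₗ f)
    rw [h2, LinearMap.zero_comp, zero_add, add_zero, Int.negOnePow_zero, one_smul] at h3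
    rw [h1, LinearMap.comp_zero, smul_zero, add_zero, zero_add, h3] at h4
    exact h4

theorem conjOp_apply {ψ : P' →ₗ[k] P} {φ : Q →ₗ[k] Q'} (hψ : ψ ∈ homZ P' P 0)
    (hφ : φ ∈ homZ Q Q' 0) (f : P →ₗ[k] Q) : (conjOp hψ hφ).toLin f = φ ∘ₗ f ∘ₗ ψ := rfl

theorem comp_comp_sub_mem_homB {a : P →ₗ[k] P} {b : Q →ₗ[k] Q} (ha : a ∈ homZ P P 0)
    (ha' : a - LinearMap.id ∈ homB P P 0) (hb' : b - LinearMap.id ∈ homB Q Q 0) {i : ℤ}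
    {f : P →ₗ[k] Q} (hf : f ∈ homZ P Q i) : b ∘ₗ f ∘ₗ a - f ∈ homB P Q i := by
  have e : b ∘ₗ f ∘ₗ a - f = (b - LinearMap.id) ∘ₗ f ∘ₗ a + f ∘ₗ (a - LinearMap.id) := by
    rw [LinearMap.sub_comp, LinearMap.comp_sub, LinearMap.id_comp, LinearMap.comp_id]
    abel
  have h1 := comp_mem_homB_left (comp_mem_homZ ha hf) hb'
  have h2 := comp_mem_homB_right ha' hf
  rw [zero_add, add_zero] at h1
  rw [zero_add] at h2
  rw [e]
  exact Submodule.add_mem _ h1 h2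

/-- `Ext` does not depend on the resolutions. -/
theorem exists_ext_equiv {M N : DGModule A} (P P' : KProjRes M) (Q Q' : KProjRes N) :
    ∃ e : Ext P Q ≃ₗ[k] Ext P' Q', ∀ i x, x ∈ extGr P Q i ↔ e x ∈ extGr P' Q' i := by
  obtain ⟨φ, hφ, hφ'⟩ := P.exists_hom P'
  obtain ⟨ψ, hψ, hψ'⟩ := P'.exists_hom P
  obtain ⟨σ, hσ, hσ'⟩ := Q.exists_hom Q'
  obtain ⟨τ, hτ, hτ'⟩ := Q'.exists_hom Q
  let e : Ext P Q ≃ₗ[k] Ext P' Q' := LinearEquiv.ofLinearMap (conjOp hψ hσ).mapTot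
    (conjOp hφ hτ).mapTot
    (LinearMap.ext fun x => (conjOp hφ hτ).mapTot_mapTot_of_sub_mem _ (fun i f hf =>
      comp_comp_sub_mem_homB (comp_mem_homZ_zero hψ hφ) (P'.comp_sub_id_mem P hψ hφ hψ' hφ')
        (Q'.comp_sub_id_mem Q hτ hσ hτ' hσ') hf) x)
    (LinearMap.ext fun x => (conjOp hψ hσ).mapTot_mapTot_of_sub_mem _ (fun i f hf =>
      comp_comp_sub_mem_homB (comp_mem_homZ_zero hφ hψ) (P.comp_sub_id_mem P' hφ hψ hφ' hψ')
        (Q.comp_sub_id_mem Q' hσ hτ hσ' hτ') hf) x)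
  exact ⟨e, fun i x => ((conjOp hψ hσ).mapTot_mem_homHGr_iff e.injective).symm⟩

/-- The graded algebra `Ext(M,M)` does not depend on the resolution. -/
theorem exists_ext_algEquiv {M : DGModule A} (P P' : KProjRes M) :
    ∃ e : Ext P P ≃ₐ[k] Ext P' P', ∀ i x, x ∈ extGr P P i ↔ e x ∈ extGr P' P' i := by
  obtain ⟨φ, hφ, hφ'⟩ := P.exists_hom P'
  obtain ⟨ψ, hψ, hψ'⟩ := P'.exists_hom P
  have h1 := P.comp_sub_id_mem P' hφ hψ hφ' hψ'
  have h2 := P'.comp_sub_id_mem P hψ hφ hψ' hφ'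
  let F : Ext P P →ₐ[k] Ext P' P' := (conjOp hψ hφ).algHom h2 (fun i j f hf g hg => by
    simp only [conjOp_apply]
    -- Conjugation is multiplicative only up to homotopy: the defect contains the factor `ψ ∘ φ -
    -- id`, a coboundary, between cocycles.
    have e : φ ∘ₗ (g ∘ₗ f) ∘ₗ ψ - (φ ∘ₗ g ∘ₗ ψ) ∘ₗ φ ∘ₗ f ∘ₗ ψ =
        -(φ ∘ₗ g ∘ₗ (ψ ∘ₗ φ - LinearMap.id) ∘ₗ f ∘ₗ ψ) := by
      simp only [LinearMap.sub_comp, LinearMap.comp_sub, LinearMap.id_comp, LinearMap.comp_assoc]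
      abel
    have h3 := comp_mem_homB_right (comp_mem_homB_left (comp_mem_homZ hψ hf) h1)
      (comp_mem_homZ hg hφ)
    rw [zero_add, add_zero, add_zero] at h3
    rw [e]
    exact Submodule.neg_mem _ h3)
  have hF : ∀ x, (conjOp hφ hψ).mapTot (F x) = x :=
    (conjOp hψ hφ).mapTot_mapTot_of_sub_mem _ (fun i f hf =>
      comp_comp_sub_mem_homB (comp_mem_homZ_zero hφ hψ) h1 h1 hf)
  have hF' : ∀ x, F ((conjOp hφ hψ).mapTot x) = x :=
    (conjOp hφ hψ).mapTot_mapTot_of_sub_mem _ (fun i f hf =>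
      comp_comp_sub_mem_homB (comp_mem_homZ_zero hψ hφ) h2 h2 hf)
  exact ⟨AlgEquiv.ofBijective F ⟨Function.LeftInverse.injective hF,
    Function.RightInverse.surjective hF'⟩, fun i x =>
      ((conjOp hψ hφ).mapTot_mem_homHGr_iff (Function.LeftInverse.injective hF)).symm⟩

end Resolutions

/-! ### Change of presentation in Sweedler sums -/

section Sweedler
variable {k : Type u} [Field k] {H : Type u} [Ring H] [HopfAlgebra k H]
  {X : Type*} [AddCommGroup X] [Module k X]

theorem sum_repr_eq_lift (φ : H →ₗ[k] H →ₗ[k] X) (h : H) :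
    ∑ i ∈ (ℛ k h).index, φ ((ℛ k h).left i) ((ℛ k h).right i) =
      TensorProduct.lift φ (comul h) := by
  conv_rhs => rw [← (ℛ k h).eq]
  rw [map_sum]
  rfl

/-- The chosen presentation of `Δ(h g)` need not be the product of those of `h` and `g`. Both sides
evaluate the same bilinear map on `Δ(h) Δ(g)`, so the choice is irrelevant. -/
theorem sum_repr_mul (φ : H →ₗ[k] H →ₗ[k] X) (h g : H) :
    ∑ i ∈ (ℛ k (h * g)).index, φ ((ℛ k (h * g)).left i) ((ℛ k (h * g)).right i) =
      ∑ i ∈ (ℛ k h).index, ∑ j ∈ (ℛ k g).index,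
        φ ((ℛ k h).left i * (ℛ k g).left j) ((ℛ k h).right i * (ℛ k g).right j) := by
  rw [sum_repr_eq_lift, Bialgebra.comul_mul]
  conv_lhs => rw [← (ℛ k h).eq, ← (ℛ k g).eq]
  simp only [Finset.sum_mul_sum, Algebra.TensorProduct.tmul_mul_tmul, map_sum,
    TensorProduct.lift.tmul]

theorem sum_repr_one (φ : H →ₗ[k] H →ₗ[k] X) :
    ∑ i ∈ (ℛ k (1 : H)).index, φ ((ℛ k (1 : H)).left i) ((ℛ k (1 : H)).right i) = φ 1 1 := by
  rw [sum_repr_eq_lift, Bialgebra.comul_one]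
  rfl

end Sweedler

/-! ### `A # H`-linearity as `A`-linearity together with `H`-linearity -/

section SmashModules
variable {k : Type u} [Field k] {H : Type u} [Ring H] [HopfAlgebra k H]
  {A : DGAlgebra k} [Module H A] [IsScalarTower k H A] [IsDGModuleAlgebra H A]

theorem mkDG_eq (a : A) (h : H) : mkDG a h = inlDG H A a * inrDG H A h :=
  (smashInl_mul_smashInr a h).symm

theorem smashDG_gr_induction {i : ℤ} {p : smashDG H A → Prop} (h0 : p 0)
    (hadd : ∀ x y, p x → p y → p (x + y)) (hmk : ∀ a ∈ A.gr i, ∀ h : H, p (mkDG a h))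
    (x : smashDG H A) (hx : x ∈ (smashDG H A).gr i) : p x := by
  -- The predicate `p` is not assumed stable under scalars, so the induction runs over all multiples
  -- `c • x` at once. On generators the scalar is absorbed into `a`.
  have key : ∀ x ∈ smashGr H A.gr i, ∀ c : k, p (c • x : Smash k H A) := by
    intro x hx
    induction hx using Submodule.span_induction with
    | zero => intro c; rw [smul_zero]; exact h0
    | add x y _ _ hx hy => intro c; rw [smul_add]; exact hadd _ _ (hx c) (hy c)
    | smul c x _ hx => intro c'; rw [smul_smul]; exact hx _
    | mem x hx =>
      intro c
      obtain ⟨a, ha, h, rfl⟩ := hx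
      exact hmk (c • a) (Submodule.smul_mem _ c ha) h
  have h1 : ((1 : k) • x : smashDG H A) = x := one_smul k x
  exact h1 ▸ key x hx 1

/-- The algebra `A # H` is generated by `A` and `H`, and `H` sits in degree zero, so no sign appears
when a map of any degree passes an element of `H`. -/
theorem mem_homDeg_of_res {M N : DGModule (smashDG H A)} {i : ℤ} {f : M →ₗ[k] N}
    (hf : f ∈ homDeg M.res N.res i)
    (hH : ∀ (h : H) (m : M), f (actH M h m) = actH N h (f m)) : f ∈ homDeg M N i := by
  refine ⟨hf.1, fun j => smashDG_gr_induction (fun m => by simp)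
    (fun x y hx hy m => by rw [add_smul, map_add, hx, hy, add_smul, smul_add])
    fun a ha h m => ?_⟩
  · rw [mkDG_eq, mul_smul, mul_smul]
    exact (hf.2 j a ha (inrDG H A h • m)).trans
      (congrArg (fun y => (i * j).negOnePow • inlDG H A a • y) (hH h m))

theorem res_mem_homDeg {M N : DGModule (smashDG H A)} {i : ℤ} {f : M →ₗ[k] N}
    (hf : f ∈ homDeg M N i) : f ∈ homDeg M.res N.res i :=
  ⟨hf.1, fun j _ ha m => hf.2 j _ (inlDG_mem ha) m⟩

theorem map_actH_of_mem_homDeg {M N : DGModule (smashDG H A)} {i : ℤ} {f : M →ₗ[k] N}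
    (hf : f ∈ homDeg M N i) (h : H) (m : M) : f (actH M h m) = actH N h (f m) := by
  have := hf.2 0 _ (inrDG_mem h) m
  rwa [mul_zero, Int.negOnePow_zero, one_smul] at this

end SmashModules

/-! ### Coinduction, and K-projectivity of restrictions -/

section Coinduction
variable {k : Type u} [Field k] {H : Type u} [Ring H] [HopfAlgebra k H]
  {A : DGAlgebra k} (X : DGModule A)

variable (H) in
/-- The action of `H` on `Hom(H, X)`: `(g φ)(h) = φ(h g)`. -/
noncomputable def coindH : H →ₐ[k] Module.End k (H →ₗ[k] X) :=
  AlgHom.ofLinearMap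
    (LinearMap.mk₂ k (fun g φ => φ ∘ₗ LinearMap.mulRight k g)
      (fun g g' φ => LinearMap.ext fun h => by simp [mul_add])
      (fun c g φ => LinearMap.ext fun h => by simp)
      (fun g φ ψ => LinearMap.ext fun h => by simp)
      (fun c g φ => LinearMap.ext fun h => by simp))
    (LinearMap.ext fun φ => LinearMap.ext fun h => by simp)
    (fun g g' => LinearMap.ext fun φ => LinearMap.ext fun h => by simp [mul_assoc])

theorem coindH_apply (g : H) (φ : H →ₗ[k] X) (h : H) : coindH H X g φ h = φ (h * g) := rfl

variable [Module H A] [IsScalarTower k H A]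

/-- The bilinear map `(x, y) ↦ (x a) φ(y)`. -/
noncomputable def coindBilin (a : A) (φ : H →ₗ[k] X) : H →ₗ[k] H →ₗ[k] X :=
  (Algebra.lsmul k k X).toLinearMap.compl₁₂ ((LinearMap.toSpanSingleton H A a).restrictScalars k) φ

theorem coindBilin_apply (a : A) (φ : H →ₗ[k] X) (x y : H) :
    coindBilin X a φ x y = (x • a) • φ y := rfl

/-- The map `h ↦ (h₍₁₎ a) φ(h₍₂₎)`. -/
noncomputable def coindFun (a : A) (φ : H →ₗ[k] X) : H →ₗ[k] X :=
  TensorProduct.lift (coindBilin X a φ) ∘ₗ comul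

theorem coindFun_apply (a : A) (φ : H →ₗ[k] X) (h : H) : coindFun X a φ h =
    ∑ i ∈ (ℛ k h).index, ((ℛ k h).left i • a) • φ ((ℛ k h).right i) :=
  (sum_repr_eq_lift (coindBilin X a φ) h).symm

theorem coindFun_one_right (a : A) (φ : H →ₗ[k] X) : coindFun X a φ 1 = a • φ 1 := by
  rw [coindFun_apply]
  refine (sum_repr_one (coindBilin X a φ)).trans ?_
  rw [coindBilin_apply, one_smul]

variable [IsDGModuleAlgebra H A]

variable (H) in
/-- The action of `A` on `Hom(H, X)`: `(a φ)(h) = (h₍₁₎ a) φ(h₍₂₎)`. -/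
noncomputable def coindA : A →ₐ[k] Module.End k (H →ₗ[k] X) :=
  AlgHom.ofLinearMap
    (LinearMap.mk₂ k (coindFun X)
      (fun a b φ => LinearMap.ext fun h => by
        simp only [coindFun_apply, LinearMap.add_apply, smul_add, add_smul,
          Finset.sum_add_distrib])
      (fun c a φ => LinearMap.ext fun h => by
        simp only [coindFun_apply, LinearMap.smul_apply, smul_comm _ c a, smul_assoc,
          Finset.smul_sum])
      (fun a φ ψ => LinearMap.ext fun h => by
        simp only [coindFun_apply, LinearMap.add_apply, smul_add, Finset.sum_add_distrib])
      (fun c a φ => LinearMap.ext fun h => by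
        simp only [coindFun_apply, LinearMap.smul_apply, smul_comm _ c, Finset.smul_sum]))
    (LinearMap.ext fun φ => LinearMap.ext fun h => by
      change coindFun X 1 φ h = φ h
      simp only [coindFun_apply, IsModuleAlgebra.smul_one (k := k), algebraMap_smul]
      exact sum_counit_left φ h)
    (fun a b => LinearMap.ext fun φ => LinearMap.ext fun h => by
      change coindFun X (a * b) φ h = coindFun X a (coindFun X b φ) h
      simp only [coindFun_apply, IsModuleAlgebra.smul_mul (k := k), Finset.sum_smul,
        Finset.smul_sum, mul_smul]
      exact coassoc3 (fun x y z => (x • a) • (y • b) • φ z)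
        (fun y z => ⟨fun x x' => by simp [add_smul], fun c x => by simp⟩)
        (fun y z => ⟨fun x x' => by simp [add_smul], fun c x => by
          simp only [smul_assoc]
          rw [smul_comm]⟩)
        (fun y z => ⟨fun x x' => by simp, fun c x => by
          simp only [map_smul]
          rw [smul_comm (_ : A) c, smul_comm (_ : A) c]⟩) h)

theorem coindA_apply (a : A) (φ : H →ₗ[k] X) : coindA H X a φ = coindFun X a φ := rfl

/-- Multiplicativity of `Δ` is the whole content: `(g(aφ))(h) = (aφ)(h g) = (h₍₁₎ g₍₁₎ a) φ(h₍₂₎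
g₍₂₎)`. -/
theorem covariant_coind : Covariant (coindA H X) (coindH H X) := by
  intro g a
  refine LinearMap.ext fun φ => LinearMap.ext fun h => ?_
  simp only [LinearMap.sum_apply, Module.End.mul_apply, coindH_apply, coindA_apply]
  rw [coindFun_apply]
  refine (sum_repr_mul (coindBilin X a φ) h g).trans ?_
  rw [Finset.sum_comm]
  refine Finset.sum_congr rfl fun j _ => ?_
  rw [coindFun_apply]
  refine Finset.sum_congr rfl fun i _ => ?_
  rw [coindBilin_apply, coindH_apply, mul_smul]

variable (H) in
/-- The action of `A # H` on `Hom(H, X)`. -/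
noncomputable def coindAct : smashDG H A →ₐ[k] Module.End k (H →ₗ[k] X) :=
  smashLift (covariant_coind X)

theorem coindAct_mk (a : A) (g : H) (φ : H →ₗ[k] X) :
    coindAct H X (mkDG a g) φ = coindFun X a (coindH H X g φ) := rfl

section
variable {X} {P : DGModule (smashDG H A)}

/-- The map `p ↦ (h ↦ f(h p))`. -/
noncomputable def coindHom (f : P →ₗ[k] X) : P →ₗ[k] (H →ₗ[k] X) :=
  LinearMap.mk₂ k (fun p h => f (actH P h p)) (fun p q h => by simp) (fun c p h => by simp)
    (fun p h g => by simp) (fun c p h => by simp)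

theorem coindHom_apply (f : P →ₗ[k] X) (p : P) (h : H) : coindHom f p h = f (actH P h p) := rfl

/-- Moving `h` past `a` in `P` gives `f(h a p) = f((h₍₁₎ a) h₍₂₎ p)`. The hypothesis is therefore
needed for every translate `g • a`; these have the same degree as `a`, hence the same sign. -/
theorem coindHom_actA (f : P →ₗ[k] X) (s : ℤˣ) (a : A)
    (hf : ∀ (g : H) (p : P), f (actA P (g • a) p) = s • (g • a) • f p) (p : P) :
    coindHom f (actA P a p) = s • coindFun X a (coindHom f p) := by
  refine LinearMap.ext fun h => ?_
  rw [LinearMap.smul_apply, coindHom_apply, coindFun_apply, ← Module.End.mul_apply,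
    covariant_act P h a, LinearMap.sum_apply, Finset.smul_sum, map_sum]
  exact Finset.sum_congr rfl fun l _ => hf _ _

theorem coindHom_actH (f : P →ₗ[k] X) (g : H) (p : P) :
    coindHom f (actH P g p) = coindH H X g (coindHom f p) := by
  refine LinearMap.ext fun h => ?_
  rw [coindH_apply, coindHom_apply, coindHom_apply, map_mul, Module.End.mul_apply]

theorem coindAct_inl (a : A) (φ : H →ₗ[k] X) :
    coindAct H X (inlDG H A a) φ = coindFun X a φ := by
  change coindFun X a (coindH H X 1 φ) = _
  rw [map_one, Module.End.one_apply]

theorem coindAct_inr (g : H) (φ : H →ₗ[k] X) :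
    coindAct H X (inrDG H A g) φ = coindH H X g φ := by
  change coindA H X 1 (coindH H X g φ) = _
  rw [map_one, Module.End.one_apply]

end

variable [FiniteDimensional k H]

variable (H) in
/-- The coinduced dg `A # H`-module `Hom(H, X)` of a dg `A`-module `X`. -/
noncomputable def coind : DGModule (smashDG H A) where
  carrier := H →ₗ[k] X
  addCommGroup := inferInstance
  moduleBase := inferInstance
  module := moduleOfHom (coindAct H X)
  isScalarTower := isScalarTower_moduleOfHom (coindAct H X)
  gr := fun n => ⨅ h : H, (X.gr n).comap (LinearMap.applyₗ h)
  isInternal := isInternal_hom X.isInternal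
  smul_mem := fun {i j x φ} hx hφ => by
    rw [Submodule.mem_iInf] at hφ ⊢
    intro h
    refine smashDG_gr_induction (p := fun x => coindAct H X x φ h ∈ X.gr (i + j)) ?_ ?_ ?_ x hx
    · rw [map_zero]; exact Submodule.zero_mem _
    · intro x y hx hy
      rw [map_add]; exact Submodule.add_mem _ hx hy
    · intro a ha g
      rw [coindAct_mk, coindFun_apply]
      exact Submodule.sum_mem _ fun l _ => X.smul_mem (IsDGModuleAlgebra.smul_mem _ ha) (hφ _)
  d := LinearMap.compRight k X.d
  d_mem := fun {i φ} hφ => by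
    rw [Submodule.mem_iInf] at hφ ⊢
    exact fun h => X.d_mem (hφ h)
  d_d := fun φ => LinearMap.ext fun h => X.d_d (φ h)
  d_smul := fun {i x} φ hx => by
    refine LinearMap.ext fun h => ?_
    refine smashDG_gr_induction (p := fun x => X.d (coindAct H X x φ h) =
      coindAct H X ((smashDG H A).d x) φ h + i.negOnePow • coindAct H X x (X.d ∘ₗ φ) h)
      ?_ ?_ ?_ x hx
    · simp only [map_zero, LinearMap.zero_apply, smul_zero, add_zero]
    · intro x y hx hy
      simp only [map_add, LinearMap.add_apply, hx, hy, smul_add]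
      abel
    · intro a ha g
      change _ = coindAct H X (mkDG (A.d a) g) φ h + _
      simp only [coindAct_mk, coindFun_apply, map_sum, Finset.smul_sum,
        ← Finset.sum_add_distrib, X.d_smul _ (IsDGModuleAlgebra.smul_mem _ ha),
        IsDGModuleAlgebra.d_smul]
      rfl

theorem mem_coind_gr {n : ℤ} {φ : H →ₗ[k] X} : φ ∈ (coind H X).gr n ↔ ∀ h, φ h ∈ X.gr n :=
  Submodule.mem_iInf _

variable (H) in
theorem coind_isAcyclic (hX : X.IsAcyclic) : (coind H X).IsAcyclic := by
  suffices key : ∀ φ : H →ₗ[k] X, X.d ∘ₗ φ = 0 → ∃ ψ : H →ₗ[k] X, X.d ∘ₗ ψ = φ from key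
  intro φ hφ
  -- The preimages `σ h` need not depend linearly on `h`. Only their values on a basis are kept, and
  -- these are extended linearly.
  choose σ hσ using fun h => hX (φ h) (LinearMap.congr_fun hφ h)
  let b := Module.finBasis k H
  exact ⟨b.constr k fun j => σ (b j), b.ext fun j => by
    rw [LinearMap.comp_apply, b.constr_basis, hσ]⟩

variable {X} {P : DGModule (smashDG H A)}

/-- The map to the coinduced module adjoint to `f`. -/
noncomputable def coindMk (f : P.res →ₗ[k] X) : P →ₗ[k] coind H X :=
  coindHom (P := P) f

theorem coindMk_mem_homDeg {i : ℤ} {f : P.res →ₗ[k] X} (hf : f ∈ homDeg P.res X i) :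
    coindMk f ∈ homDeg P (coind H X) i :=
  mem_homDeg_of_res ⟨fun n _ hp => (mem_coind_gr X).2 fun h => hf.1 n _ (actH_mem P h hp),
    fun j a ha p => (coindHom_actA (P := P) f _ a
      (fun g => hf.2 j _ (IsDGModuleAlgebra.smul_mem g ha)) p).trans
      (congrArg ((i * j).negOnePow • ·) (coindAct_inl a (coindHom (P := P) f p)).symm)⟩
    fun g p => (coindHom_actH (P := P) f g p).trans (coindAct_inr g (coindHom (P := P) f p)).symm

theorem homD_coindMk (i : ℤ) (f : P.res →ₗ[k] X) :
    homD P (coind H X) i (coindMk f) = coindMk (homD P.res X i f) := by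
  refine LinearMap.ext fun p => LinearMap.ext fun h => ?_
  exact congrArg (fun q => X.d ((f : P →ₗ[k] X) (actH P h p)) -
    i.negOnePow • (f : P →ₗ[k] X) q) (d_actH P h p).symm

/-- Evaluation of a map to the coinduced module at `1`. -/
noncomputable def coindEval (G : P →ₗ[k] coind H X) : P.res →ₗ[k] X :=
  LinearMap.applyₗ (1 : H) ∘ₗ (G : P →ₗ[k] H →ₗ[k] X)

theorem coindEval_mem_homDeg {i : ℤ} {G : P →ₗ[k] coind H X}
    (hG : G ∈ homDeg P (coind H X) i) : coindEval G ∈ homDeg P.res X i := by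
  refine ⟨fun n p hp => (mem_coind_gr X).1 (hG.1 n p hp) 1, fun j a ha p => ?_⟩
  have h1 : (G : P →ₗ[k] H →ₗ[k] X) (actA P a p) =
      (i * j).negOnePow • coindFun X a ((G : P →ₗ[k] H →ₗ[k] X) p) :=
    (hG.2 j _ (inlDG_mem ha) p).trans
      (congrArg ((i * j).negOnePow • ·) (coindAct_inl a ((G : P →ₗ[k] H →ₗ[k] X) p)))
  exact (LinearMap.congr_fun h1 1).trans
    (congrArg ((i * j).negOnePow • ·) (coindFun_one_right X a _))

theorem homD_coindEval (i : ℤ) (G : P →ₗ[k] coind H X) :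
    homD P.res X i (coindEval G) = coindEval (homD P (coind H X) i G) := rfl

theorem coindEval_coindMk (f : P.res →ₗ[k] X) : coindEval (coindMk (P := P) f) = f :=
  LinearMap.ext fun p => congrArg (fun e : Module.End k P => f (e p)) (map_one (actH P))

/-- A cocycle `P → X` over `A` corresponds to a cocycle `P → Hom(H, X)` over `A # H`. The target is
acyclic, so the latter is a coboundary, and evaluation at `1` carries a bounding map back to `X`. -/
theorem DGModule.IsKProjective.res (hP : P.IsKProjective) : P.res.IsKProjective := by
  intro X hX i f hf
  have hd : homD P.res X i f = 0 := hf.2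
  have hz : coindMk f ∈ homZ P (coind H X) i := by
    refine ⟨coindMk_mem_homDeg hf.1, ?_⟩
    change homD P (coind H X) i (coindMk f) = 0
    rw [homD_coindMk, hd]
    exact LinearMap.ext fun p => rfl
  obtain ⟨G, hG, hGd⟩ := hP _ (coind_isAcyclic H X hX) i hz
  refine ⟨coindEval G, coindEval_mem_homDeg hG, ?_⟩
  rw [homD_coindEval, hGd, coindEval_coindMk]

end Coinduction

/-! ### Invariants and the averaging operator of an integral: parts (i) and (ii) -/

section Invariants
variable {k : Type u} [Field k] {H : Type u} [Ring H] [HopfAlgebra k H]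
  [FiniteDimensional k H] [IsSemisimpleRing H]
  {A : DGAlgebra k} [Module H A] [IsScalarTower k H A] [IsDGModuleAlgebra H A]
  {M N : DGModule (smashDG H A)}

theorem homAct_apply_actH (h : H) (f : M →ₗ[k] N) (m : M) :
    homAct M N h f m = ∑ i ∈ (ℛ k h).index,
      actH N ((ℛ k h).right i) (f (actH M (antipodeInv k H ((ℛ k h).left i)) m)) :=
  homAct_apply M N h f m

/-- Expanding gives `h₍₃₎ f(S⁻¹(h₍₂₎) h₍₁₎ m)`, and `S⁻¹(h₍₂₎) h₍₁₎` collapses to the counit. The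
identity turns invariance into `H`-linearity and also makes the extension of a map to `M ⊗ H` linear
over `H`. -/
theorem sum_homAct_actH (f : M →ₗ[k] N) (h : H) (m : M) :
    ∑ i ∈ (ℛ k h).index, homAct M N ((ℛ k h).right i) f (actH M ((ℛ k h).left i) m) =
      actH N h (f m) := by
  simp only [homAct_apply_actH]
  rw [← coassoc3 (fun x y z => actH N z (f (actH M (antipodeInv k H y) (actH M x m))))
    (fun y z => ⟨fun x x' => by simp, fun c x => by simp⟩)
    (fun y z => ⟨fun x x' => by simp, fun c x => by simp⟩)
    (fun y z => ⟨fun x x' => by simp, fun c x => by simp⟩) h]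
  simp only [← Module.End.mul_apply, ← map_mul, ← map_sum, ← LinearMap.sum_apply,
    sum_antipodeInv_right_mul_left]
  simp only [AlgHom.commutes, Module.algebraMap_end_apply, map_smul]
  exact sum_counit_left ((actH N).toLinearMap.flip (f m)) h

/-- For `H`-linear `f` the action pulls out as `h₍₂₎ S⁻¹(h₍₁₎) f(m) = ε(h) f(m)`. -/
theorem homAct_of_mem_homDeg {i : ℤ} {f : M →ₗ[k] N} (hf : f ∈ homDeg M N i) (h : H) :
    homAct M N h f = counit (R := k) h • f := by
  refine LinearMap.ext fun m => ?_
  rw [homAct_apply_actH]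
  simp only [map_actH_of_mem_homDeg hf, ← Module.End.mul_apply, ← map_mul]
  rw [← LinearMap.sum_apply, ← map_sum, sum_right_mul_antipodeInv_left, AlgHom.commutes]
  rfl

theorem mem_homDeg_of_homAct {i : ℤ} {f : M →ₗ[k] N} (hf : f ∈ homDeg M.res N.res i)
    (hinv : ∀ h : H, homAct M N h f = counit (R := k) h • f) : f ∈ homDeg M N i := by
  refine mem_homDeg_of_res hf fun h m => ?_
  rw [← sum_homAct_actH]
  simp only [hinv, LinearMap.smul_apply]
  exact (sum_counit_right (f ∘ₗ (actH M).toLinearMap.flip m) h).symm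

variable (M N) in
/-- The inclusion of `Hom_{A # H}(M,N)` in `Hom_A(M,N)`. -/
noncomputable def resOp : HomOp M N M.res N.res where
  toLin := (LinearMap.id : (M →ₗ[k] N) →ₗ[k] (M →ₗ[k] N))
  map_mem := res_mem_homDeg
  map_homD := fun _ _ => rfl

theorem homAct_integral {t : H} (ht : ∀ h : H, h * t = counit (R := k) h • t) (f : M →ₗ[k] N)
    (h : H) : homAct M N h (homAct M N t f) = counit (R := k) h • homAct M N t f := by
  rw [← Module.End.mul_apply, ← map_mul, ht, map_smul, LinearMap.smul_apply]

variable (M N) in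
/-- The projection of `Hom_A(M,N)` to `Hom_{A # H}(M,N)` given by the action of an integral. -/
noncomputable def reynoldsOp {t : H} (ht : ∀ h : H, h * t = counit (R := k) h • t) :
    HomOp M.res N.res M N where
  toLin := homAct M N t
  map_mem := fun {_ f} hf => mem_homDeg_of_homAct (homActRes_mem_homDeg M N t hf) fun h =>
    homAct_integral ht f h
  map_homD := fun i f => homD_homAct M N t i f

theorem reynoldsOp_resOp {t : H} (ht : ∀ h : H, h * t = counit (R := k) h • t)
    (h1 : counit (R := k) t = 1) (x : HomHTot M N) :
    (reynoldsOp M N ht).mapTot ((resOp M N).mapTot x) = x :=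
  (resOp M N).mapTot_mapTot_of_sub_mem _ (fun i f hf => by
    have h2 : homAct M N t f - f = 0 := by
      rw [homAct_of_mem_homDeg hf.1, h1, one_smul, sub_self]
    exact h2 ▸ Submodule.zero_mem _) x

/-- The inclusion is the identity on underlying maps, so this composite is the action of `t` already
on cochains. When `ε(t) = 1` it fixes invariant classes, which gives surjectivity onto the
invariants. -/
theorem resOp_reynoldsOp {t : H} (ht : ∀ h : H, h * t = counit (R := k) h • t)
    (x : HomHTot M.res N.res) :
    (resOp M N).mapTot ((reynoldsOp M N ht).mapTot x) = t • x := by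
  refine DFinsupp.ext fun i => ?_
  change (resOp M N).mapH i ((reynoldsOp M N ht).mapH i (x i)) = t • x i
  obtain ⟨f, hf⟩ := HomH.mk_surjective M.res N.res i (x i)
  rw [← hf]
  rfl

theorem resOp_mapTot_injective : Function.Injective (resOp M N).mapTot := by
  obtain ⟨t, h1, ht⟩ := exists_integral (k := k) (H := H)
  exact Function.LeftInverse.injective (reynoldsOp_resOp ht h1)

theorem resOp_mapTot_smul (x : HomHTot M N) (h : H) :
    h • (resOp M N).mapTot x = counit (R := k) h • (resOp M N).mapTot x := by
  refine DFinsupp.ext fun i => ?_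
  change h • (resOp M N).mapH i (x i) = counit (R := k) h • (resOp M N).mapH i (x i)
  obtain ⟨f, hf⟩ := HomH.mk_surjective M N i (x i)
  rw [← hf, HomOp.mapH_mk, smul_mk, ← map_smul]
  congr 1
  exact Subtype.ext (homAct_of_mem_homDeg f.2.1 h)

theorem exists_resOp_eq (x : HomHTot M.res N.res)
    (hx : ∀ h : H, h • x = counit (R := k) h • x) : ∃ y, (resOp M N).mapTot y = x := by
  obtain ⟨t, h1, ht⟩ := exists_integral (k := k) (H := H)
  exact ⟨_, by rw [resOp_reynoldsOp ht, hx, h1, one_smul]⟩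

variable (M N) in
/-- `H^*(Hom_{A # H}(M,N)) ≅ H^*(Hom_A(M,N))^H`. -/
noncomputable def resEquiv : HomHTot M N ≃ₗ[k] invariants k H (HomHTot M.res N.res) :=
  LinearEquiv.ofBijective ((resOp M N).mapTot.codRestrict _ resOp_mapTot_smul)
    ⟨fun _ _ h => resOp_mapTot_injective (congrArg Subtype.val h), fun x =>
      (exists_resOp_eq x.1 x.2).imp fun _ hy => Subtype.ext hy⟩

variable (M) in
/-- The algebra map `H^*(Hom_{A # H}(M,M)) → H^*(Hom_A(M,M))`. -/
noncomputable def resAlgHom : HomHTot M M →ₐ[k] HomHTot M.res M.res :=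
  (resOp M M).algHom
    -- The inclusion respects identities and compositions strictly, so the coboundaries asked for
    -- are zero.
    ((sub_self (LinearMap.id : M.res →ₗ[k] M.res)).symm ▸ Submodule.zero_mem _)
    fun _ _ f _ g _ => (sub_self (g ∘ₗ f : M.res →ₗ[k] M.res)).symm ▸ Submodule.zero_mem _

variable (M) in
/-- `H^*(Hom_{A # H}(M,M)) ≅ H^*(Hom_A(M,M))^H` as algebras. -/
noncomputable def resAlgEquiv :
    HomHTot M M ≃ₐ[k] invariantSubalgebra k H (HomHTot M.res M.res) :=
  AlgEquiv.ofBijective ((resAlgHom M).codRestrict _ resOp_mapTot_smul)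
    ⟨fun _ _ h => resOp_mapTot_injective (congrArg Subtype.val h), fun x =>
      (exists_resOp_eq x.1 x.2).imp fun _ hy => Subtype.ext hy⟩

/-- The resolutions on the two sides may differ, so Ext over `A # H` is first moved to the pair
`P'`, `Q'`, where both Hom complexes share their underlying modules. -/
theorem exists_ext_equiv_invariants {M N : DGModule (smashDG H A)} (P P' : KProjRes M)
    (Q Q' : KProjRes N) : ∃ e : Ext P Q ≃ₗ[k] invariants k H (ExtRes P' Q'),
      ∀ (i : ℤ) (x : Ext P Q),
        x ∈ extGr P Q i ↔ (e x : ExtRes P' Q') ∈ extResGr P' Q' i := by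
  obtain ⟨e, he⟩ := exists_ext_equiv P P' Q Q'
  exact ⟨e.trans (resEquiv P'.P Q'.P), fun i x => (he i x).trans
    ((resOp P'.P Q'.P).mapTot_mem_homHGr_iff resOp_mapTot_injective).symm⟩

theorem exists_ext_algEquiv_invariants {M : DGModule (smashDG H A)} (P P' : KProjRes M) :
    ∃ e : Ext P P ≃ₐ[k] invariantSubalgebra k H (ExtRes P' P'),
      ∀ (i : ℤ) (x : Ext P P),
        x ∈ extGr P P i ↔ (e x : ExtRes P' P') ∈ extResGr P' P' i := by
  obtain ⟨e, he⟩ := exists_ext_algEquiv P P'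
  exact ⟨e.trans (resAlgEquiv P'.P), fun i x => (he i x).trans
    ((resOp P'.P P'.P).mapTot_mem_homHGr_iff resOp_mapTot_injective).symm⟩

end Invariants

/-! ### The module `M ⊗ H`: maps out of it, contractions and right multiplications -/

section TensorModule
variable {k : Type u} [Field k] {H : Type u} [Ring H] [HopfAlgebra k H]
  {A : DGAlgebra k} [Module H A] [IsScalarTower k H A] [IsDGModuleAlgebra H A]
  {M N : DGModule (smashDG H A)}

theorem actH_tensorH (h : H) :
    (actH M.tensorH h : Module.End k (M ⊗[k] H)) = tensorDiag (actH M) h := by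
  change tensorLeft H (actA M) 1 * tensorDiag (actH M) h = _
  rw [map_one, one_mul]

theorem actA_tensorH (a : A) :
    (actA M.tensorH a : Module.End k (M ⊗[k] H)) = tensorLeft H (actA M) a := by
  change tensorLeft H (actA M) a * tensorDiag (actH M) 1 = _
  rw [map_one, mul_one]

theorem mem_homDeg_tensorH {F : M ⊗[k] H →ₗ[k] N} {i : ℤ}
    (h1 : ∀ n, ∀ m ∈ M.gr n, ∀ w : H, F (m ⊗ₜ w) ∈ N.gr (n + i))
    (h2 : ∀ j, ∀ a ∈ A.gr j, ∀ (m : M) (w : H),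
      F (actA M a m ⊗ₜ w) = (i * j).negOnePow • actA N a (F (m ⊗ₜ w)))
    (h3 : ∀ (h : H) (m : M) (w : H),
      F (tensorDiag (actH M) h (m ⊗ₜ w)) = actH N h (F (m ⊗ₜ w))) :
    (F : M.tensorH →ₗ[k] N) ∈ homDeg M.tensorH N i := by
  have k1 : ∀ n, ∀ x ∈ tensorGr H M.gr n, F x ∈ N.gr (n + i) := by
    intro n x hx
    induction hx using Submodule.span_induction with
    | zero => rw [map_zero]; exact Submodule.zero_mem _
    | add x y _ _ hx hy => rw [map_add]; exact Submodule.add_mem _ hx hy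
    | smul c x _ hx => rw [map_smul]; exact Submodule.smul_mem _ _ hx
    | mem x hx =>
      obtain ⟨m, hm, w, rfl⟩ := hx
      exact h1 n m hm w
  have k2 : ∀ j, ∀ a ∈ A.gr j, ∀ x : M ⊗[k] H,
      F (tensorLeft H (actA M) a x) = (i * j).negOnePow • actA N a (F x) := by
    intro j a ha x
    induction x with
    | zero => simp
    | add x y hx hy => simp only [map_add, hx, hy, smul_add]
    | tmul m w => exact h2 j a ha m w
  have k3 : ∀ (h : H) (x : M ⊗[k] H), F (tensorDiag (actH M) h x) = actH N h (F x) := by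
    intro h x
    induction x with
    | zero => simp
    | add x y hx hy => simp only [map_add, hx, hy]
    | tmul m w => exact h3 h m w
  exact mem_homDeg_of_res ⟨k1, fun j a ha x =>
    (congrArg (fun e : Module.End k (M ⊗[k] H) => F (e x)) (actA_tensorH a)).trans (k2 j a ha x)⟩ fun h x =>
      (congrArg (fun e : Module.End k (M ⊗[k] H) => F (e x)) (actH_tensorH h)).trans (k3 h x)

variable (M) in
/-- The map `m ↦ m ⊗ 1`. -/
noncomputable def tmulOne : M →ₗ[k] M ⊗[k] H := (TensorProduct.mk k M H).flip 1

theorem tmulOne_apply (m : M) : tmulOne M m = m ⊗ₜ[k] (1 : H) := rfl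

theorem tmulOne_mem_homZ :
    (tmulOne M : M.res →ₗ[k] M.tensorH.res) ∈ homZ M.res M.tensorH.res 0 := by
  have h1 : ∀ n, ∀ m ∈ M.gr n, tmulOne M m ∈ tensorGr H M.gr n := fun n m hm =>
    Submodule.subset_span ⟨m, hm, 1, rfl⟩
  exact mem_homZ_zero h1
    (fun a m => congrArg (fun e : Module.End k (M ⊗[k] H) => e (tmulOne M m))
      (actA_tensorH a).symm) (fun m => rfl)

section
variable {V W : Type u} [AddCommGroup V] [Module k V] [AddCommGroup W] [Module k W]

variable (V) in
/-- Contraction of the second tensor factor with a functional. -/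
noncomputable def contract (ξ : H →ₗ[k] k) : V ⊗[k] H →ₗ[k] V :=
  (TensorProduct.rid k V).toLinearMap ∘ₗ ξ.lTensor V

theorem contract_tmul (ξ : H →ₗ[k] k) (v : V) (w : H) : contract V ξ (v ⊗ₜ w) = ξ w • v := by
  simp [contract]

theorem contract_rTensor (ξ : H →ₗ[k] k) (f : V →ₗ[k] W) (x : V ⊗[k] H) :
    contract W ξ (f.rTensor H x) = f (contract V ξ x) := by
  induction x with
  | zero => simp
  | add x y hx hy => simp only [map_add, hx, hy]
  | tmul v w => simp [contract_tmul]

theorem sum_contract_tmul {ι : Type*} [Fintype ι] (b : Module.Basis ι k H) (x : V ⊗[k] H) :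
    ∑ j, contract V (b.coord j) x ⊗ₜ[k] b j = x := by
  induction x with
  | zero => simp
  | add x y hx hy =>
    simp only [map_add, TensorProduct.add_tmul, Finset.sum_add_distrib, hx, hy]
  | tmul v w =>
    simp only [contract_tmul, TensorProduct.smul_tmul, ← TensorProduct.tmul_sum]
    simp [b.sum_repr]

end

/-- The algebra `A` acts on `M ⊗ H` through the first factor alone, so contracting the second factor
is `A`-linear; in general it is not `H`-linear. -/
theorem contract_mem_homZ (ξ : H →ₗ[k] k) :
    (contract M ξ : M.tensorH.res →ₗ[k] M.res) ∈ homZ M.tensorH.res M.res 0 := by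
  have h1 : ∀ n, ∀ x ∈ tensorGr H M.gr n, contract M ξ x ∈ M.gr n := by
    intro n x hx
    induction hx using Submodule.span_induction with
    | zero => rw [map_zero]; exact Submodule.zero_mem _
    | add x y _ _ hx hy => rw [map_add]; exact Submodule.add_mem _ hx hy
    | smul c x _ hx => rw [map_smul]; exact Submodule.smul_mem _ _ hx
    | mem x hx =>
      obtain ⟨m, hm, w, rfl⟩ := hx
      rw [contract_tmul]
      exact Submodule.smul_mem _ _ hm
  exact mem_homZ_zero h1 (fun a x => (congrArg (fun e : Module.End k (M ⊗[k] H) =>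
    contract M ξ (e x)) (actA_tensorH a)).trans (contract_rTensor ξ (actA M a) x))
    (fun x => (contract_rTensor ξ M.d x).symm)

theorem tensorAct_rTensor {π : M →ₗ[k] N} (hπ : IsQuasiIso π) (x : smashDG H A) (y : M ⊗[k] H) :
    π.rTensor H (tensorAct M x y) = tensorAct N x (π.rTensor H y) := by
  refine smash_induction (k := k) (H := H) (B := A) (p := fun x =>
    π.rTensor H (tensorAct M x y) = tensorAct N x (π.rTensor H y)) x ?_ ?_ ?_
  · have h1 : tensorAct M (0 : smashDG H A) = 0 := map_zero _
    have h2 : tensorAct N (0 : smashDG H A) = 0 := map_zero _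
    refine (congrArg (fun e => π.rTensor H (e y)) h1).trans
      (Eq.trans ?_ (congrArg (fun e => e (π.rTensor H y)) h2).symm)
    simp
  · intro a h
    change π.rTensor H (tensorAct M (mkDG a h) y) = tensorAct N (mkDG a h) (π.rTensor H y)
    induction y with
    | zero => simp
    | add y z hy hz => simp only [map_add, hy, hz]
    | tmul m w =>
      simp only [LinearMap.rTensor_tmul, tensorAct_mk, map_sum, hπ.map_smul]
  · intro x x' hx hx'
    have h1 : tensorAct M (x + x' : smashDG H A) = tensorAct M x + tensorAct M x' := map_add _ _ _
    have h2 : tensorAct N (x + x' : smashDG H A) = tensorAct N x + tensorAct N x' := map_add _ _ _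
    refine (congrArg (fun e => π.rTensor H (e y)) h1).trans
      (Eq.trans ?_ (congrArg (fun e => e (π.rTensor H y)) h2).symm)
    rw [LinearMap.add_apply, map_add, hx, hx', LinearMap.add_apply]

theorem rTensor_mem_tensorGr {V W : Type u} [AddCommGroup V] [Module k V] [AddCommGroup W]
    [Module k W] {g : ℤ → Submodule k V} {g' : ℤ → Submodule k W} {f : V →ₗ[k] W} {n : ℤ}
    (hf : ∀ v ∈ g n, f v ∈ g' n) {x : V ⊗[k] H} (hx : x ∈ tensorGr H g n) :
    f.rTensor H x ∈ tensorGr H g' n := by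
  induction hx using Submodule.span_induction with
  | zero => rw [map_zero]; exact Submodule.zero_mem _
  | add x y _ _ hx hy => rw [map_add]; exact Submodule.add_mem _ hx hy
  | smul c x _ hx => rw [map_smul]; exact Submodule.smul_mem _ _ hx
  | mem x hx =>
    obtain ⟨v, hv, w, rfl⟩ := hx
    exact Submodule.subset_span ⟨f v, hf v hv, w, rfl⟩

/-- As a complex, `M ⊗ H` is a finite direct sum of copies of `M` indexed by a basis of `H`. Both
conditions are checked coordinatewise through the contractions and reassembled with
`sum_contract_tmul`. -/
theorem IsQuasiIso.tensorH [FiniteDimensional k H] {π : M →ₗ[k] N} (hπ : IsQuasiIso π) :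
    IsQuasiIso (M := M.tensorH) (N := N.tensorH) (π.rTensor H) := by
  let b := Module.finBasis k H
  have hd : ∀ x : M ⊗[k] H, π.rTensor H (M.d.rTensor H x) = N.d.rTensor H (π.rTensor H x) := by
    intro x
    rw [← LinearMap.comp_apply, ← LinearMap.comp_apply, ← LinearMap.rTensor_comp,
      ← LinearMap.rTensor_comp]
    congr 2
    exact LinearMap.ext hπ.map_d
  have hinj : ∀ x : M ⊗[k] H, M.d.rTensor H x = 0 →
      (∃ n : N ⊗[k] H, N.d.rTensor H n = π.rTensor H x) →
      ∃ m : M ⊗[k] H, M.d.rTensor H m = x := by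
    rintro x hx ⟨n, hn⟩
    have h1 : ∀ j, ∃ m : M, M.d m = contract M (b.coord j) x := fun j =>
      hπ.inj _ (by rw [← contract_rTensor, hx, map_zero])
        ⟨contract N (b.coord j) n, by rw [← contract_rTensor, hn, contract_rTensor]⟩
    choose m hm using h1
    refine ⟨∑ j, m j ⊗ₜ[k] b j, ?_⟩
    simp only [map_sum, LinearMap.rTensor_tmul, hm, sum_contract_tmul]
  have hsurj : ∀ n : N ⊗[k] H, N.d.rTensor H n = 0 → ∃ m : M ⊗[k] H, M.d.rTensor H m = 0 ∧
      ∃ n' : N ⊗[k] H, n = π.rTensor H m + N.d.rTensor H n' := by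
    intro n hn
    have h1 : ∀ j, ∃ m : M, M.d m = 0 ∧ ∃ n' : N, contract N (b.coord j) n = π m + N.d n' :=
      fun j => hπ.surj _ (by rw [← contract_rTensor, hn, map_zero])
    choose m hm n' hn' using h1
    refine ⟨∑ j, m j ⊗ₜ[k] b j, ?_, ∑ j, n' j ⊗ₜ[k] b j, ?_⟩
    · simp only [map_sum, LinearMap.rTensor_tmul, hm, TensorProduct.zero_tmul,
        Finset.sum_const_zero]
    · simp only [map_sum, LinearMap.rTensor_tmul, ← Finset.sum_add_distrib,
        ← TensorProduct.add_tmul, ← hn', sum_contract_tmul]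
  exact ⟨fun n x hx => rTensor_mem_tensorGr (hπ.map_mem n) hx, tensorAct_rTensor hπ, hd, hinj,
    hsurj⟩

/-- The endomorphism `m ⊗ w ↦ m ⊗ w u` of `M ⊗ H`. -/
noncomputable def rightMul (M : DGModule (smashDG H A)) (u : H) : M ⊗[k] H →ₗ[k] M ⊗[k] H :=
  (LinearMap.mulRight k u).lTensor M

theorem rightMul_tmul (u : H) (m : M) (w : H) :
    rightMul M u (m ⊗ₜ w) = m ⊗ₜ[k] (w * u) := rfl

/-- Right multiplication on `H` commutes with the left regular action and touches neither the first
factor nor the differential. -/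
theorem rightMul_mem_homZ (u : H) :
    (rightMul M u : M.tensorH →ₗ[k] M.tensorH) ∈ homZ M.tensorH M.tensorH 0 := by
  have h1 : ∀ n, ∀ m ∈ M.gr n, ∀ w : H, rightMul M u (m ⊗ₜ w) ∈ tensorGr H M.gr (n + 0) := by
    intro n m hm w
    rw [add_zero]
    exact Submodule.subset_span ⟨m, hm, w * u, rfl⟩
  have h2 : ∀ (j : ℤ) (a : A) (m : M) (w : H), rightMul M u (actA M a m ⊗ₜ w) =
      (0 * j).negOnePow • tensorLeft H (actA M) a (m ⊗ₜ[k] (w * u)) := by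
    intro j a m w
    rw [zero_mul, Int.negOnePow_zero, one_smul]
    rfl
  have h3 : ∀ (h : H) (m : M) (w : H), rightMul M u (tensorDiag (actH M) h (m ⊗ₜ w)) =
      tensorDiag (actH M) h (m ⊗ₜ[k] (w * u)) := by
    intro h m w
    rw [tensorDiag_apply, tensorDiag_apply, map_sum]
    simp only [rightMul_tmul, mul_assoc]
  have h4 : ∀ x : M ⊗[k] H, M.d.rTensor H (rightMul M u x) = rightMul M u (M.d.rTensor H x) := by
    intro x
    rw [rightMul, ← LinearMap.comp_apply, ← LinearMap.comp_apply, LinearMap.rTensor_comp_lTensor,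
      LinearMap.lTensor_comp_rTensor]
  exact ⟨mem_homDeg_tensorH (N := M.tensorH) h1 (fun j a _ m w => (h2 j a m w).trans
      (congrArg (fun e : Module.End k (M ⊗[k] H) => (0 * j).negOnePow • e (m ⊗ₜ[k] (w * u)))
        (actA_tensorH a).symm))
    (fun h m w => (h3 h m w).trans (congrArg (fun e : Module.End k (M ⊗[k] H) =>
      e (m ⊗ₜ[k] (w * u))) (actH_tensorH h).symm)), homD_zero_eq_zero h4⟩

end TensorModule

/-! ### `M ⊗ H` as an induced module, and its K-projectivity -/

section Free
variable {k : Type u} [Field k] {H : Type u} [Ring H] [HopfAlgebra k H]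
  [FiniteDimensional k H] [IsSemisimpleRing H]
  {A : DGAlgebra k} [Module H A] [IsScalarTower k H A] [IsDGModuleAlgebra H A]
  {M N : DGModule (smashDG H A)}

variable (M N) in
/-- The extension `m ⊗ w ↦ (w ⇀ g)(m)` to `M ⊗ H` of a map `g` on `M`. -/
noncomputable def tensorExt : (M →ₗ[k] N) →ₗ[k] (M ⊗[k] H →ₗ[k] N) where
  toFun := fun g => TensorProduct.lift ((homAct M N).toLinearMap.flip g).flip
  map_add' := fun g g' => TensorProduct.ext' fun m w => by simp
  map_smul' := fun c g => TensorProduct.ext' fun m w => by simp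

theorem tensorExt_tmul (g : M →ₗ[k] N) (m : M) (w : H) :
    tensorExt M N g (m ⊗ₜ w) = homAct M N w g m := rfl

/-- By definition the left side is `(h₍₂₎ ⇀ (w ⇀ g))(h₍₁₎ m)`, so `sum_homAct_actH` for the map `w ⇀
g` applies. -/
theorem tensorExt_diag (g : M →ₗ[k] N) (h : H) (m : M) (w : H) :
    tensorExt M N g (tensorDiag (actH M) h (m ⊗ₜ w)) = actH N h (tensorExt M N g (m ⊗ₜ w)) := by
  rw [tensorDiag_apply, map_sum]
  simp only [tensorExt_tmul, map_mul, Module.End.mul_apply]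
  exact sum_homAct_actH (homAct M N w g) h m

theorem homD_tensorExt (i : ℤ) (g : M →ₗ[k] N) (x : M ⊗[k] H) :
    N.d (tensorExt M N g x) - i.negOnePow • tensorExt M N g (M.d.rTensor H x) =
      tensorExt M N (homD M N i g) x := by
  induction x with
  | zero => simp
  | add x y hx hy => simp only [map_add, smul_add, ← hx, ← hy]; abel
  | tmul m w =>
    rw [LinearMap.rTensor_tmul, tensorExt_tmul, tensorExt_tmul, tensorExt_tmul, ← homD_homAct,
      homD_apply]

variable (M N) in
/-- `tensorExt` as an operator from `Hom_A(M,N)` to `Hom_{A # H}(M ⊗ H,N)`. -/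
noncomputable def extOp : HomOp M.res N.res M.tensorH N where
  toLin := tensorExt M N
  map_mem := fun {_ g} hg => mem_homDeg_tensorH
    (fun n m hm w => (homActRes_mem_homDeg M N w hg).1 n m hm)
    (fun j a ha m w => (homActRes_mem_homDeg M N w hg).2 j a ha m)
    (fun h m w => tensorExt_diag g h m w)
  map_homD := fun i g => LinearMap.ext fun x => homD_tensorExt i g x

theorem homAct_comp_of_linear {L : DGModule (smashDG H A)} {F : N →ₗ[k] L}
    (hF : ∀ (h : H) (n : N), F (actH N h n) = actH L h (F n)) (g : M →ₗ[k] N) (h : H) :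
    homAct M L h (F ∘ₗ g) = F ∘ₗ homAct M N h g := by
  refine LinearMap.ext fun m => ?_
  rw [LinearMap.comp_apply, homAct_apply_actH, homAct_apply_actH, map_sum]
  simp only [hF, LinearMap.comp_apply]

/-- The diagonal action on `n ⊗ 1` yields `w₍₂₎ f(S⁻¹(w₍₁₎) m) ⊗ w₍₃₎`, and coassociativity groups
the first two legs into the action on `f`. -/
theorem homAct_tmulOne_comp (f : M →ₗ[k] N) (w : H) (m : M) :
    homAct M N.tensorH w (tmulOne N ∘ₗ f) m =
      ∑ i ∈ (ℛ k w).index, homAct M N ((ℛ k w).left i) f m ⊗ₜ[k] (ℛ k w).right i := by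
  have h1 : ∀ (h : H) (n : N), actH N.tensorH h (tmulOne N n) =
      ∑ j ∈ (ℛ k h).index, actH N ((ℛ k h).left j) n ⊗ₜ[k] (ℛ k h).right j := fun h n => by
    refine (congrArg (fun e : Module.End k (N ⊗[k] H) => e (tmulOne N n))
      (actH_tensorH h)).trans ?_
    rw [tmulOne_apply, tensorDiag_apply]
    simp only [mul_one]
  have h2 := coassoc3 (k := k)
    (fun x y z => actH N y (f (actH M (antipodeInv k H x) m)) ⊗ₜ[k] z)
    (fun y z => ⟨fun x x' => by simp [TensorProduct.add_tmul],
      fun c x => by simp [TensorProduct.smul_tmul']⟩)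
    (fun y z => ⟨fun x x' => by simp [TensorProduct.add_tmul],
      fun c x => by simp [TensorProduct.smul_tmul']⟩)
    (fun y z => ⟨fun x x' => by simp [TensorProduct.tmul_add], fun c x => by simp⟩) w
  simp only [← TensorProduct.sum_tmul, ← homAct_apply_actH] at h2
  rw [h2]
  refine (homAct_apply_actH w _ m).trans (Finset.sum_congr rfl fun i _ => ?_)
  exact h1 _ _

theorem tensorExt_tmulOne : tensorExt M M.tensorH (tmulOne M) = LinearMap.id := by
  refine TensorProduct.ext' fun m w => ?_
  have h1 := homAct_tmulOne_comp (N := M) LinearMap.id w m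
  simp only [homAct_id, LinearMap.smul_apply, LinearMap.id_apply, TensorProduct.smul_tmul,
    ← TensorProduct.tmul_sum, sum_counit_smul] at h1
  exact h1

/-- An `H`-linear `F` commutes with the action on maps, so extending `F(- ⊗ 1)` is the same as
composing `F` with the extension of `m ↦ m ⊗ 1`, which is the identity. This is one half of the
induction adjunction. -/
theorem tensorExt_comp_tmulOne {i : ℤ} {F : M.tensorH →ₗ[k] N} (hF : F ∈ homDeg M.tensorH N i) :
    tensorExt M N ((F : M ⊗[k] H →ₗ[k] N) ∘ₗ tmulOne M) = F := by
  refine TensorProduct.ext' fun m w => ?_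
  have h1 := LinearMap.congr_fun (homAct_comp_of_linear (M := M) (N := M.tensorH)
    (map_actH_of_mem_homDeg hF) (tmulOne M) w) m
  refine h1.trans (congrArg F ?_)
  exact LinearMap.congr_fun tensorExt_tmulOne (m ⊗ₜ[k] w)

/-- `M ⊗ 1` generates `M ⊗ H` over `H`. This reduces identities between `A # H`-linear maps to
elements `m ⊗ 1`, where no coproducts remain to be expanded. -/
theorem homDeg_tensorH_ext {i : ℤ} {F G : M.tensorH →ₗ[k] N} (hF : F ∈ homDeg M.tensorH N i)
    (hG : G ∈ homDeg M.tensorH N i)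
    (h : ∀ m : M, (F : M ⊗[k] H →ₗ[k] N) (m ⊗ₜ 1) = (G : M ⊗[k] H →ₗ[k] N) (m ⊗ₜ 1)) :
    F = G := by
  rw [← tensorExt_comp_tmulOne hF, ← tensorExt_comp_tmulOne hG]
  congr 1
  exact LinearMap.ext h

/-- Composition of chain operators. -/
noncomputable def HomOp.comp {A B C : DGAlgebra k} {M N : DGModule A} {M' N' : DGModule B}
    {M'' N'' : DGModule C} (S : HomOp M' N' M'' N'') (T : HomOp M N M' N') :
    HomOp M N M'' N'' where
  toLin := S.toLin ∘ₗ T.toLin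
  map_mem := fun hf => S.map_mem (T.map_mem hf)
  map_homD := fun i f => (S.map_homD i _).trans (congrArg S.toLin (T.map_homD i f))

/-- Restricting a cocycle to `M ⊗ 1` gives a cocycle over `A` on the K-projective module `M.res`,
hence a coboundary. Extension commutes with differentials and recovers the original map. -/
theorem DGModule.IsKProjective.tensorH (hM : M.IsKProjective) : M.tensorH.IsKProjective := by
  intro X hX i F hF
  let S : HomOp M.tensorH X M.res X.res :=
    (conjOp tmulOne_mem_homZ (oneZ X.res).2).comp (resOp M.tensorH X)
  have h1 := (extOp M X).map_mem_homB (hM.res X.res hX i (S.map_mem_homZ hF))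
  have h2 : (extOp M X).toLin (S.toLin F) = F := tensorExt_comp_tmulOne hF.1
  exact h2 ▸ h1

/-- The resolution `P ⊗ H` of `M ⊗ H`. -/
noncomputable def KProjRes.tensorH (P : KProjRes M) : KProjRes M.tensorH where
  P := P.P.tensorH
  isKProjective := P.isKProjective.tensorH
  π := P.π.rTensor H
  isQuasiIso := P.isQuasiIso.tensorH

end Free

/-! ### Algebra maps out of a smash product -/

section SmashLift
variable {k : Type u} [Field k] {H : Type u} [Ring H] [HopfAlgebra k H]
  {B : Type u} [Ring B] [Algebra k B] [Module H B] [IsScalarTower k H B]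
  {C : Type u} [Ring C] [Algebra k C]

theorem lift_mul_smashMul {F : B →ₐ[k] C} {ρ : H →ₐ[k] C}
    (hc : ∀ (h : H) (b : B), ρ h * F b =
      ∑ i ∈ (ℛ k h).index, F ((ℛ k h).left i • b) * ρ ((ℛ k h).right i)) (x y : B ⊗[k] H) :
    TensorProduct.lift ((LinearMap.mul k C).compl₁₂ F.toLinearMap ρ.toLinearMap)
        (smashMul k H B x y) =
      TensorProduct.lift ((LinearMap.mul k C).compl₁₂ F.toLinearMap ρ.toLinearMap) x *
        TensorProduct.lift ((LinearMap.mul k C).compl₁₂ F.toLinearMap ρ.toLinearMap) y := by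
  induction x with
  | zero => rw [map_zero, LinearMap.zero_apply, map_zero, zero_mul]
  | add x x' hx hx' => rw [map_add, LinearMap.add_apply, map_add, hx, hx', map_add, add_mul]
  | tmul a h =>
    induction y with
    | zero => rw [map_zero, map_zero, mul_zero]
    | add y y' hy hy' => rw [map_add, map_add, hy, hy', map_add, mul_add]
    | tmul b g =>
      rw [smashMul_tmul, map_sum]
      change ∑ i ∈ (ℛ k h).index, F (a * ((ℛ k h).left i • b)) * ρ ((ℛ k h).right i * g) =
        F a * ρ h * (F b * ρ g)
      rw [mul_assoc, ← mul_assoc (ρ h), hc, Finset.sum_mul, Finset.mul_sum]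
      simp only [map_mul, mul_assoc]

variable [IsModuleAlgebra k H B]

/-- The universal property of the smash product. -/
noncomputable def smashAlgLift (F : B →ₐ[k] C) (ρ : H →ₐ[k] C)
    (hc : ∀ (h : H) (b : B), ρ h * F b =
      ∑ i ∈ (ℛ k h).index, F ((ℛ k h).left i • b) * ρ ((ℛ k h).right i)) :
    Smash k H B →ₐ[k] C :=
  AlgHom.ofLinearMap
    (TensorProduct.lift ((LinearMap.mul k C).compl₁₂ F.toLinearMap ρ.toLinearMap))
    (by
      change F 1 * ρ 1 = 1
      rw [map_one, map_one, one_mul])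
    (fun x y => lift_mul_smashMul hc x y)

theorem smashAlgLift_mk (F : B →ₐ[k] C) (ρ : H →ₐ[k] C) (hc) (b : B) (h : H) :
    smashAlgLift F ρ hc (smashMk k b h) = F b * ρ h := rfl

end SmashLift

/-! ### The copy of `H` in the Ext algebra of `M ⊗ H` -/

section RightMul
variable {k : Type u} [Field k] {H : Type u} [Ring H] [HopfAlgebra k H]
  {A : DGAlgebra k} [Module H A] [IsScalarTower k H A] [IsDGModuleAlgebra H A]
  (M : DGModule (smashDG H A))

theorem rightMul_one : rightMul M (1 : H) = LinearMap.id :=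
  TensorProduct.ext' fun m w => by rw [rightMul_tmul, mul_one, LinearMap.id_apply]

/-- Right multiplications reverse products under composition. The product of Ext reverses
composition again, so they give an algebra map from `H` itself, not from its opposite. -/
theorem rightMul_mul (u v : H) : rightMul M (u * v) = rightMul M v ∘ₗ rightMul M u :=
  TensorProduct.ext' fun m w => by
    rw [LinearMap.comp_apply, rightMul_tmul, rightMul_tmul, rightMul_tmul, mul_assoc]

/-- Right multiplications have degree zero, so products with them carry no sign. -/
theorem starZ_coe_of_mul_eq_zero {A : DGAlgebra k} {M : DGModule A} {i j : ℤ} (h : i * j = 0)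
    (f : homZ M M i) (g : homZ M M j) : (starZ f g).1 = g.1 ∘ₗ f.1 := by
  change (i * j).negOnePow • (g.1 ∘ₗ f.1) = _
  rw [h, Int.negOnePow_zero, one_smul]

/-- Right multiplications as cocycles. -/
noncomputable def rightMulZ : H →ₗ[k] homZ M.tensorH M.tensorH 0 where
  toFun := fun u => ⟨rightMul M u, rightMul_mem_homZ u⟩
  map_add' := fun u v => Subtype.ext (by
    have h1 : rightMul M (u + v) = rightMul M u + rightMul M v :=
      TensorProduct.ext' fun m w => by
        simp only [rightMul_tmul, LinearMap.add_apply, mul_add, TensorProduct.tmul_add]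
    exact h1)
  map_smul' := fun c u => Subtype.ext (by
    have h1 : rightMul M (c • u) = c • rightMul M u :=
      TensorProduct.ext' fun m w => by
        simp only [rightMul_tmul, LinearMap.smul_apply, mul_smul_comm, TensorProduct.tmul_smul]
    exact h1)

/-- The algebra map `H → H^*(Hom_{A # H}(M ⊗ H,M ⊗ H))`. -/
noncomputable def rightMulAlgHom : H →ₐ[k] HomHTot M.tensorH M.tensorH :=
  AlgHom.ofLinearMap
    (DirectSum.lof k ℤ (HomH M.tensorH M.tensorH) 0 ∘ₗ HomH.mk M.tensorH M.tensorH 0 ∘ₗ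
      rightMulZ M)
    (of_mk_eq rfl (f := rightMulZ M 1) (g := oneZ M.tensorH) (rightMul_one M))
    (fun u v => by
      refine Eq.trans ?_ (of_mk_mul_of_mk (rightMulZ M u) (rightMulZ M v)).symm
      refine of_mk_eq (add_zero 0).symm (f := rightMulZ M (u * v)) ?_
      exact (rightMul_mul M u v).trans (starZ_coe_of_mul_eq_zero (mul_zero 0)
        (rightMulZ M u) (rightMulZ M v)).symm)

theorem rightMulAlgHom_apply (u : H) : rightMulAlgHom M u =
    DirectSum.of _ 0 (HomH.mk M.tensorH M.tensorH 0 (rightMulZ M u)) := rfl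

end RightMul

/-! ### The Ext algebra of `M ⊗ H` as a smash product: part (iii) -/

section TensorExt
variable {k : Type u} [Field k] {H : Type u} [Ring H] [HopfAlgebra k H]
  [FiniteDimensional k H] [IsSemisimpleRing H]
  {A : DGAlgebra k} [Module H A] [IsScalarTower k H A] [IsDGModuleAlgebra H A]
  (M : DGModule (smashDG H A))

/-- The operator from `Hom_A(M,M)` to `Hom_{A # H}(M ⊗ H,M ⊗ H)` sending `f` to
`m ⊗ w ↦ (w₍₁₎ ⇀ f)(m) ⊗ w₍₂₎`, see `freeMap_tmul`. -/
noncomputable def freeOp : HomOp M.res M.res M.tensorH M.tensorH :=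
  (extOp M M.tensorH).comp (conjOp (oneZ M.res).2 tmulOne_mem_homZ)

variable {M}

/-- `freeOp` on the underlying spaces. -/
noncomputable def freeMap (f : M →ₗ[k] M) : M ⊗[k] H →ₗ[k] M ⊗[k] H := (freeOp M).toLin f

theorem freeMap_tmul (f : M →ₗ[k] M) (m : M) (w : H) : freeMap f (m ⊗ₜ w) =
    ∑ i ∈ (ℛ k w).index, homAct M M ((ℛ k w).left i) f m ⊗ₜ[k] (ℛ k w).right i :=
  homAct_tmulOne_comp f w m

theorem freeMap_tmul_one (f : M →ₗ[k] M) (m : M) : freeMap f (m ⊗ₜ (1 : H)) = f m ⊗ₜ 1 := by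
  have h1 : homAct M M.tensorH 1 (tmulOne M ∘ₗ f) m = tmulOne M (f m) := by
    rw [map_one, Module.End.one_apply]
    rfl
  exact h1

theorem freeMap_freeMap_tmul_one (f g : M →ₗ[k] M) (m : M) :
    freeMap g (freeMap f (m ⊗ₜ (1 : H))) = g (f m) ⊗ₜ 1 := by
  rw [freeMap_tmul_one, freeMap_tmul_one]

theorem freeMap_rightMul_tmul_one (f : M →ₗ[k] M) (u : H) (m : M) :
    freeMap f (rightMul M u (m ⊗ₜ 1)) = ∑ l ∈ (ℛ k u).index,
      rightMul M ((ℛ k u).right l) (freeMap (homAct M M ((ℛ k u).left l) f) (m ⊗ₜ 1)) := by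
  rw [rightMul_tmul, one_mul, freeMap_tmul]
  simp only [freeMap_tmul_one, rightMul_tmul, one_mul]

theorem contract_rightMul_freeMap (ξ : H →ₗ[k] k) (f : M →ₗ[k] M) (u : H) (m : M) :
    contract M ξ (rightMul M u (freeMap f (m ⊗ₜ 1))) = ξ u • f m := by
  rw [freeMap_tmul_one, rightMul_tmul, one_mul, contract_tmul]

/-- Expanding `F(m ⊗ 1)` in a basis of `H` recovers `F` from its components `m ↦ (id ⊗ b_j^*)(F(m ⊗
1))`. This is the formula behind the inverse isomorphism. -/
theorem sum_rightMul_freeMap_contract {ι : Type*} [Fintype ι] (b : Module.Basis ι k H)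
    (F : M ⊗[k] H →ₗ[k] M ⊗[k] H) (m : M) :
    ∑ j, rightMul M (b j) (freeMap (contract M (b.coord j) ∘ₗ F ∘ₗ tmulOne M) (m ⊗ₜ 1)) =
      F (m ⊗ₜ 1) := by
  simp only [freeMap_tmul_one, rightMul_tmul, one_mul, LinearMap.comp_apply]
  exact sum_contract_tmul b (F (m ⊗ₜ 1))

theorem freeMap_mem {i : ℤ} {f : M.res →ₗ[k] M.res} (hf : f ∈ homDeg M.res M.res i) :
    (freeMap (M := M) f : M.tensorH →ₗ[k] M.tensorH) ∈ homDeg M.tensorH M.tensorH i :=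
  (freeOp M).map_mem hf

theorem freeMap_id : freeMap (LinearMap.id : M →ₗ[k] M) = LinearMap.id :=
  homDeg_tensorH_ext (i := 0) (freeMap_mem (oneZ M.res).2.1) (oneZ M.tensorH).2.1
    fun m => freeMap_tmul_one LinearMap.id m

/-- Both sides are `A # H`-linear and send `m ⊗ 1` to `g(f(m)) ⊗ 1`. The identity holds for
cochains, without homotopies. -/
theorem freeMap_comp {i j : ℤ} {f g : M.res →ₗ[k] M.res} (hf : f ∈ homDeg M.res M.res i)
    (hg : g ∈ homDeg M.res M.res j) :
    freeMap (M := M) (g ∘ₗ f) = freeMap (M := M) g ∘ₗ freeMap (M := M) f := by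
  refine homDeg_tensorH_ext (i := i + j) (freeMap_mem (comp_mem_homDeg hf hg))
    (comp_mem_homDeg (freeMap_mem hf) (freeMap_mem hg)) fun m => ?_
  exact (freeMap_tmul_one (M := M) (g ∘ₗ f) m).trans
    (freeMap_freeMap_tmul_one (M := M) f g m).symm

/-- On `m ⊗ 1` the left side is `(u₍₁₎ ⇀ f)(m) ⊗ u₍₂₎`, which is the right side applied to `m ⊗ 1`.
Read in the reversed product, this is the commutation relation of the smash product. -/
theorem freeMap_rightMul {i : ℤ} {f : M.res →ₗ[k] M.res} (hf : f ∈ homDeg M.res M.res i) (u : H) :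
    freeMap (M := M) f ∘ₗ rightMul M u = ∑ l ∈ (ℛ k u).index,
      rightMul M ((ℛ k u).right l) ∘ₗ freeMap (homAct M M ((ℛ k u).left l) f) := by
  have h1 := comp_mem_homDeg (rightMul_mem_homZ (M := M) u).1 (freeMap_mem hf)
  rw [zero_add] at h1
  have h2 : (∑ l ∈ (ℛ k u).index, rightMul M ((ℛ k u).right l) ∘ₗ
      freeMap (homAct M M ((ℛ k u).left l) f) : M ⊗[k] H →ₗ[k] M ⊗[k] H) ∈
      homDeg M.tensorH M.tensorH i := by
    refine Submodule.sum_mem (homDeg M.tensorH M.tensorH i) fun l _ => ?_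
    have h3 := comp_mem_homDeg (freeMap_mem (homActRes_mem_homDeg M M ((ℛ k u).left l) hf))
      (rightMul_mem_homZ (M := M) ((ℛ k u).right l)).1
    rw [add_zero] at h3
    exact h3
  refine homDeg_tensorH_ext h1 h2 fun m => ?_
  refine (freeMap_rightMul_tmul_one (M := M) f u m).trans (Eq.symm ?_)
  exact LinearMap.sum_apply (M := M ⊗[k] H) (M₂ := M ⊗[k] H) _ _ _

variable (M)

/-- The algebra map `H^*(Hom_A(M,M)) → H^*(Hom_{A # H}(M ⊗ H,M ⊗ H))`. -/
noncomputable def freeAlgHom : HomHTot M.res M.res →ₐ[k] HomHTot M.tensorH M.tensorH :=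
  (freeOp M).algHom ((sub_eq_zero.2 (freeMap_id (M := M))) ▸ Submodule.zero_mem _)
    fun _ _ _ hf _ hg => (sub_eq_zero.2 (freeMap_comp hf.1 hg.1)) ▸ Submodule.zero_mem _

theorem freeAlgHom_of_mk (i : ℤ) (f : homZ M.res M.res i) :
    freeAlgHom M (DirectSum.of _ i (HomH.mk M.res M.res i f)) =
      DirectSum.of _ i (HomH.mk M.tensorH M.tensorH i ((freeOp M).mapZ i f)) :=
  (freeOp M).mapTot_of_mk i f

/-- The cocycle `m ⊗ w ↦ (w₍₁₎ ⇀ f)(m) ⊗ w₍₂₎ u`. -/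
noncomputable def freeRightZ {i : ℤ} (f : homZ M.res M.res i) (u : H) :
    homZ M.tensorH M.tensorH i :=
  ⟨(rightMulZ M u).1 ∘ₗ ((freeOp M).mapZ i f).1, by
    have := comp_mem_homZ ((freeOp M).mapZ i f).2 (rightMulZ M u).2
    rwa [add_zero] at this⟩

theorem freeAlgHom_mul_rightMulAlgHom {i : ℤ} (f : homZ M.res M.res i) (u : H) :
    freeAlgHom M (DirectSum.of _ i (HomH.mk M.res M.res i f)) * rightMulAlgHom M u =
      DirectSum.of _ i (HomH.mk M.tensorH M.tensorH i (freeRightZ M f u)) := by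
  rw [freeAlgHom_of_mk, rightMulAlgHom_apply, of_mk_mul_of_mk]
  refine of_mk_eq (add_zero i) ?_
  exact starZ_coe_of_mul_eq_zero (mul_zero i) _ _

theorem rightMulAlgHom_mul_freeAlgHom (u : H) (x : HomHTot M.res M.res) :
    rightMulAlgHom M u * freeAlgHom M x = ∑ l ∈ (ℛ k u).index,
      freeAlgHom M ((ℛ k u).left l • x) * rightMulAlgHom M ((ℛ k u).right l) := by
  induction x using homHTot_induction with
  | h0 => simp
  | h2 x y hx hy => simp only [map_add, mul_add, smul_add, add_mul, hx, hy, Finset.sum_add_distrib]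
  | h1 i f =>
    simp only [smul_of, smul_mk, freeAlgHom_mul_rightMulAlgHom, ← map_sum]
    rw [freeAlgHom_of_mk, rightMulAlgHom_apply, of_mk_mul_of_mk]
    refine of_mk_eq (zero_add i) ?_
    rw [starZ_coe_of_mul_eq_zero (zero_mul i), AddSubmonoidClass.coe_finsetSum]
    exact freeMap_rightMul f.2.1 u

/-- The algebra map `H^*(Hom_A(M,M)) # H → H^*(Hom_{A # H}(M ⊗ H,M ⊗ H))`. -/
noncomputable def smashToTensor :
    Smash k H (HomHTot M.res M.res) →ₐ[k] HomHTot M.tensorH M.tensorH :=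
  smashAlgLift (freeAlgHom M) (rightMulAlgHom M) (rightMulAlgHom_mul_freeAlgHom M)

/-- The operator `F ↦ (id ⊗ ξ) ∘ F(- ⊗ 1)`. -/
noncomputable def contractOp (ξ : H →ₗ[k] k) : HomOp M.tensorH M.tensorH M.res M.res :=
  (conjOp tmulOne_mem_homZ (contract_mem_homZ ξ)).comp (resOp M.tensorH M.tensorH)

/-- The inverse of `smashToTensor`. -/
noncomputable def tensorToSmash (x : HomHTot M.tensorH M.tensorH) :
    Smash k H (HomHTot M.res M.res) :=
  ∑ j, smashMk k ((contractOp M ((Module.finBasis k H).coord j)).mapTot x) (Module.finBasis k H j)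

theorem contractOp_freeRightZ (ξ : H →ₗ[k] k) {i : ℤ} (f : homZ M.res M.res i) (u : H) :
    (contractOp M ξ).mapZ i (freeRightZ M f u) = ξ u • f := by
  refine Subtype.ext (LinearMap.ext fun m => ?_)
  exact contract_rightMul_freeMap (M := M) ξ f.1 u m

theorem contractOp_smashToTensor_mk (ξ : H →ₗ[k] k) (x : HomHTot M.res M.res) (u : H) :
    (contractOp M ξ).mapTot (smashToTensor M (smashMk k x u)) = ξ u • x := by
  rw [smashToTensor, smashAlgLift_mk]
  induction x using homHTot_induction with
  | h0 => simp
  | h2 x y hx hy => rw [map_add, add_mul, map_add, hx, hy, smul_add]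
  | h1 i f =>
    rw [freeAlgHom_mul_rightMulAlgHom, HomOp.mapTot_of_mk, contractOp_freeRightZ, map_smul]
    exact (DirectSum.lof k ℤ (HomH M.res M.res) i).map_smul (ξ u) _

theorem tensorToSmash_smashToTensor (y : Smash k H (HomHTot M.res M.res)) :
    tensorToSmash M (smashToTensor M y) = y := by
  induction y using smash_induction with
  | h0 =>
    simp only [tensorToSmash, map_zero]
    exact Finset.sum_eq_zero fun j _ => TensorProduct.zero_tmul _ _
  | h2 x y hx hy =>
    conv_rhs => rw [← hx, ← hy]
    simp only [tensorToSmash, map_add, smashMk_add, Finset.sum_add_distrib]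
  | h1 x u =>
    simp only [tensorToSmash, contractOp_smashToTensor_mk]
    have h1 := sum_contract_tmul (Module.finBasis k H) (x ⊗ₜ[k] u)
    simp only [contract_tmul] at h1
    exact h1

theorem smashToTensor_tensorToSmash (x : HomHTot M.tensorH M.tensorH) :
    smashToTensor M (tensorToSmash M x) = x := by
  rw [tensorToSmash, map_sum]
  simp only [smashToTensor, smashAlgLift_mk]
  induction x using homHTot_induction with
  | h0 => simp
  | h2 x y hx hy => simp only [map_add, add_mul, Finset.sum_add_distrib, hx, hy]
  | h1 i F =>
    simp only [HomOp.mapTot_of_mk, freeAlgHom_mul_rightMulAlgHom, ← map_sum]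
    refine of_mk_eq rfl ?_
    -- The two sides agree as cochains and not only as classes: both are `A # H`-linear, and on `M ⊗
    -- 1` the equality is the basis expansion of `F(m ⊗ 1)`.
    refine homDeg_tensorH_ext (i := i) (SetLike.coe_mem _ : _ ∈ homZ M.tensorH M.tensorH i).1
      F.2.1 fun m => ?_
    rw [AddSubmonoidClass.coe_finsetSum]
    refine Eq.trans ?_ (sum_rightMul_freeMap_contract (Module.finBasis k H) F.1 m)
    exact LinearMap.sum_apply (M := M ⊗[k] H) (M₂ := M ⊗[k] H) _ _ _

/-- `H^*(Hom_{A # H}(M ⊗ H,M ⊗ H)) ≅ H^*(Hom_A(M,M)) # H` as algebras. -/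
noncomputable def tensorEquivSmash :
    HomHTot M.tensorH M.tensorH ≃ₐ[k] Smash k H (HomHTot M.res M.res) :=
  (AlgEquiv.ofBijective (smashToTensor M)
    ⟨Function.LeftInverse.injective (tensorToSmash_smashToTensor M),
      Function.RightInverse.surjective (smashToTensor_tensorToSmash M)⟩).symm

theorem tensorEquivSmash_apply (x : HomHTot M.tensorH M.tensorH) :
    tensorEquivSmash M x = tensorToSmash M x := by
  rw [tensorEquivSmash, AlgEquiv.symm_apply_eq]
  exact (smashToTensor_tensorToSmash M x).symm

/-- Right multiplications and contractions have degree zero, so the isomorphism and its inverse both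
preserve degrees. -/
theorem tensorEquivSmash_mem_iff {i : ℤ} {x : HomHTot M.tensorH M.tensorH} :
    tensorEquivSmash M x ∈ smashGr H (homHGr M.res M.res) i ↔ x ∈ homHGr M.tensorH M.tensorH i := by
  rw [tensorEquivSmash_apply]
  constructor
  · intro hx
    rw [← smashToTensor_tensorToSmash M x]
    generalize tensorToSmash M x = z at hx
    induction hx using Submodule.span_induction with
    | zero => rw [map_zero]; exact Submodule.zero_mem _
    | add x y _ _ hx hy => rw [map_add]; exact Submodule.add_mem _ hx hy
    | smul c x _ hx => rw [map_smul]; exact Submodule.smul_mem _ _ hx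
    | mem x hx =>
      obtain ⟨_, ⟨b, rfl⟩, h, rfl⟩ := hx
      obtain ⟨f, rfl⟩ := HomH.mk_surjective M.res M.res i b
      rw [smashToTensor, smashAlgLift_mk]
      have h1 := freeAlgHom_mul_rightMulAlgHom M f h
      exact h1 ▸ of_mem_homHGr i _
  · rintro ⟨y, rfl⟩
    exact Submodule.sum_mem _ fun j _ => Submodule.subset_span
      ⟨_, ⟨_, ((contractOp M ((Module.finBasis k H).coord j)).mapTot_of i y).symm⟩, _, rfl⟩

/-- The given resolution `R` of `M ⊗ H` is compared with the particular resolution `P ⊗ H`, for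
which the cochain formulas are available. -/
theorem exists_ext_tensorH_algEquiv_smash {M : DGModule (smashDG H A)} (P : KProjRes M)
    (R : KProjRes M.tensorH) : ∃ e : Ext R R ≃ₐ[k] Smash k H (ExtRes P P),
      ∀ (i : ℤ) (x : Ext R R), x ∈ extGr R R i ↔ e x ∈ smashGr H (extResGr P P) i := by
  obtain ⟨e, he⟩ := exists_ext_algEquiv R P.tensorH
  exact ⟨e.trans (tensorEquivSmash P.P), fun i x =>
    (he i x).trans (tensorEquivSmash_mem_iff P.P).symm⟩

end TensorExt

end DGHopf

theorem corollary2p9 {k : Type u} [Field k] [IsAlgClosed k] [CharZero k]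
    {H : Type u} [Ring H] [HopfAlgebra k H] [FiniteDimensional k H] [IsSemisimpleRing H]
    (A : DGHopf.DGAlgebra.{u} k) [Module H A] [IsScalarTower k H A]
    [DGHopf.IsDGModuleAlgebra H A] :
    -- K-projective dg `A # H`-modules are K-projective over `A`, so that `ExtRes` is `Ext_A`
    (∀ P : DGHopf.DGModule (DGHopf.smashDG H A), P.IsKProjective → P.res.IsKProjective) ∧
    -- `Ext_{A#H}(M,N) ≅ Ext_A(M,N)^H`, degreewise
    (∀ (M N : DGHopf.DGModule (DGHopf.smashDG H A))
      (P P' : DGHopf.KProjRes M) (Q Q' : DGHopf.KProjRes N),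
      ∃ e : DGHopf.Ext P Q ≃ₗ[k] DGHopf.invariants k H (DGHopf.ExtRes P' Q'),
        ∀ (i : ℤ) (x : DGHopf.Ext P Q),
          x ∈ DGHopf.extGr P Q i ↔ (e x : DGHopf.ExtRes P' Q') ∈ DGHopf.extResGr P' Q' i) ∧
    -- `Ext_{A#H}(M,M) ≅ Ext_A(M,M)^H` as graded algebras
    (∀ (M : DGHopf.DGModule (DGHopf.smashDG H A)) (P P' : DGHopf.KProjRes M),
      ∃ e : DGHopf.Ext P P ≃ₐ[k] DGHopf.invariantSubalgebra k H (DGHopf.ExtRes P' P'),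
        ∀ (i : ℤ) (x : DGHopf.Ext P P),
          x ∈ DGHopf.extGr P P i ↔ (e x : DGHopf.ExtRes P' P') ∈ DGHopf.extResGr P' P' i) ∧
    -- `Ext_{A#H}(M ⊗ H, M ⊗ H) ≅ Ext_A(M,M) # H` as graded algebras
    (∀ (M : DGHopf.DGModule (DGHopf.smashDG H A)) (P' : DGHopf.KProjRes M)
      (R : DGHopf.KProjRes M.tensorH),
      ∃ e : DGHopf.Ext R R ≃ₐ[k] DGHopf.Smash k H (DGHopf.ExtRes P' P'),
        ∀ (i : ℤ) (x : DGHopf.Ext R R),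
          x ∈ DGHopf.extGr R R i ↔ e x ∈ DGHopf.smashGr H (DGHopf.extResGr P' P') i) := by
  exact ⟨fun _ hP => hP.res, fun _ _ P P' Q Q' => DGHopf.exists_ext_equiv_invariants P P' Q Q',
    fun _ P P' => DGHopf.exists_ext_algEquiv_invariants P P',
    fun _ P' R => DGHopf.exists_ext_tensorH_algEquiv_smash P' R⟩
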